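/- **Definitions.** All graphs are finite and simple. Let $d$ be a degree function on the vertices of a graph $G$ (by default $d=\deg_G$). A *strong transitive partition* of $G$ of order $k$ is a partition of $V(G)$ into non-empty sets $V_1,\dots,V_k$ such that for all $1\le i<j\le k$ every $y\in V_j$ has a neighbour $x\in V_i$ with $d(x)\ge d(y)$. The *strong transitivity* $Tr_{st}(G)$ is the largest order of a strong transitive partition of $G$. The *strong transitive number* $st(v,G)$ of a vertex $v$ is the largest $p$ such that $v\in V_p$ for some strong transitive partition $\{V_1,\dots,V_k\}$ of $G$. The Maximum Strong Transitivity Problem (MSTP) asks for a strong transitive partition of maximum order. For a tree $T$ and a vertex $c$, let $T^c$ be $T$ rooted at $c$, and let $T^c_v$ be the subtree of $T^c$ rooted at $v$ (induced by the vertices $w$ such that $v$ lies on the path from $c$ to $w$). The *modified rooted strong transitive number* $mst^r(v,T^c)$ is the strong transitive number of $v$ in $T^c_v$, computed with the degree of $v$ raised by $1$ if $v\ne c$ (all other degrees are those in $T^c_v$). A child $v$ of $x$ in $T^x$ is *required*, written $R(v)=1$, if the strong transitive number of $x$ in $T\setminus T^x_v$, computed with $x$ keeping its degree $\deg_T(x)$,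 equals $st(x,T)-1$; otherwise $R(v)=0$. The machine model is a random access machine with finitely many registers and arrays of natural numbers, with the instructions constant, copy, addition, truncated subtraction, indirect load and store, and with branches and loops controlled by tests $a<b$ between registers. Every instruction and every test costs one step. **Theorem.** The MSTP can be solved in linear time for trees. That is, there are one program and one constant $C$ such that for every tree $T$ with vertex set $\{0,\dots,n-1\}$, $n\ge 1$, given by $n$ and by adjacency lists in arbitrary order, the program halts after at most $Cn$ steps, never writes a number larger than $Cn$, and outputs $Tr_{st}(T)$, the numbers $st(v,T)$ of all vertices $v$, and a strong transitive partition of $T$ of order $Tr_{st}(T)$. Moreover, the following rules hold for every finite tree $T$. 1. $Tr_{st}(T)=\max_{v\in V(T)} st(v,T)$. 2. Let $v_1,\dots,v_k$ be the children of $x$ in $T^c$ and put $l_i=mst^r(v_i,T^c)$, where $l_1\le\dots\le l_k$. Let $z$ be the largest integer for which there are indices $i_1<\dots<i_z$ with $l_{i_q}\ge q$ and $\deg_T(v_{i_q})\ge\deg_T(x)$ for all $1\le q\le z$. Then $mst^r(x,T^c)=1+z$. 3. $mst^r(c,T^c)=st(c,T)$ for every vertex $c$, and $mst^r(v,T^x)=mst^r(v,T^c)$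 whenever $v$ is a child of $x$ in $T^c$. 4. If $x$ and $v$ are adjacent, then $mst^r(x,T^v)=st(x,T)-1$ if $v$ is a required child of $x$ in $T^x$, and $mst^r(x,T^v)=st(x,T)$ otherwise. 5. Let $v_1,\dots,v_k$ be the children of $x$ in $T^x$, let $z=st(x,T)$ and $l_i=mst^r(v_i,T^x)$, and let $0\le p\le k$ be such that $\deg_T(v_i)<k$ for $i\le p$, $\deg_T(v_i)\ge k$ for $i>p$, and $l_{p+1}\le\dots\le l_k$. Then: (a) if $k=z-1$, then $R(v_i)=1$ for all $i$; (b) if $k>z-1$ and $k-p=z-1$, then $R(v_i)=0$ for $i\le p$ and $R(v_i)=1$ for $i>p$; (c) if $k>z-1$ and $k-p>z-1$, then $R(v_i)=0$ for all $i\le p$ and for all $p+1\le i\le k-z+1$; (d) if $k>z-1$, $k-p>z-1$, $k-z+2\le i\le k$, and $l_{j-1}\ge j-(k-z+1)$ for all $k-z+2\le j\le i$, then $R(v_i)=0$; (e) if $k>z-1$, $k-p>z-1$, $k-z+2\le i\le k$, and $l_{j-1}<j-(k-z+1)$ for some $k-z+2\le j\le i$, then $R(v_i)=1$. -/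

import Mathlib

/-! ### Strong transitive partitions -/

namespace StrongTrans

/-- The degree of `v` in the finite graph `G`. -/
noncomputable def deg {V : Type*} [Finite V] (G : SimpleGraph V) (v : V) : ℕ :=
  haveI := Fintype.ofFinite (G.neighborSet v)
  G.degree v

/-- `A` strongly dominates `B` in `G`, where `d` is the degree function that is used:
every `y ∈ B` has a neighbour `x ∈ A` with `d x ≥ d y`. -/
def StronglyDominates {V : Type*} (G : SimpleGraph V) (d : V → ℕ) (A B : Set V) : Prop :=
  ∀ y ∈ B, ∃ x ∈ A, G.Adj x y ∧ d y ≤ d x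

/-- `f` describes a strong transitive partition `V_1, …, V_k` of the vertex set of `G` (with
degree function `d`): the parts `V_i = {v | f v = i}`, `1 ≤ i ≤ k`, are non-empty and cover all
vertices, and `V_i` strongly dominates `V_j` for all `1 ≤ i < j ≤ k`. -/
structure IsStrongTransitivePartition {V : Type*} (G : SimpleGraph V) (d : V → ℕ) (k : ℕ)
    (f : V → ℕ) : Prop where
  mem_Icc : ∀ v, f v ∈ Set.Icc 1 k
  nonempty : ∀ i ∈ Set.Icc 1 k, {v | f v = i}.Nonempty
  dominates : ∀ i j, 1 ≤ i → i < j → j ≤ k →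
    StronglyDominates G d {v | f v = i} {v | f v = j}

/-- The strong transitivity `Tr_st(G)`: the largest order of a strong transitive partition. -/
noncomputable def strongTransitivity {V : Type*} [Finite V] (G : SimpleGraph V) : ℕ :=
  sSup {k | ∃ f, IsStrongTransitivePartition G (deg G) k f}

/-- The largest `p` such that `v ∈ V_p` for some strong transitive partition of `G` with degree
function `d`. -/
noncomputable def strongNumber {V : Type*} (G : SimpleGraph V) (d : V → ℕ) (v : V) : ℕ :=
  sSup {p | ∃ k f, IsStrongTransitivePartition G d k f ∧ f v = p}

/-- The strong transitive number `st(v, G)`. -/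
noncomputable def st {V : Type*} [Finite V] (G : SimpleGraph V) (v : V) : ℕ :=
  strongNumber G (deg G) v

/-! ### Rooted trees -/

/-- The vertex set of `T_v^c`, the subtree rooted at `v` of the tree `G` rooted at `c`:
the vertices `w` such that `v` lies on the path from `c` to `w`. -/
def subtree {V : Type*} (G : SimpleGraph V) (c v : V) : Set V :=
  {w | ∀ p : G.Walk c w, p.IsPath → v ∈ p.support}

theorem self_mem_subtree {V : Type*} (G : SimpleGraph V) (c v : V) : v ∈ subtree G c v :=
  fun p _ => p.end_mem_support

theorem root_mem_compl_subtree {V : Type*} {G : SimpleGraph V} {x v : V} (h : G.Adj x v) :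
    x ∈ (subtree G x v)ᶜ := fun hx => by
  have := hx SimpleGraph.Walk.nil SimpleGraph.Walk.IsPath.nil
  simp only [SimpleGraph.Walk.support_nil, List.mem_singleton] at this
  exact h.ne this.symm

/-- The children of `x` in the tree `G` rooted at `c`. -/
def children {V : Type*} (G : SimpleGraph V) (c x : V) : Set V :=
  {v | G.Adj x v ∧ v ∈ subtree G c x}

open Classical in
/-- The degree function of `G` with the degree of the vertex `v` raised by `e`. -/
noncomputable def raisedDeg {V : Type*} [Finite V] (G : SimpleGraph V) (v : V) (e : ℕ)
    (w : V) : ℕ :=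
  deg G w + if w = v then e else 0

open Classical in
/-- The modified rooted strong transitive number `mst^r(v, T^c)`: the strong transitive number
of `v` in the tree `T_v^c`, where the degree of `v` is taken one larger if `v` is not the
root `c`. -/
noncomputable def mst {V : Type*} [Finite V] (G : SimpleGraph V) (c v : V) : ℕ :=
  strongNumber (G.induce (subtree G c v))
    (raisedDeg (G.induce (subtree G c v)) ⟨v, self_mem_subtree G c v⟩ (if v = c then 0 else 1))
    ⟨v, self_mem_subtree G c v⟩

/-- The child `v` of the root `x` is required: deleting the subtree `T_v^x` lowers the strong
transitive number of `x` by one. The degree of `x` is not changed by the deletion, so that the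
degree of `x` in the remaining tree is raised by one. -/
def Required {V : Type*} [Finite V] {G : SimpleGraph V} {x v : V} (h : G.Adj x v) : Prop :=
  strongNumber (G.induce (subtree G x v)ᶜ)
    (raisedDeg (G.induce (subtree G x v)ᶜ) ⟨x, root_mem_compl_subtree h⟩ 1)
    ⟨x, root_mem_compl_subtree h⟩ + 1 = st G x

/-! ### A random access machine -/

/-- A memory state: registers and arrays (indexed by `ℕ`), all of whose cells hold natural
numbers. A program mentions only finitely many registers and arrays. -/
structure Memory where
  reg : ℕ → ℕ
  arr : ℕ → ℕ → ℕ

/-- `x := k`. -/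
def Memory.setReg (s : Memory) (x k : ℕ) : Memory :=
  { s with reg := Function.update s.reg x k }

/-- `a[i] := k`. -/
def Memory.setArr (s : Memory) (a i k : ℕ) : Memory :=
  { s with arr := Function.update s.arr a (Function.update (s.arr a) i k) }

/-- Programs of the machine. Below, `x y z` name registers and `a` names an array. -/
inductive Program where
  /-- do nothing -/
  | skip : Program
  /-- `x := k` -/
  | const (x k : ℕ) : Program
  /-- `x := y` -/
  | copy (x y : ℕ) : Program
  /-- `x := y + z` -/
  | add (x y z : ℕ) : Program
  /-- `x := max (y - z) 0` -/
  | sub (x y z : ℕ) : Program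
  /-- `x := a[y]` -/
  | load (x a y : ℕ) : Program
  /-- `a[x] := y` -/
  | store (a x y : ℕ) : Program
  /-- `P; Q` -/
  | seq (P Q : Program) : Program
  /-- `if x < y then P else Q` -/
  | ite (x y : ℕ) (P Q : Program) : Program
  /-- `while x < y do P` -/
  | loop (x y : ℕ) (P : Program) : Program

/-- `Exec W P s t s'`: started in the memory state `s`, the program `P` halts after exactly `t`
steps in the memory state `s'`, and every number that it writes is at most `W`
(an execution that would write a larger number is stuck). Each elementary instruction and each
evaluation of a test is one step. -/
inductive Exec (W : ℕ) : Program → Memory → ℕ → Memory → Prop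
  | skip (s : Memory) : Exec W .skip s 1 s
  | const (s : Memory) (x k : ℕ) (h : k ≤ W) : Exec W (.const x k) s 1 (s.setReg x k)
  | copy (s : Memory) (x y : ℕ) (h : s.reg y ≤ W) :
      Exec W (.copy x y) s 1 (s.setReg x (s.reg y))
  | add (s : Memory) (x y z : ℕ) (h : s.reg y + s.reg z ≤ W) :
      Exec W (.add x y z) s 1 (s.setReg x (s.reg y + s.reg z))
  | sub (s : Memory) (x y z : ℕ) (h : s.reg y - s.reg z ≤ W) :
      Exec W (.sub x y z) s 1 (s.setReg x (s.reg y - s.reg z))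
  | load (s : Memory) (x a y : ℕ) (h : s.arr a (s.reg y) ≤ W) :
      Exec W (.load x a y) s 1 (s.setReg x (s.arr a (s.reg y)))
  | store (s : Memory) (a x y : ℕ) (h : s.reg y ≤ W) :
      Exec W (.store a x y) s 1 (s.setArr a (s.reg x) (s.reg y))
  | seq {P Q : Program} {s s₁ s₂ : Memory} {t₁ t₂ : ℕ} (h₁ : Exec W P s t₁ s₁)
      (h₂ : Exec W Q s₁ t₂ s₂) : Exec W (.seq P Q) s (t₁ + t₂) s₂
  | ite_true {x y : ℕ} {P Q : Program} {s s₁ : Memory} {t : ℕ} (hxy : s.reg x < s.reg y)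
      (h : Exec W P s t s₁) : Exec W (.ite x y P Q) s (t + 1) s₁
  | ite_false {x y : ℕ} {P Q : Program} {s s₁ : Memory} {t : ℕ} (hxy : ¬ s.reg x < s.reg y)
      (h : Exec W Q s t s₁) : Exec W (.ite x y P Q) s (t + 1) s₁
  | loop_true {x y : ℕ} {P : Program} {s s₁ s₂ : Memory} {t₁ t₂ : ℕ}
      (hxy : s.reg x < s.reg y) (h₁ : Exec W P s t₁ s₁) (h₂ : Exec W (.loop x y P) s₁ t₂ s₂) :
      Exec W (.loop x y P) s (t₁ + t₂ + 1) s₂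
  | loop_false {x y : ℕ} {P : Program} {s : Memory} (hxy : ¬ s.reg x < s.reg y) :
      Exec W (.loop x y P) s 1 s

/-- The arrays `off` and `nbr` are an adjacency-list representation of the graph `G` with
vertices `0, …, n - 1`: the cells `nbr[off[v]], …, nbr[off[v+1] - 1]` list the neighbours of `v`,
each exactly once, in an arbitrary order. Unused cells hold `0`. -/
structure IsAdjList {n : ℕ} (G : SimpleGraph (Fin n)) (off nbr : ℕ → ℕ) : Prop where
  off_zero : off 0 = 0
  off_le : ∀ v < n, off v ≤ off (v + 1)
  bijOn : ∀ v : Fin n,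
    Set.BijOn nbr (Set.Ico (off v) (off (v + 1))) (Fin.val '' G.neighborSet v)
  off_unused : ∀ i, n < i → off i = 0
  nbr_unused : ∀ i, off n ≤ i → nbr i = 0

/-- The initial memory: register `0` holds `n`, arrays `0` and `1` hold the adjacency lists,
everything else is `0`. -/
def inputMemory (n : ℕ) (off nbr : ℕ → ℕ) : Memory where
  reg := fun x => if x = 0 then n else 0
  arr := fun a => if a = 0 then off else if a = 1 then nbr else fun _ => 0

/-- The final memory `s` answers the maximum strong transitivity problem for `G`: register `0`
holds `Tr_st(G)`, array `2` holds the strong transitive numbers of the vertices, and array `3`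
holds a strong transitive partition of order `Tr_st(G)`. -/
structure IsSolution {n : ℕ} (G : SimpleGraph (Fin n)) (s : Memory) : Prop where
  order : s.reg 0 = strongTransitivity G
  number : ∀ v : Fin n, s.arr 2 v = st G v
  partition : IsStrongTransitivePartition G (deg G) (strongTransitivity G)
    (fun v : Fin n => s.arr 3 v)

end StrongTrans

namespace StrongTrans

/-! ### Reasoning about programs -/

/-! Mathematics. Cutting the edge between `x` and a neighbour `u` leaves the component `branch G x
u` of `u`. Branches at `x` are disjoint and meet the rest of the tree only at `x`, so their
partitions can be chosen independently. A partition with `u` in class `p` gives one with `u` in any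
smaller class `q`: truncate all classes at `q`. Conversely, if the class of `u` is below that of
`x`, then `u` never needs `x` as a dominator, and the partition restricts to the branch. Hence `st G
x = 1 + z`, where `z` is the largest number such that the slots `1, …, z` can be given to distinct
neighbours `u` of degree at least that of `x`, each slot being at most the number of `u` in its
branch (`setNumber_eq_fill`). Raising a degree by one in `mst` and `Required` restores exactly what
the cut removes, so all numbers use the degrees of the whole tree (`raisedDeg_induce`).

By a Hall type argument `z` is the minimum over `j` of `j` plus the number of neighbours with weight
above `j` (`le_fill_iff_exists_injective`). Deleting `u` lowers the term at `j` exactly when `j` is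
below the weight of `u`. So `u` is required if and only if some minimiser lies below its weight
(`fill_sdiff_add_one_iff`). The rerooting rule and the rules for required children are consequences
of this criterion.

Algorithm. Only the smallest minimiser matters for the criterion. Stored as a threshold at each
vertex, it gives the number of a parent in the branch away from a child in constant time
(`branchNumber_eq_of_isMinAt`). Values can be capped at the degree `k`, so counting sort finds `z`,
the threshold and an optimal assignment of slots in time proportional to `k + 1` (`runs_fillSlots`).
An upward sweep computes `mst` for one root and a downward sweep computes `st` everywhere. A second
upward sweep, rooted at a vertex of maximal `st`, records slots from which the partition is read off
from the root downwards (`valid_of_isRanked`). The degrees sum to `2 * n - 2`, so the total time is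
linear. -/

@[simp] theorem Memory.setReg_reg (s : Memory) (x k y : ℕ) :
    (s.setReg x k).reg y = if y = x then k else s.reg y := by
  simp [Memory.setReg, Function.update_apply]

@[simp] theorem Memory.setReg_arr (s : Memory) (x k : ℕ) : (s.setReg x k).arr = s.arr := rfl

@[simp] theorem Memory.setArr_reg (s : Memory) (a i k : ℕ) : (s.setArr a i k).reg = s.reg := rfl

@[simp] theorem Memory.setArr_arr (s : Memory) (a i k b : ℕ) :
    (s.setArr a i k).arr b = if b = a then Function.update (s.arr a) i k else s.arr b := by
  by_cases h : b = a
  · subst h; simp [Memory.setArr]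
  · simp [Memory.setArr, h]

/-- All numbers in the memory are at most `W`. -/
def Memory.Bounded (W : ℕ) (s : Memory) : Prop :=
  (∀ x, s.reg x ≤ W) ∧ ∀ a i, s.arr a i ≤ W

theorem Memory.Bounded.setReg {W : ℕ} {s : Memory} (h : s.Bounded W) {k : ℕ} (x : ℕ)
    (hk : k ≤ W) : (s.setReg x k).Bounded W := by
  refine ⟨fun y => ?_, h.2⟩
  rw [Memory.setReg_reg]
  split_ifs
  · exact hk
  · exact h.1 y

theorem Memory.Bounded.setArr {W : ℕ} {s : Memory} (h : s.Bounded W) {k : ℕ} (a i : ℕ)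
    (hk : k ≤ W) : (s.setArr a i k).Bounded W := by
  refine ⟨h.1, fun b j => ?_⟩
  rw [Memory.setArr_arr]
  split_ifs
  · rw [Function.update_apply]
    split_ifs
    · exact hk
    · exact h.2 a j
  · exact h.2 b j

/-- The registers that occur as targets of instructions. -/
def Program.outRegs : Program → List ℕ
  | .skip => []
  | .const x _ => [x]
  | .copy x _ => [x]
  | .add x _ _ => [x]
  | .sub x _ _ => [x]
  | .load x _ _ => [x]
  | .store _ _ _ => []
  | .seq P Q => P.outRegs ++ Q.outRegs
  | .ite _ _ P Q => P.outRegs ++ Q.outRegs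
  | .loop _ _ P => P.outRegs

/-- The arrays that occur as targets of instructions. -/
def Program.outArrs : Program → List ℕ
  | .store a _ _ => [a]
  | .seq P Q => P.outArrs ++ Q.outArrs
  | .ite _ _ P Q => P.outArrs ++ Q.outArrs
  | .loop _ _ P => P.outArrs
  | _ => []

/-- `s` and `s'` agree on everything that `P` does not write. -/
def Frame (P : Program) (s s' : Memory) : Prop :=
  (∀ x, x ∉ P.outRegs → s'.reg x = s.reg x) ∧ ∀ a, a ∉ P.outArrs → s'.arr a = s.arr a

theorem Frame.refl (P : Program) (s : Memory) : Frame P s s := ⟨fun _ _ => rfl, fun _ _ => rfl⟩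

theorem Frame.trans {P : Program} {s s₁ s₂ : Memory} (h₁ : Frame P s s₁) (h₂ : Frame P s₁ s₂) :
    Frame P s s₂ :=
  ⟨fun x hx => (h₂.1 x hx).trans (h₁.1 x hx), fun a ha => (h₂.2 a ha).trans (h₁.2 a ha)⟩

theorem Frame.mono {P Q : Program} {s s' : Memory} (h : Frame P s s')
    (hr : P.outRegs ⊆ Q.outRegs) (ha : P.outArrs ⊆ Q.outArrs) : Frame Q s s' :=
  ⟨fun x hx => h.1 x fun h' => hx (hr h'), fun a hx => h.2 a fun h' => hx (ha h')⟩

/-- This keeps loop invariants small: facts about untouched registers and arrays are carried along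
by `decide` on the finite lists of targets. -/
theorem Exec.frame {W : ℕ} {P : Program} {s s' : Memory} {t : ℕ} (h : Exec W P s t s') :
    Frame P s s' := by
  induction h with
  | skip s => exact .refl _ _
  | const s x k h => exact ⟨fun y hy => by simp_all [Program.outRegs], fun _ _ => rfl⟩
  | copy s x k h => exact ⟨fun y hy => by simp_all [Program.outRegs], fun _ _ => rfl⟩
  | add s x y z h => exact ⟨fun y hy => by simp_all [Program.outRegs], fun _ _ => rfl⟩
  | sub s x y z h => exact ⟨fun y hy => by simp_all [Program.outRegs], fun _ _ => rfl⟩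
  | load s x a y h => exact ⟨fun y hy => by simp_all [Program.outRegs], fun _ _ => rfl⟩
  | store s a x y h => exact ⟨fun _ _ => rfl, fun b hb => by simp_all [Program.outArrs]⟩
  | seq h₁ h₂ ih₁ ih₂ =>
    exact (ih₁.mono (List.subset_append_left _ _) (List.subset_append_left _ _)).trans
      (ih₂.mono (List.subset_append_right _ _) (List.subset_append_right _ _))
  | ite_true hxy h ih =>
    exact ih.mono (List.subset_append_left _ _) (List.subset_append_left _ _)
  | ite_false hxy h ih =>
    exact ih.mono (List.subset_append_right _ _) (List.subset_append_right _ _)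
  | loop_true hxy h₁ h₂ ih₁ ih₂ => exact Frame.trans (P := .loop _ _ _) ih₁ ih₂
  | loop_false hxy => exact .refl _ _

/-- Started in `s`, the program `P` halts after `t` steps in a state `s'` with `Q t s'`; no number
larger than `W` is written. -/
def Runs (W : ℕ) (P : Program) (s : Memory) (Q : ℕ → Memory → Prop) : Prop :=
  s.Bounded W → ∃ t s', Exec W P s t s' ∧ s'.Bounded W ∧ Q t s'

theorem Runs.mono {W : ℕ} {P : Program} {s : Memory} {Q Q' : ℕ → Memory → Prop}
    (h : Runs W P s Q) (hQ : ∀ t s', Frame P s s' → Q t s' → Q' t s') : Runs W P s Q' := by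
  intro hs
  obtain ⟨t, s', he, hb, hq⟩ := h hs
  exact ⟨t, s', he, hb, hQ t s' he.frame hq⟩

theorem Runs.seq {W : ℕ} {P R : Program} {s : Memory} {Q : ℕ → Memory → Prop}
    (h : Runs W P s fun t s' => Runs W R s' fun t' s'' => Q (t + t') s'') :
    Runs W (.seq P R) s Q := by
  intro hs
  obtain ⟨t, s', he, hb, hq⟩ := h hs
  obtain ⟨t', s'', he', hb', hq'⟩ := hq hb
  exact ⟨_, s'', .seq he he', hb', hq'⟩

/-- The rule for loops: `I j t s` holds after `j` rounds that took `t` steps. -/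
theorem Runs.loop {W : ℕ} {x y : ℕ} {P : Program} {s : Memory} (N : ℕ)
    (I : ℕ → ℕ → Memory → Prop) (h0 : I 0 0 s)
    (step : ∀ j t s', j < N → Frame P s s' → I j t s' →
      s'.reg x < s'.reg y ∧ Runs W P s' fun t' s'' => I (j + 1) (t + t' + 1) s'')
    (halt : ∀ t s', Frame P s s' → I N t s' → ¬ s'.reg x < s'.reg y) :
    Runs W (.loop x y P) s fun t s' => ∃ t', t = t' + 1 ∧ I N t' s' := by
  -- Induction on the number `m` of remaining rounds. Each round pays for its own test; the final
  -- failing test is the extra step.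
  suffices H : ∀ m j, j + m = N → ∀ t s', s'.Bounded W → Frame P s s' → I j t s' →
      ∃ t₁ s₁, Exec W (.loop x y P) s' t₁ s₁ ∧ s₁.Bounded W ∧
        ∃ t', t + t₁ = t' + 1 ∧ I N t' s₁ by
    intro hs
    simpa using H N 0 (zero_add N) 0 s hs (.refl _ _) h0
  intro m
  induction m with
  | zero =>
    intro j hj t s' hb hf hI
    obtain rfl : j = N := hj
    exact ⟨1, s', .loop_false (halt t s' hf hI), hb, t, rfl, hI⟩
  | succ m ih =>
    intro j hj t s' hb hf hI
    obtain ⟨hg, hr⟩ := step j t s' (by omega) hf hI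
    obtain ⟨t₁, s₁, he, hb₁, hI₁⟩ := hr hb
    obtain ⟨t₂, s₂, he₂, hb₂, t', ht', hI₂⟩ :=
      ih (j + 1) (by omega) _ s₁ hb₁ (hf.trans he.frame) hI₁
    exact ⟨_, s₂, .loop_true hg he he₂, hb₂, t', by omega, hI₂⟩

/-- The weakest precondition of a program without loops, for bounded memories. -/
def wp (W : ℕ) : Program → (ℕ → Memory → Prop) → Memory → Prop
  | .skip, Q, s => Q 1 s
  | .const x k, Q, s => k ≤ W ∧ Q 1 (s.setReg x k)
  | .copy x y, Q, s => Q 1 (s.setReg x (s.reg y))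
  | .add x y z, Q, s => s.reg y + s.reg z ≤ W ∧ Q 1 (s.setReg x (s.reg y + s.reg z))
  | .sub x y z, Q, s => Q 1 (s.setReg x (s.reg y - s.reg z))
  | .load x a y, Q, s => Q 1 (s.setReg x (s.arr a (s.reg y)))
  | .store a x y, Q, s => Q 1 (s.setArr a (s.reg x) (s.reg y))
  | .seq P R, Q, s => wp W P (fun t => wp W R fun t' => Q (t + t')) s
  | .ite x y P R, Q, s =>
    (s.reg x < s.reg y → wp W P (fun t => Q (t + 1)) s) ∧
      (¬ s.reg x < s.reg y → wp W R (fun t => Q (t + 1)) s)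
  | .loop _ _ _, _, _ => False

/-- In a bounded memory, copies, loads, stores and truncated differences cannot exceed the bound, so
`wp` has side conditions only for constants and sums. -/
theorem Runs.of_wp {W : ℕ} {P : Program} {s : Memory} {Q : ℕ → Memory → Prop}
    (h : wp W P Q s) : Runs W P s Q := by
  induction P generalizing s Q with
  | skip => exact fun hs => ⟨1, s, .skip s, hs, h⟩
  | const x k => exact fun hs => ⟨1, _, .const s x k h.1, hs.setReg x h.1, h.2⟩
  | copy x y => exact fun hs => ⟨1, _, .copy s x y (hs.1 _), hs.setReg x (hs.1 _), h⟩
  | add x y z => exact fun hs => ⟨1, _, .add s x y z h.1, hs.setReg x h.1, h.2⟩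
  | sub x y z =>
    intro hs
    have := (Nat.sub_le (s.reg y) (s.reg z)).trans (hs.1 y)
    exact ⟨1, _, .sub s x y z this, hs.setReg x this, h⟩
  | load x a y => exact fun hs => ⟨1, _, .load s x a y (hs.2 _ _), hs.setReg x (hs.2 _ _), h⟩
  | store a x y => exact fun hs => ⟨1, _, .store s a x y (hs.1 _), hs.setArr a _ (hs.1 _), h⟩
  | seq P R ihP ihR => exact Runs.seq ((ihP h).mono fun _ _ _ h' => ihR h')
  | ite x y P R ihP ihR =>
    intro hs
    by_cases hxy : s.reg x < s.reg y
    · obtain ⟨t, s', he, hb, hq⟩ := ihP (h.1 hxy) hs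
      exact ⟨_, s', .ite_true hxy he, hb, hq⟩
    · obtain ⟨t, s', he, hb, hq⟩ := ihR (h.2 hxy) hs
      exact ⟨_, s', .ite_false hxy he, hb, hq⟩
  | loop x y P => exact h.elim

/-! ### Branches of a tree -/

/-- The component of `v` after the deletion of the edge `xv`. -/
def branch {V : Type*} (G : SimpleGraph V) (x v : V) : Set V :=
  {w | (G.deleteEdges {s(x, v)}).Reachable v w}

section Branch

variable {V : Type*} {G : SimpleGraph V} {c v w x y z : V}

theorem mem_branch_self : v ∈ branch G x v := SimpleGraph.Reachable.refl _

theorem root_notMem_branch (hG : G.IsTree) (h : G.Adj x v) : x ∉ branch G x v := fun hx =>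
  SimpleGraph.isBridge_iff.1
    (SimpleGraph.isAcyclic_iff_forall_adj_isBridge.1 hG.isAcyclic h) (SimpleGraph.Reachable.symm hx)

/-- The cut edge is the only edge of `G` leaving a branch. -/
theorem eq_of_adj_of_notMem_branch (hy : y ∈ branch G x v) (h : G.Adj y z)
    (hz : z ∉ branch G x v) : y = v ∧ z = x := by
  by_contra hne
  have hyv : y = x ∧ z = v ∨ y = v ∧ z = x := by
    by_contra hne'
    refine hz (SimpleGraph.Reachable.trans hy (SimpleGraph.Adj.reachable ?_))
    rw [SimpleGraph.deleteEdges_adj]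
    refine ⟨h, fun hm => hne' ?_⟩
    simpa [Sym2.eq_iff] using hm
  rcases hyv with ⟨-, rfl⟩ | h'
  · exact hz mem_branch_self
  · exact hne h'

/-- A walk from `v` to a vertex outside both branches would leave their union, but the only edge
leaving one branch ends in the other. -/
theorem branch_compl (hG : G.IsTree) (h : G.Adj x v) : (branch G x v)ᶜ = branch G v x := by
  ext w
  constructor
  · intro hw
    by_contra hw'
    obtain ⟨p⟩ := hG.connected.preconnected v w
    obtain ⟨d, -, hd, hd'⟩ := p.exists_boundary_dart (branch G x v ∪ branch G v x)
      (Or.inl mem_branch_self) (fun hm => hm.elim hw hw')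
    rw [Set.mem_union, not_or] at hd'
    rcases hd with hd | hd
    · exact hd'.2 ((eq_of_adj_of_notMem_branch hd d.adj hd'.1).2 ▸ mem_branch_self)
    · exact hd'.1 ((eq_of_adj_of_notMem_branch hd d.adj hd'.2).2 ▸ mem_branch_self)
  · intro hw hw'
    have h1 : (G.deleteEdges {s(x, v)}).Reachable x w := by
      have := hw
      rwa [branch, Set.mem_ofPred_eq, Sym2.eq_swap] at this
    exact root_notMem_branch hG h (SimpleGraph.Reachable.trans hw' h1.symm)

theorem exists_walk_in_branch (hw : w ∈ branch G x v) :
    ∃ p : G.Walk v w, ∀ y ∈ p.support, y ∈ branch G x v := by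
  classical
  obtain ⟨p⟩ := hw
  refine ⟨p.mapLe (SimpleGraph.deleteEdges_le _), fun y hy => ?_⟩
  rw [SimpleGraph.Walk.support_mapLe_eq_support] at hy
  exact ⟨p.takeUntil y hy⟩

theorem mem_support_of_mem_branch (hw : w ∉ branch G x v) (hz : z ∈ branch G x v)
    (p : G.Walk w z) : x ∈ p.support ∧ v ∈ p.support := by
  obtain ⟨d, hd, h1, h2⟩ := p.exists_boundary_dart (branch G x v)ᶜ hw (fun h => h hz)
  rw [Set.mem_compl_iff, not_not] at h2
  obtain ⟨e1, e2⟩ := eq_of_adj_of_notMem_branch h2 d.adj.symm h1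
  exact ⟨e2 ▸ p.dart_fst_mem_support_of_mem_darts hd,
    e1 ▸ p.dart_snd_mem_support_of_mem_darts hd⟩

/-- Once the parent `x` of `v` is known, the position of the root no longer matters. This is why
`mst` depends only on the edge above `v`. -/
theorem subtree_eq_branch (hG : G.IsTree) (h : G.Adj x v) (hc : c ∉ branch G x v) :
    subtree G c v = branch G x v := by
  classical
  ext w
  constructor
  · intro hw
    by_contra hw'
    -- Vertices outside the branch are joined to `x` by walks avoiding `v`; two of these compose to
    -- a walk from `c` to `w` avoiding `v`.
    have key : ∀ u, u ∉ branch G x v → ∃ p : G.Walk x u, v ∉ p.support := by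
      intro u hu
      have hu' : u ∈ branch G v x := by rwa [← branch_compl hG h]
      obtain ⟨p, hp⟩ := exists_walk_in_branch hu'
      exact ⟨p, fun hv => root_notMem_branch hG h.symm (hp v hv)⟩
    obtain ⟨p, hp⟩ := key c hc
    obtain ⟨q, hq⟩ := key w hw'
    have := (p.reverse.append q).support_bypass_subset_support
      (hw (p.reverse.append q).bypass (SimpleGraph.Walk.bypass_isPath _))
    rw [SimpleGraph.Walk.mem_support_append_iff, SimpleGraph.Walk.support_reverse,
      List.mem_reverse] at this
    exact this.elim hp hq
  · exact fun hw p _ => (mem_support_of_mem_branch hc hw p).2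

theorem subtree_self (G : SimpleGraph V) (c : V) : subtree G c c = Set.univ :=
  Set.eq_univ_of_forall fun _ p _ => p.start_mem_support

theorem mem_children_iff (hG : G.IsTree) :
    v ∈ children G c x ↔ G.Adj x v ∧ c ∉ branch G x v := by
  classical
  refine and_congr_right fun h => ⟨fun hv hc => ?_, fun hc p _ =>
    (mem_support_of_mem_branch hc mem_branch_self p).1⟩
  obtain ⟨p, hp⟩ := exists_walk_in_branch hc
  have := p.reverse.support_bypass_subset_support (hv _ (SimpleGraph.Walk.bypass_isPath _))
  rw [SimpleGraph.Walk.support_reverse, List.mem_reverse] at this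
  exact root_notMem_branch hG h (hp x this)

theorem mem_branch_of_notMem_support (q : G.Walk w c) (h : x ∉ q.support) : c ∈ branch G x w :=
  ⟨q.toDeleteEdges _ fun e he hm => by
    rw [Set.mem_singleton_iff] at hm
    exact h (q.fst_mem_support_of_mem_edges (hm ▸ he))⟩

theorem exists_mem_branch (hG : G.IsTree) (hx : x ≠ c) : ∃ w, G.Adj x w ∧ c ∈ branch G x w := by
  classical
  obtain ⟨p₀⟩ := hG.connected.preconnected x c
  have hp := p₀.bypass_isPath
  cases hq : p₀.bypass with
  | nil => exact absurd rfl hx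
  | @cons _ w _ h q =>
    rw [hq, SimpleGraph.Walk.cons_isPath_iff] at hp
    exact ⟨w, h, mem_branch_of_notMem_support q hp.2⟩

theorem branch_disjoint (hG : G.IsTree) (h : G.Adj x v) (h' : G.Adj x w) (hne : v ≠ w)
    (hy : y ∈ branch G x v) : y ∉ branch G x w := by
  intro hy'
  obtain ⟨p, hp⟩ := exists_walk_in_branch hy'
  have hw : w ∉ branch G x v := fun hw =>
    hne (eq_of_adj_of_notMem_branch hw h'.symm (root_notMem_branch hG h)).1.symm
  exact root_notMem_branch hG h' (hp x (mem_support_of_mem_branch hw hy p).1)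

theorem children_eq_of_mem_branch (hG : G.IsTree) (h : G.Adj x w) (hc : c ∈ branch G x w) :
    children G c x = G.neighborSet x \ {w} := by
  ext v
  rw [mem_children_iff hG]
  refine and_congr_right fun hv => ⟨fun hn e => hn (e ▸ hc), fun hne hcv => ?_⟩
  exact branch_disjoint hG hv h hne hcv hc

theorem children_self (hG : G.IsTree) (x : V) : children G x x = G.neighborSet x := by
  ext v
  rw [mem_children_iff hG]
  exact ⟨fun h => h.1, fun h => ⟨h, root_notMem_branch hG h⟩⟩

theorem branch_subset_branch (hG : G.IsTree) (h : G.Adj w x) (hu : G.Adj x v) (hne : v ≠ w) :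
    branch G x v ⊆ branch G w x := fun y hy => by
  rw [← branch_compl hG h.symm]
  exact branch_disjoint hG hu h.symm hne hy

end Branch

/-! ### Filling slots -/

/-- The largest number `z` such that the slots `1, …, z` can be given to distinct elements `u` of
`S`, where `u` may only get a slot that is at most `a u`; see `le_fill_iff_exists_injective`. -/
noncomputable def fill {V : Type*} (S : Set V) (a : V → ℕ) : ℕ :=
  sInf (Set.range fun j => j + {u | u ∈ S ∧ j < a u}.ncard)

section Fill

variable {V : Type*} {S : Set V} {a : V → ℕ} {m : ℕ}

theorem le_fill_iff : m ≤ fill S a ↔ ∀ j, m ≤ j + {u | u ∈ S ∧ j < a u}.ncard := by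
  constructor
  · exact fun h j => h.trans (Nat.sInf_le ⟨j, rfl⟩)
  · intro h
    obtain ⟨j, hj⟩ := Nat.sInf_mem
      (Set.range_nonempty fun j => j + {u | u ∈ S ∧ j < a u}.ncard)
    exact (h j).trans hj.le

theorem exists_fill_eq (S : Set V) (a : V → ℕ) :
    ∃ j, fill S a = j + {u | u ∈ S ∧ j < a u}.ncard := by
  obtain ⟨j, hj⟩ := Nat.sInf_mem
    (Set.range_nonempty fun j => j + {u | u ∈ S ∧ j < a u}.ncard)
  exact ⟨j, hj.symm⟩

theorem fill_le (S : Set V) (a : V → ℕ) (j : ℕ) :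
    fill S a ≤ j + {u | u ∈ S ∧ j < a u}.ncard := le_fill_iff.1 le_rfl j

/-- The sets of admissible elements decrease with the slot, so Hall's condition is needed only for
the topmost slots and a greedy choice works. The index `q : Fin m` stands for the slot `q + 1`. -/
theorem le_fill_iff_exists_injective [Finite V] :
    m ≤ fill S a ↔
      ∃ g : Fin m → V, Function.Injective g ∧ ∀ q, g q ∈ S ∧ (q : ℕ) < a (g q) := by
  rw [le_fill_iff]
  constructor
  · induction m generalizing S with
    | zero => exact fun _ => ⟨Fin.elim0, fun q => q.elim0, fun q => q.elim0⟩
    | succ m ih =>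
      intro h
      -- The condition at `j = m` supplies a candidate for the top slot. It is counted for every `j
      -- < m`, so removing it costs each of these terms exactly one.
      have hpos : 0 < {u | u ∈ S ∧ m < a u}.ncard := by have := h m; omega
      obtain ⟨u₀, hu₀, hm⟩ := (Set.ncard_pos).1 hpos
      obtain ⟨g, hg, hga⟩ := ih (S := S \ {u₀}) fun j => by
        by_cases hj : m ≤ j
        · omega
        · have hsub : {u | u ∈ S \ {u₀} ∧ j < a u} = {u | u ∈ S ∧ j < a u} \ {u₀} := by
            ext u
            simp only [Set.mem_sdiff, Set.mem_ofPred_eq, Set.mem_singleton_iff]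
            tauto
          have := h j
          rw [hsub, Set.ncard_sdiff_singleton_of_mem (Set.mem_ofPred.2 ⟨hu₀, by omega⟩)]
          omega
      refine ⟨Fin.snoc g u₀, ?_, fun q => ?_⟩
      · rw [Fin.snoc_injective_iff]
        exact ⟨hg, fun ⟨q, hq⟩ => (hga q).1.2 hq⟩
      · induction q using Fin.lastCases with
        | last => simpa using ⟨hu₀, hm⟩
        | cast q => simpa using ⟨(hga q).1.1, (hga q).2⟩
  · rintro ⟨g, hg, hga⟩ j
    -- The holders of the slots above `j` are distinct and all have a value above `j`; there are at
    -- most `j` other slots.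
    have h1 : (g '' {q | j ≤ (q : ℕ)}).ncard ≤ {u | u ∈ S ∧ j < a u}.ncard := by
      refine Set.ncard_le_ncard ?_
      rintro _ ⟨q, hq, rfl⟩
      exact ⟨(hga q).1, lt_of_le_of_lt hq (hga q).2⟩
    rw [Set.ncard_image_of_injective _ hg] at h1
    have h2 : {q : Fin m | j ≤ (q : ℕ)}ᶜ.ncard ≤ j := by
      have : (Fin.val '' {q : Fin m | j ≤ (q : ℕ)}ᶜ).ncard ≤ (Set.Iio j).ncard := by
        refine Set.ncard_le_ncard ?_ (Set.finite_Iio j)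
        rintro _ ⟨q, hq, rfl⟩
        simpa using hq
      rw [Set.ncard_image_of_injective _ Fin.val_injective] at this
      simpa using this
    have h3 := Set.ncard_add_ncard_compl {q : Fin m | j ≤ (q : ℕ)}
    rw [Nat.card_eq_fintype_card, Fintype.card_fin] at h3
    omega

theorem ncard_sdiff_lt [Finite V] {u : V} (hu : u ∈ S) (j : ℕ) :
    {w | w ∈ S \ {u} ∧ j < a w}.ncard + (if j < a u then 1 else 0) =
      {w | w ∈ S ∧ j < a w}.ncard := by
  have hsub : {w | w ∈ S \ {u} ∧ j < a w} = {w | w ∈ S ∧ j < a w} \ {u} := by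
    ext w
    simp only [Set.mem_sdiff, Set.mem_ofPred_eq, Set.mem_singleton_iff]
    tauto
  rw [hsub]
  split_ifs with h
  · exact Set.ncard_sdiff_singleton_add_one (Set.mem_ofPred.2 ⟨hu, h⟩)
  · rw [Set.sdiff_singleton_eq_self]
    · rfl
    · exact fun h' => h h'.2

/-- Removing `u` lowers by one precisely the terms with `j < a u`. The minimum therefore drops
exactly when one of these terms attains it. -/
theorem fill_sdiff_add_one_iff [Finite V] {u : V} (hu : u ∈ S) :
    fill (S \ {u}) a + 1 = fill S a ↔
      ∃ j < a u, fill S a = j + {w | w ∈ S ∧ j < a w}.ncard := by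
  constructor
  · intro h
    obtain ⟨j, hj⟩ := exists_fill_eq (S \ {u}) a
    have h1 := ncard_sdiff_lt (a := a) hu j
    have h2 := fill_le S a j
    refine ⟨j, ?_, ?_⟩
    · by_contra hn
      rw [if_neg hn] at h1
      omega
    · split_ifs at h1 <;> omega
  · rintro ⟨j, hj, h⟩
    have h1 := ncard_sdiff_lt (a := a) hu j
    rw [if_pos hj] at h1
    have h2 := fill_le (S \ {u}) a j
    obtain ⟨j', hj'⟩ := exists_fill_eq (S \ {u}) a
    have h3 := ncard_sdiff_lt (a := a) hu j'
    have h4 := fill_le S a j'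
    split_ifs at h3 <;> omega

theorem fill_sdiff_of_ne [Finite V] {u : V} (hu : u ∈ S) (h : fill (S \ {u}) a + 1 ≠ fill S a) :
    fill (S \ {u}) a = fill S a := by
  obtain ⟨j, hj⟩ := exists_fill_eq (S \ {u}) a
  obtain ⟨j', hj'⟩ := exists_fill_eq S a
  have h1 := ncard_sdiff_lt (a := a) hu j
  have h2 := fill_le S a j
  have h3 := ncard_sdiff_lt (a := a) hu j'
  have h4 := fill_le (S \ {u}) a j'
  split_ifs at h1 h3 <;> omega

end Fill

/-! ### Strong transitive numbers of trees -/

theorem deg_eq_ncard {V : Type*} [Finite V] (G : SimpleGraph V) (v : V) :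
    deg G v = (G.neighborSet v).ncard := by
  have := Fintype.ofFinite (G.neighborSet v)
  rw [Set.ncard_eq_toFinset_card', ← SimpleGraph.neighborFinset,
    SimpleGraph.card_neighborFinset_eq_degree, deg]
  congr!

/-- The colouring `f` describes a strong transitive partition on `S`. -/
def Valid {V : Type*} (G : SimpleGraph V) (d : V → ℕ) (S : Set V) (f : V → ℕ) : Prop :=
  ∀ y ∈ S, 1 ≤ f y ∧ ∀ i, 1 ≤ i → i < f y → ∃ z ∈ S, G.Adj z y ∧ d y ≤ d z ∧ f z = i

/-- The strong transitive number of `v` in the subgraph induced by `S`, with degree function `d`. -/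
noncomputable def setNumber {V : Type*} (G : SimpleGraph V) (d : V → ℕ) (S : Set V) (v : V) : ℕ :=
  sSup {p | ∃ f, Valid G d S f ∧ f v = p}

section SetNumber

variable {V : Type*} {G : SimpleGraph V} {d : V → ℕ} {S : Set V} {f : V → ℕ}

theorem Valid.le_card [Finite V] (hf : Valid G d S f) {v : V} (hv : v ∈ S) : f v ≤ Nat.card V := by
  have h : Set.Icc 1 (f v) ⊆ f '' Set.univ := by
    intro i hi
    rcases hi.2.lt_or_eq with h | h
    · obtain ⟨z, -, -, -, hz⟩ := (hf v hv).2 i hi.1 h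
      exact ⟨z, trivial, hz⟩
    · exact ⟨v, trivial, h.symm⟩
  have h1 := (Set.ncard_le_ncard h).trans (Set.ncard_image_le (f := f))
  simpa [Set.ncard_univ, ← Finset.coe_Icc, Set.ncard_coe_finset] using h1

theorem Valid.le_setNumber [Finite V] (hf : Valid G d S f) {v : V} (hv : v ∈ S) :
    f v ≤ setNumber G d S v :=
  le_csSup ⟨Nat.card V, by rintro _ ⟨g, hg, rfl⟩; exact hg.le_card hv⟩ ⟨f, hf, rfl⟩

theorem exists_valid [Finite V] (G : SimpleGraph V) (d : V → ℕ) {v : V} (hv : v ∈ S) :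
    ∃ f, Valid G d S f ∧ f v = setNumber G d S v := by
  refine Nat.sSup_mem (s := {p | ∃ f, Valid G d S f ∧ f v = p}) ?_
    ⟨Nat.card V, by rintro _ ⟨g, hg, rfl⟩; exact hg.le_card hv⟩
  exact ⟨1, fun _ => 1, fun y _ => ⟨le_rfl, fun i h1 h2 => absurd h2 (not_lt.2 h1)⟩, rfl⟩

/-- Non-emptiness is automatic: a vertex of the largest class has a neighbour in every smaller
class. -/
theorem Valid.isPartition (hf : Valid G d Set.univ f) {r : V} (hr : ∀ v, f v ≤ f r) :
    IsStrongTransitivePartition G d (f r) f where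
  mem_Icc v := ⟨(hf v trivial).1, hr v⟩
  nonempty i hi := by
    rcases hi.2.lt_or_eq with h | h
    · obtain ⟨z, -, -, -, hz⟩ := (hf r trivial).2 i hi.1 h
      exact ⟨z, hz⟩
    · exact ⟨r, h.symm⟩
  dominates i j hi hij hj y hy := by
    obtain ⟨z, -, h1, h2, h3⟩ := (hf y trivial).2 i hi (by rw [show f y = j from hy]; exact hij)
    exact ⟨z, h3, h1, h2⟩

theorem IsStrongTransitivePartition.valid {k : ℕ} (hf : IsStrongTransitivePartition G d k f) :
    Valid G d Set.univ f := by
  intro y _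
  refine ⟨(hf.mem_Icc y).1, fun i h1 h2 => ?_⟩
  obtain ⟨z, hz, ha, hd⟩ := hf.dominates i (f y) h1 h2 (hf.mem_Icc y).2 y rfl
  exact ⟨z, trivial, ha, hd, hz⟩

/-- Replaces induced subgraphs by sets of vertices of one fixed graph. Values outside `S` are
irrelevant to `Valid`, so the extension by `1` is harmless. -/
theorem strongNumber_induce [Finite V] {v : V} (hv : v ∈ S) {dS : S → ℕ}
    (hd : ∀ w : S, dS w = d w) :
    strongNumber (G.induce S) dS ⟨v, hv⟩ = setNumber G d S v := by
  classical
  unfold strongNumber setNumber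
  congr 1
  ext p
  constructor
  · rintro ⟨k, f, hf, rfl⟩
    refine ⟨fun w => if h : w ∈ S then f ⟨w, h⟩ else 1, fun y hy => ?_, by simp [hv]⟩
    have := hf.valid ⟨y, hy⟩ trivial
    simp only [hy, dite_true]
    refine ⟨this.1, fun i h1 h2 => ?_⟩
    obtain ⟨z, -, ha, hdz, hz⟩ := this.2 i h1 h2
    exact ⟨z, z.2, ha, by simpa [hd] using hdz, by simpa using hz⟩
  · rintro ⟨f, hf, rfl⟩
    have hf' : Valid (G.induce S) dS Set.univ (fun w => f w) := by
      intro y _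
      refine ⟨(hf y y.2).1, fun i h1 h2 => ?_⟩
      obtain ⟨z, hz, ha, hdz, hfz⟩ := (hf y y.2).2 i h1 h2
      exact ⟨⟨z, hz⟩, trivial, ha, by simpa [hd] using hdz, hfz⟩
    have : Nonempty S := ⟨⟨v, hv⟩⟩
    obtain ⟨r, hr⟩ := Finite.exists_max (fun w : S => f w)
    exact ⟨f r, _, hf'.isPartition hr, rfl⟩

theorem strongNumber_eq [Finite V] (v : V) : strongNumber G d v = setNumber G d Set.univ v := by
  unfold strongNumber setNumber
  congr 1
  ext p
  constructor
  · rintro ⟨k, f, hf, rfl⟩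
    exact ⟨f, hf.valid, rfl⟩
  · rintro ⟨f, hf, rfl⟩
    have : Nonempty V := ⟨v⟩
    obtain ⟨r, hr⟩ := Finite.exists_max f
    exact ⟨f r, _, hf.isPartition hr, rfl⟩

/-- The number of a vertex is computed from the numbers of its neighbours in their branches. -/
theorem setNumber_eq_fill [Finite V] (hG : G.IsTree) {x : V} (hx : x ∈ S)
    (hS : ∀ u ∈ S, G.Adj x u → branch G x u ⊆ S) :
    setNumber G d S x = 1 + fill {u | u ∈ S ∧ G.Adj x u}
      (fun u => if d x ≤ d u then setNumber G d (branch G x u) u else 0) := by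
  classical
  set a : V → ℕ := fun u => if d x ≤ d u then setNumber G d (branch G x u) u else 0 with ha
  apply le_antisymm
  -- Upper bound: the neighbours that supply `x` with the classes below its own occupy distinct
  -- slots.
  · obtain ⟨f, hf, hfx⟩ := exists_valid G d hx
    rw [← hfx]
    suffices h : f x - 1 ≤ fill {u | u ∈ S ∧ G.Adj x u} a by omega
    rw [le_fill_iff_exists_injective]
    have hc : ∀ q : Fin (f x - 1), ∃ z ∈ S, G.Adj z x ∧ d x ≤ d z ∧ f z = q + 1 := fun q =>
      (hf x hx).2 (q + 1) (by omega) (by omega)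
    choose g hgS hga hgd hgf using hc
    refine ⟨g, fun q q' hq => ?_, fun q => ⟨⟨hgS q, (hga q).symm⟩, ?_⟩⟩
    · have h1 := hgf q
      have h2 := hgf q'
      rw [hq] at h1
      exact Fin.ext (by omega)
    · have hv : Valid G d (branch G x (g q)) f := by
        intro y hy
        refine ⟨(hf y (hS _ (hgS q) (hga q).symm hy)).1, fun i h1 h2 => ?_⟩
        obtain ⟨z, hz, hzy, hd, hfz⟩ := (hf y (hS _ (hgS q) (hga q).symm hy)).2 i h1 h2
        -- A witness outside the branch could only be `x` itself, but the class of `x` is larger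
        -- than that of `g q`.
        refine ⟨z, ?_, hzy, hd, hfz⟩
        by_contra hn
        obtain ⟨rfl, rfl⟩ := eq_of_adj_of_notMem_branch hy hzy.symm hn
        have := hgf q
        omega
      have := hv.le_setNumber mem_branch_self
      simp only [ha, if_pos (hgd q)]
      rw [hgf q] at this
      omega
  · obtain ⟨g, hg, hga⟩ := le_fill_iff_exists_injective.1
      (le_refl (fill {u | u ∈ S ∧ G.Adj x u} a))
    generalize fill {u | u ∈ S ∧ G.Adj x u} a = z at g hg hga
    have hadj : ∀ q, G.Adj x (g q) := fun q => (hga q).1.2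
    have hdq : ∀ q, d x ≤ d (g q) := fun q => by
      by_contra hn
      have := (hga q).2
      simp only [ha, if_neg hn] at this
      omega
    have hF : ∀ q, ∃ f, Valid G d (branch G x (g q)) f ∧ (q : ℕ) < f (g q) := fun q => by
      obtain ⟨f, hf, hfx⟩ := exists_valid G d (mem_branch_self (G := G) (x := x) (v := g q))
      have := (hga q).2
      simp only [ha, if_pos (hdq q)] at this
      exact ⟨f, hf, by rwa [hfx]⟩
    choose F hFv hFq using hF
    -- The branch of `g q` keeps its own partition truncated at `q + 1`, which puts `g q` in class
    -- `q + 1`. Truncation preserves validity because a vertex only needs classes below its own. All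
    -- other vertices get class `1`, which demands nothing.
    set f : V → ℕ := fun w => if w = x then 1 + z else
      if h : ∃ q, w ∈ branch G x (g q) then min (F h.choose w) (h.choose + 1) else 1 with hf
    have hfq : ∀ q, ∀ w ∈ branch G x (g q), f w = min (F q w) (q + 1) := by
      intro q w hw
      have hwx : w ≠ x := fun e => root_notMem_branch hG (hadj q) (e ▸ hw)
      have hex : ∃ q, w ∈ branch G x (g q) := ⟨q, hw⟩
      have hq : hex.choose = q := by
        by_contra hne
        exact branch_disjoint hG (hadj _) (hadj _) (fun e => hne (hg e)) hex.choose_spec hw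
      simp only [hf, if_neg hwx, dif_pos hex, hq]
    have hfx : f x = 1 + z := by simp [hf]
    have hvalid : Valid G d S f := by
      intro y hy
      by_cases hyx : y = x
      · subst hyx
        refine ⟨by omega, fun i h1 h2 => ?_⟩
        have hi : i - 1 < z := by omega
        have h3 := hFq ⟨i - 1, hi⟩
        have h4 := hfq ⟨i - 1, hi⟩ _ mem_branch_self
        refine ⟨_, (hga ⟨i - 1, hi⟩).1.1, (hadj _).symm, hdq _, ?_⟩
        rw [h4]
        simp only at h3 ⊢
        omega
      · by_cases hex : ∃ q, y ∈ branch G x (g q)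
        · obtain ⟨q, hq⟩ := hex
          rw [hfq q y hq]
          have hv := hFv q y hq
          refine ⟨le_min hv.1 (by omega), fun i h1 h2 => ?_⟩
          obtain ⟨w, hw, hwa, hwd, hwf⟩ := hv.2 i h1 (by omega)
          refine ⟨w, hS _ (hga q).1.1 (hadj q) hw, hwa, hwd, ?_⟩
          rw [hfq q w hw]
          omega
        · have : f y = 1 := by simp only [hf, if_neg hyx, dif_neg hex]
          rw [this]
          exact ⟨le_rfl, fun i h1 h2 => by omega⟩
    rw [← hfx]
    exact hvalid.le_setNumber hx

end SetNumber

/-- The strong transitive number of `v` in its component after the deletion of the edge `xv`,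
with the degrees of `G`. -/
noncomputable def branchNumber {V : Type*} [Finite V] (G : SimpleGraph V) (x v : V) : ℕ :=
  setNumber G (deg G) (branch G x v) v

/-- The bound on the colours that the neighbour `u` of `x` can contribute to `x`. -/
noncomputable def weight {V : Type*} [Finite V] (G : SimpleGraph V) (x u : V) : ℕ :=
  if deg G x ≤ deg G u then branchNumber G x u else 0

/-! ### Branch numbers, rooted numbers and required children in a tree -/

section Tree

variable {V : Type*} [Finite V] {G : SimpleGraph V} {c v w x : V}

theorem st_eq_setNumber (G : SimpleGraph V) (v : V) :
    st G v = setNumber G (deg G) Set.univ v := strongNumber_eq v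

theorem st_eq_fill (hG : G.IsTree) (x : V) :
    st G x = 1 + fill (G.neighborSet x) (weight G x) := by
  rw [st_eq_setNumber, setNumber_eq_fill hG (Set.mem_univ x) (fun _ _ _ => Set.subset_univ _)]
  congr 2
  ext u
  simp

theorem branchNumber_eq_fill (hG : G.IsTree) (h : G.Adj x w) :
    branchNumber G w x = 1 + fill (G.neighborSet x \ {w}) (weight G x) := by
  rw [branchNumber, setNumber_eq_fill hG mem_branch_self]
  · congr 2
    ext u
    simp only [Set.mem_ofPred_eq, Set.mem_sdiff, SimpleGraph.mem_neighborSet,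
      Set.mem_singleton_iff]
    constructor
    · exact fun ⟨h1, h2⟩ => ⟨h2, fun e => root_notMem_branch hG h.symm (e ▸ h1)⟩
    · exact fun ⟨h1, h2⟩ => ⟨branch_subset_branch hG h.symm h1 h2 mem_branch_self, h1⟩
  · intro u hu hxu
    exact branch_subset_branch hG h.symm hxu fun e => root_notMem_branch hG h.symm (e ▸ hu)

/-- Only the endpoint `v` of the cut edge loses a neighbour, and it loses one. Raising its degree by
one therefore recovers the degrees of `G` on the whole branch. -/
theorem raisedDeg_induce (hG : G.IsTree) (h : G.Adj x v) {S : Set V} (hS : S = branch G x v)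
    (hv : v ∈ S) (w : S) : raisedDeg (G.induce S) ⟨v, hv⟩ 1 w = deg G w := by
  subst hS
  have h1 : deg (G.induce (branch G x v)) w = (G.neighborSet w ∩ branch G x v).ncard := by
    rw [deg_eq_ncard, ← Set.ncard_image_of_injective _ Subtype.val_injective]
    congr 1
    ext u
    simp [and_comm]
  rw [raisedDeg, h1, deg_eq_ncard]
  split_ifs with hw
  · have hw' : (w : V) = v := congrArg Subtype.val hw
    have h2 : G.neighborSet w ∩ branch G x v = G.neighborSet w \ {x} := by
      ext u
      simp only [Set.mem_inter_iff, Set.mem_sdiff, SimpleGraph.mem_neighborSet,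
        Set.mem_singleton_iff]
      refine and_congr_right fun hu => ⟨fun hub e => root_notMem_branch hG h (e ▸ hub),
        fun hne => ?_⟩
      by_contra hub
      exact hne (eq_of_adj_of_notMem_branch w.2 hu hub).2
    rw [h2, Set.ncard_sdiff_singleton_add_one]
    rw [hw']
    exact h.symm
  · have h2 : G.neighborSet w ∩ branch G x v = G.neighborSet w := by
      rw [Set.inter_eq_left]
      intro u hu
      by_contra hub
      exact hw (Subtype.ext (eq_of_adj_of_notMem_branch w.2 hu hub).1)
    rw [h2, add_zero]

theorem mst_eq_branchNumber (hG : G.IsTree) (h : G.Adj x v) (hc : c ∉ branch G x v) :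
    mst G c v = branchNumber G x v := by
  have hvc : v ≠ c := fun e => hc (e ▸ mem_branch_self)
  unfold mst branchNumber
  rw [strongNumber_induce]
  · rw [subtree_eq_branch hG h hc]
  · rw [if_neg hvc]
    exact raisedDeg_induce hG h (subtree_eq_branch hG h hc) _

theorem mst_self (G : SimpleGraph V) (c : V) : mst G c c = st G c := by
  rw [st_eq_setNumber, mst, if_pos rfl, ← subtree_self G c]
  refine strongNumber_induce _ fun w => ?_
  rw [raisedDeg, ite_self, add_zero, deg_eq_ncard, deg_eq_ncard,
    ← Set.ncard_image_of_injective _ Subtype.val_injective]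
  congr 1
  ext u
  simp [subtree_self]

theorem mst_eq_of_mem_children (hG : G.IsTree) (hv : v ∈ children G c x) :
    mst G c v = branchNumber G x v := by
  rw [mem_children_iff hG] at hv
  exact mst_eq_branchNumber hG hv.1 hv.2

theorem mst_eq_fill (hG : G.IsTree) (c x : V) :
    mst G c x = 1 + fill (children G c x) (weight G x) := by
  by_cases hx : x = c
  · subst hx
    rw [mst_self, st_eq_fill hG, children_self hG]
  · obtain ⟨w, hw, hc⟩ := exists_mem_branch hG hx
    rw [children_eq_of_mem_branch hG hw hc, ← branchNumber_eq_fill hG hw]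
    refine mst_eq_branchNumber hG hw.symm ?_
    rwa [← branch_compl hG hw, Set.mem_compl_iff, not_not]

/-- What remains after the deletion is the branch of `x` on the other side of the edge, so both
numbers become slot counts at `x`, without and with `v`. -/
theorem required_iff (hG : G.IsTree) (h : G.Adj x v) :
    Required h ↔ fill (G.neighborSet x \ {v}) (weight G x) + 1 =
      fill (G.neighborSet x) (weight G x) := by
  have hs : (subtree G x v)ᶜ = branch G v x := by
    rw [subtree_eq_branch hG h (root_notMem_branch hG h), branch_compl hG h]
  have h1 : strongNumber (G.induce (subtree G x v)ᶜ)
      (raisedDeg (G.induce (subtree G x v)ᶜ) ⟨x, root_mem_compl_subtree h⟩ 1)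
      ⟨x, root_mem_compl_subtree h⟩ = branchNumber G v x := by
    rw [strongNumber_induce (d := deg G) _ (raisedDeg_induce hG h.symm hs _), hs, branchNumber]
  rw [Required, h1, st_eq_fill hG, branchNumber_eq_fill hG h]
  omega

theorem isGreatest_strongTransitivity [Nonempty V] (G : SimpleGraph V) :
    IsGreatest (Set.range (st G)) (strongTransitivity G) := by
  obtain ⟨r, hr⟩ := Finite.exists_max (st G)
  suffices h : strongTransitivity G = st G r by
    rw [h]
    exact ⟨⟨r, rfl⟩, by rintro _ ⟨v, rfl⟩; exact hr v⟩
  have hle : ∀ (f : V → ℕ), Valid G (deg G) Set.univ f → ∀ v, f v ≤ st G r := fun f hf v =>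
    ((hf.le_setNumber (Set.mem_univ v)).trans_eq (st_eq_setNumber G v).symm).trans (hr v)
  have hub : ∀ k ∈ {k | ∃ f, IsStrongTransitivePartition G (deg G) k f}, k ≤ st G r := by
    rintro k ⟨f, hf⟩
    by_cases hk : 1 ≤ k
    · obtain ⟨v, rfl⟩ := hf.nonempty k ⟨hk, le_rfl⟩
      exact hle f hf.valid v
    · omega
  obtain ⟨f, hf, hfr⟩ := exists_valid G (deg G) (Set.mem_univ r)
  rw [← st_eq_setNumber] at hfr
  have hp := hf.isPartition fun v => (hle f hf v).trans_eq hfr.symm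
  exact le_antisymm (csSup_le ⟨_, f, hp⟩ hub) (hfr ▸ le_csSup ⟨_, hub⟩ ⟨f, hp⟩)

end Tree

/-! ### The bottom-up rule, the rerooting rule and the classification of required children -/

section Rules

variable {V : Type*} [Finite V] {G : SimpleGraph V}

/-- In a sorted family the slots can be filled in increasing order. -/
theorem exists_strictMono_of_injective {k m : ℕ} {l : Fin k → ℕ} (hl : Monotone l)
    {P : Fin k → Prop} {g : Fin m → Fin k} (hg : Function.Injective g)
    (h : ∀ q, P (g q) ∧ (q : ℕ) < l (g q)) :
    ∃ s : Fin m → Fin k, StrictMono s ∧ ∀ q, P (s q) ∧ (q : ℕ) < l (s q) := by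
  classical
  have hT : (Finset.univ.image g).card = m := by
    rw [Finset.card_image_of_injective _ hg, Finset.card_univ, Fintype.card_fin]
  set s := (Finset.univ.image g).orderEmbOfFin hT with hs
  refine ⟨s, s.strictMono, fun q => ?_⟩
  constructor
  · obtain ⟨r, -, hr⟩ := Finset.mem_image.1 (Finset.orderEmbOfFin_mem _ hT q)
    exact hr ▸ (h r).1
  -- The `m - q` elements `g r` with `q ≤ r` cannot all lie among the `m - q - 1` elements above `s
  -- q`. One of them is at most `s q`, and monotonicity of `l` transfers its bound.
  · obtain ⟨r, hqr, hr⟩ : ∃ r, q ≤ r ∧ g r ≤ s q := by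
      by_contra! hn
      have hsub : (Finset.Ici q).image g ⊆ (Finset.Ioi q).image s := by
        intro u hu
        obtain ⟨r, hr, rfl⟩ := Finset.mem_image.1 hu
        have hmem : g r ∈ Set.range s := by
          rw [hs, Finset.range_orderEmbOfFin]
          simp
        obtain ⟨q', hq'⟩ := hmem
        have hlt := hn r (Finset.mem_Ici.1 hr)
        rw [← hq', s.lt_iff_lt] at hlt
        exact Finset.mem_image.2 ⟨q', Finset.mem_Ioi.2 hlt, hq'⟩
      have := Finset.card_le_card hsub
      rw [Finset.card_image_of_injective _ hg, Finset.card_image_of_injective _ s.injective,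
        Fin.card_Ici, Fin.card_Ioi] at this
      omega
    exact lt_of_le_of_lt hqr ((h r).2.trans_le (hl hr))

theorem isGreatest_fill_children (hG : G.IsTree) (c x : V) (k : ℕ) (v : Fin k → V)
    (hv : Function.Injective v) (hr : Set.range v = children G c x)
    (hm : Monotone fun i => mst G c (v i)) :
    IsGreatest {m : ℕ | ∃ s : Fin m → Fin k, StrictMono s ∧
      ∀ q : Fin m, (q : ℕ) + 1 ≤ mst G c (v (s q)) ∧ deg G x ≤ deg G (v (s q))}
      (fill (children G c x) (weight G x)) := by
  have hmem : ∀ i, v i ∈ children G c x := fun i => hr ▸ ⟨i, rfl⟩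
  have hw : ∀ i q, q < weight G x (v i) ↔ deg G x ≤ deg G (v i) ∧ q < mst G c (v i) := by
    intro i q
    rw [weight, mst_eq_of_mem_children hG (hmem i)]
    split_ifs with h <;> simp [h]
  constructor
  · obtain ⟨g, hg, hga⟩ := le_fill_iff_exists_injective.1
      (le_refl (fill (children G c x) (weight G x)))
    have hi : ∀ q, ∃ i, v i = g q := fun q => by
      have := (hga q).1
      rwa [← hr] at this
    choose i hi using hi
    obtain ⟨s, hs, hsq⟩ := exists_strictMono_of_injective hm
      (P := fun i => deg G x ≤ deg G (v i)) (g := i)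
      (fun q q' hq => hg (by rw [← hi q, ← hi q', hq]))
      (fun q => (hw _ _).1 (by rw [hi q]; exact (hga q).2))
    exact ⟨s, hs, fun q => ⟨(hsq q).2, (hsq q).1⟩⟩
  · rintro m ⟨s, hs, hsq⟩
    exact le_fill_iff_exists_injective.2 ⟨v ∘ s, hv.comp hs.injective, fun q =>
      ⟨hmem _, (hw _ _).2 ⟨(hsq q).2, (hsq q).1⟩⟩⟩

theorem mst_add_one_eq_of_required (hG : G.IsTree) {x v : V} (h : G.Adj x v) (hR : Required h) :
    mst G v x + 1 = st G x := by
  rw [mst_eq_branchNumber hG h.symm (root_notMem_branch hG h.symm), branchNumber_eq_fill hG h,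
    st_eq_fill hG]
  have := (required_iff hG h).1 hR
  omega

theorem mst_eq_of_not_required (hG : G.IsTree) {x v : V} (h : G.Adj x v) (hR : ¬ Required h) :
    mst G v x = st G x := by
  rw [mst_eq_branchNumber hG h.symm (root_notMem_branch hG h.symm), branchNumber_eq_fill hG h,
    st_eq_fill hG]
  exact congrArg (1 + ·) (fill_sdiff_of_ne h fun h' => hR ((required_iff hG h).2 h'))

theorem required_iff_exists (hG : G.IsTree) {x v : V} (h : G.Adj x v) :
    Required h ↔ ∃ j < weight G x v, fill (G.neighborSet x) (weight G x) =
      j + {w | w ∈ G.neighborSet x ∧ j < weight G x w}.ncard := by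
  rw [required_iff hG h]
  exact fill_sdiff_add_one_iff h

/-- With `F = z - 1` and `N j` the number of indices above `p` with `l i > j`, a child is required
exactly when some `j` below its weight satisfies `F = j + N j`. Since `l` is sorted, the indices
counted by `N j` are the last `N j` ones. Children of degree below `k` have weight `0`. -/
theorem required_rules (hG : G.IsTree) (x : V) (k p z : ℕ) (v : ℕ → V) (l : ℕ → ℕ) (R : ℕ → Prop)
    (hv : Set.BijOn v (Set.Icc 1 k) (G.neighborSet x)) (hpk : p ≤ k) (hz : z = st G x)
    (hl : ∀ i, l i = mst G x (v i)) (hR : ∀ i, R i ↔ ∃ h : G.Adj x (v i), Required h)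
    (hlow : ∀ i ∈ Set.Icc 1 p, deg G (v i) < k) (hhigh : ∀ i ∈ Set.Icc (p + 1) k, k ≤ deg G (v i))
    (hmono : MonotoneOn l (Set.Icc (p + 1) k)) :
    (k + 1 = z → ∀ i ∈ Set.Icc 1 k, R i) ∧
    (z < k + 1 → k + 1 = z + p →
      (∀ i ∈ Set.Icc 1 p, ¬ R i) ∧ ∀ i ∈ Set.Icc (p + 1) k, R i) ∧
    (z < k + 1 → z + p < k + 1 →
      (∀ i ∈ Set.Icc 1 p, ¬ R i) ∧
      (∀ i ∈ Set.Icc (p + 1) (k + 1 - z), ¬ R i) ∧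
      ∀ i ∈ Set.Icc (k + 2 - z) k,
        ((∀ j ∈ Set.Icc (k + 2 - z) i, j - (k + 1 - z) ≤ l (j - 1)) → ¬ R i) ∧
        ((∃ j ∈ Set.Icc (k + 2 - z) i, l (j - 1) < j - (k + 1 - z)) → R i)) := by
  have hk : deg G x = k := by
    rw [deg_eq_ncard, ← hv.ncard_eq, ← Finset.coe_Icc, Set.ncard_coe_finset, Nat.card_Icc]
    omega
  have hadj : ∀ i ∈ Set.Icc 1 k, G.Adj x (v i) := fun i hi => hv.mapsTo hi
  have hw0 : ∀ i ∈ Set.Icc 1 p, weight G x (v i) = 0 := fun i hi => by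
    rw [weight, hk, if_neg (not_le.2 (hlow i hi))]
  have hw1 : ∀ i ∈ Set.Icc (p + 1) k, weight G x (v i) = l i := fun i hi => by
    have ha := hadj i ⟨by have := hi.1; omega, hi.2⟩
    rw [weight, hk, if_pos (hhigh i hi), hl,
      mst_eq_branchNumber hG ha (root_notMem_branch hG ha)]
  set F := fill (G.neighborSet x) (weight G x) with hF
  have hzF : z = F + 1 := by rw [hz, st_eq_fill hG, add_comm]
  have hcount : ∀ j, {w | w ∈ G.neighborSet x ∧ j < weight G x w}.ncard =
      {i | i ∈ Set.Icc (p + 1) k ∧ j < l i}.ncard := by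
    intro j
    refine (Set.BijOn.ncard_eq (f := v) ⟨?_, ?_, ?_⟩).symm
    · rintro i ⟨hi, hj⟩
      exact ⟨hadj i ⟨by have := hi.1; omega, hi.2⟩, by rwa [hw1 i hi]⟩
    · exact hv.injOn.mono fun i hi => Set.mem_Icc.2 ⟨by have := hi.1.1; omega, hi.1.2⟩
    · rintro w ⟨hw, hj⟩
      obtain ⟨i, hi, rfl⟩ := hv.surjOn hw
      by_cases hip : i ≤ p
      · rw [hw0 i ⟨hi.1, hip⟩] at hj
        omega
      · have hi' : i ∈ Set.Icc (p + 1) k := ⟨by omega, hi.2⟩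
        exact ⟨i, Set.mem_ofPred.2 ⟨hi', by rwa [hw1 i hi'] at hj⟩, rfl⟩
  obtain ⟨N, hN⟩ : ∃ N : ℕ → ℕ, ∀ j, N j = {i | i ∈ Set.Icc (p + 1) k ∧ j < l i}.ncard :=
    ⟨_, fun _ => rfl⟩
  have hFle : ∀ j, F ≤ j + N j := fun j => by
    rw [hN, ← hcount]
    exact fill_le _ _ j
  have hRi : ∀ i ∈ Set.Icc 1 k, (R i ↔ ∃ j < weight G x (v i), F = j + N j) := by
    intro i hi
    rw [hR]
    constructor
    · rintro ⟨h, h'⟩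
      obtain ⟨j, hj, he⟩ := (required_iff_exists hG h).1 h'
      exact ⟨j, hj, by rw [hN, ← hcount]; exact he⟩
    · rintro ⟨j, hj, he⟩
      refine ⟨hadj i hi, (required_iff_exists hG _).2 ⟨j, hj, ?_⟩⟩
      rw [hcount, ← hN]
      exact he
  have hlowR : ∀ i ∈ Set.Icc 1 p, ¬ R i := fun i hi hr => by
    obtain ⟨j, hj, -⟩ := (hRi i ⟨hi.1, hi.2.trans hpk⟩).1 hr
    rw [hw0 i hi] at hj
    omega
  have hfin : (Set.Icc (p + 1) k).Finite := Set.finite_Icc _ _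
  have hIcc : ∀ a b : ℕ, (Set.Icc a b).ncard = b + 1 - a := fun a b => by
    rw [← Finset.coe_Icc, Set.ncard_coe_finset, Nat.card_Icc]
  have hNle : ∀ j a, (∀ i ∈ Set.Icc (p + 1) k, j < l i → a ≤ i) → N j ≤ k + 1 - a := by
    intro j a h
    rw [← hIcc a k, hN]
    exact Set.ncard_le_ncard (fun i hi => ⟨h i hi.1 hi.2, hi.1.2⟩) (Set.finite_Icc _ _)
  have hleN : ∀ j a, p + 1 ≤ a → a ≤ k → j < l a → k + 1 - a ≤ N j := by
    intro j a h1 h2 h3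
    rw [← hIcc a k, hN]
    refine Set.ncard_le_ncard (fun i hi => ⟨⟨h1.trans hi.1, hi.2⟩, h3.trans_le ?_⟩)
      (hfin.subset fun i hi => hi.1)
    exact hmono ⟨h1, h2⟩ ⟨h1.trans hi.1, hi.2⟩ hi.1
  -- Here every child of sufficient degree is needed: `N 0 = F`, so `0` is a minimiser and all these
  -- `l i` are positive.
  have hall : F + p = k → ∀ i ∈ Set.Icc (p + 1) k, R i := by
    intro he i hi
    have h0 : N 0 = F := by
      have h1 := hFle 0
      have h2 := hNle 0 (p + 1) fun i hi _ => hi.1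
      omega
    refine (hRi i ⟨by have := hi.1; omega, hi.2⟩).2 ⟨0, ?_, by omega⟩
    have hset : {i | i ∈ Set.Icc (p + 1) k ∧ 0 < l i} = Set.Icc (p + 1) k := by
      refine Set.eq_of_subset_of_ncard_le (fun i hi => hi.1) ?_ hfin
      rw [hIcc]
      have := hN 0
      omega
    have : i ∈ {i | i ∈ Set.Icc (p + 1) k ∧ 0 < l i} := hset.symm ▸ hi
    rw [hw1 i hi]
    exact this.2
  refine ⟨fun h => ?_, fun _ h => ⟨hlowR, hall (by omega)⟩,
    fun h1 h2 => ⟨hlowR, fun i hi hr => ?_, fun i hi => ⟨fun hj hr => ?_, ?_⟩⟩⟩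
  · have hp : p = 0 := by
      have h3 := hFle 0
      have h4 := hNle 0 (p + 1) fun i hi _ => hi.1
      omega
    subst hp
    exact fun i hi => hall (by omega) i ⟨by have := hi.1; omega, hi.2⟩
  -- If `j < l i`, then all of `i, …, k` are counted. These are more than `F` indices, so `j` is no
  -- minimiser.
  · obtain ⟨j, hj, he⟩ := (hRi i ⟨by have := hi.1; omega, by have := hi.2; omega⟩).1 hr
    have hik : i ≤ k := by have := hi.2; omega
    rw [hw1 i ⟨hi.1, hik⟩] at hj
    have h3 := hleN j i hi.1 hik hj
    have := hi.2
    omega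
  · have hi1 := hi.1
    have hi2 := hi.2
    obtain ⟨j, hj', he⟩ := (hRi i ⟨by omega, hi.2⟩).1 hr
    rw [hw1 i ⟨by omega, hi.2⟩] at hj'
    have h3 := hleN j i (by omega) hi.2 hj'
    -- The first counted index is `k + 1 - N j`. The hypothesis at this index says that its
    -- predecessor exceeds `j` as well, which is one counted index too many.
    have h4 := hj (k + 1 - N j) ⟨by omega, by omega⟩
    have h5 := hleN j (k + 1 - N j - 1) (by omega) (by omega) (by omega)
    omega
  · rintro ⟨j, hj, hlj⟩
    have hi1 := hi.1
    have hi2 := hi.2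
    have hj1 := hj.1
    have hj2 := hj.2
    -- For this value `J` the hypothesis gives `l (j - 1) ≤ J`, so only indices from `j` on are
    -- counted and `J + N J ≤ F`.
    refine (hRi i ⟨by omega, hi.2⟩).2 ⟨j - (k + 1 - z) - 1, ?_, ?_⟩
    all_goals
      set J := j - (k + 1 - z) - 1 with hJ
      have hsub : ∀ i ∈ Set.Icc (p + 1) k, J < l i → j ≤ i := by
        intro i' hi' hlt
        by_contra hn
        have := hmono hi' (b := j - 1) ⟨by omega, by omega⟩ (by omega)
        omega
      have h3 := hNle J j hsub
      have h4 := hFle J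
    -- Otherwise only indices after `i` would be counted, and the term at `J` would fall below the
    -- minimum.
    · by_contra hn
      rw [hw1 i ⟨by omega, hi.2⟩] at hn
      have h5 := hNle J (i + 1) fun i' hi' hlt => by
        by_contra hn'
        have := hmono hi' (b := i) ⟨by omega, by omega⟩ (by omega)
        omega
      omega
    · omega

end Rules

/-! ### The program -/

local notation "rNum" => 0
local notation "rZero" => 1
local notation "rOne" => 2
local notation "rRoot" => 3
local notation "rI" => 4
local notation "rTail" => 5
local notation "rX" => 6
local notation "rPar" => 7
local notation "rG" => 8
local notation "rE" => 9
local notation "rEnd" => 10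
local notation "rK" => 11
local notation "rU" => 12
local notation "rL" => 13
local notation "rQ" => 14
local notation "rZ" => 15
local notation "rJ" => 16
local notation "rA" => 17
local notation "rB" => 18
local notation "rBest" => 19
local notation "rArg" => 20

local notation "aOff" => 0
local notation "aNbr" => 1
local notation "aSt" => 2
local notation "aCol" => 3
local notation "aOrd" => 4
local notation "aPar" => 5
local notation "aVal" => 6
local notation "aEntry" => 7
local notation "aCnt" => 8
local notation "aLow" => 9
local notation "aLim" => 10
local notation "aRank" => 11
local notation "aThr" => 12

local infixr:67 " ;; " => Program.seq

/-- The neighbour `u` in cell `e` of the adjacency lists and its value `l`. -/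
def readValue : Program :=
  .load rU aNbr rE ;; .load rL aVal rU ;;
  -- Equality is tested by two strict comparisons.
  .ite rU rPar .skip (.ite rPar rU .skip (.copy rL rG))

/-- Replace the value `l` by `0` if the degree of `u` is less than `k`, and by `k` if it is larger
than `k`. -/
def capValue : Program :=
  .add rA rU rOne ;; .load rA aOff rA ;; .load rB aOff rU ;; .sub rA rA rB ;;
  .ite rA rK (.copy rL rZero) (.ite rK rL (.copy rL rK) .skip)

/-- Store the value `l` and count it. -/
def countValue : Program :=
  .store aEntry rE rL ;; .load rB aCnt rL ;; .add rB rB rOne ;; .store aCnt rL rB ;;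
  .add rE rE rOne

/-- Process the counter of the value `q`. -/
def scanStep : Program :=
  -- The counter is cleared as soon as it is read, which leaves the array clean for the next vertex.
  .store aLow rQ rZ ;; .load rB aCnt rQ ;; .store aCnt rQ rZero ;; .add rZ rZ rB ;;
  -- Neighbours of value at most `q` cannot fill more than `q` slots. The strict test replaces the
  -- threshold only when `q` becomes the unique minimiser, so the smallest minimiser survives.
  .ite rQ rZ (.copy rZ rQ ;; .copy rJ rQ) .skip ;;
  .store aLim rQ rZ ;; .add rQ rQ rOne

/-- Give the neighbour in cell `e` a slot. -/
def rankStep : Program :=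
  .load rU aNbr rE ;; .load rL aEntry rE ;; .load rA aLow rL ;; .load rB aLim rL ;;
  .ite rA rB (.add rA rA rOne ;; .store aLow rL rA ;; .store aRank rU rA)
    (.store aRank rU rZero) ;;
  .add rE rE rOne

/-- Fill the slots of the vertex `x` with its neighbours, whose values are stored in `aVal`, except
for the neighbour `rPar`, which has the value `rG`. -/
def fillSlots : Program :=
  (.load rE aOff rX ;; .add rA rX rOne ;; .load rEnd aOff rA ;; .sub rK rEnd rE) ;;
  .loop rE rEnd (readValue ;; capValue ;; countValue) ;;
  (.const rZ 0 ;; .const rJ 0 ;; .const rQ 0 ;; .add rA rK rOne) ;;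
  .loop rQ rA scanStep ;;
  .load rE aOff rX ;;
  .loop rE rEnd rankStep

/-! ### Correctness of `fillSlots` -/

/-- The value of the neighbour in cell `e` after capping. -/
def entry (off nbr val : ℕ → ℕ) (w g k e : ℕ) : ℕ :=
  if off (nbr e + 1) - off (nbr e) < k then 0
  else min k (if nbr e = w then g else val (nbr e))

theorem runs_readValue {W : ℕ} {s : Memory} :
    Runs W readValue s fun t s' => t ≤ 5 ∧ s'.reg rU = s.arr aNbr (s.reg rE) ∧
      s'.reg rL = if s'.reg rU = s.reg rPar then s.reg rG else s.arr aVal (s'.reg rU) := by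
  apply Runs.of_wp
  simp [readValue, wp]
  refine ⟨fun h => ?_, fun h => ⟨fun h' => ?_, fun h' => ?_⟩⟩
  · intro _; omega
  · intro _; omega
  · intro h''; exact absurd (by omega) h''

theorem runs_capValue {W : ℕ} {s : Memory} (h0 : s.reg rZero = 0) (h1 : s.reg rOne = 1)
    (hu : s.reg rU + 1 ≤ W) :
    Runs W capValue s fun t s' => t ≤ 7 ∧
      s'.reg rL = if s.arr aOff (s.reg rU + 1) - s.arr aOff (s.reg rU) < s.reg rK then 0
        else min (s.reg rK) (s.reg rL) := by
  apply Runs.of_wp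
  simp [capValue, wp, h0, h1]
  refine ⟨hu, fun h => ?_, fun h => ⟨fun h' => ?_, fun h' => ?_⟩⟩
  · intro _; omega
  · rw [if_neg (by omega)]; omega
  · rw [if_neg (by omega)]; omega

theorem runs_readLoop {W : ℕ} {s : Memory} {lo k : ℕ} (h0 : s.reg rZero = 0)
    (h1 : s.reg rOne = 1) (hE : s.reg rE = lo) (hEnd : s.reg rEnd = lo + k) (hK : s.reg rK = k)
    (hcnt : ∀ q, s.arr aCnt q = 0) (hW : lo + k ≤ W)
    (hnbr : ∀ e ∈ Finset.Ico lo (lo + k), s.arr aNbr e + 1 ≤ W) {b : ℕ → ℕ}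
    (hb : b = entry (s.arr aOff) (s.arr aNbr) (s.arr aVal) (s.reg rPar) (s.reg rG) k) :
    Runs W (.loop rE rEnd (readValue ;; capValue ;; countValue)) s fun t s' => t ≤ 20 * k + 1 ∧
      (∀ e ∈ Finset.Ico lo (lo + k), s'.arr aEntry e = b e) ∧
      ∀ q, s'.arr aCnt q = {e ∈ Finset.Ico lo (lo + k) | b e = q}.card := by
  refine (Runs.loop k (fun j t s' => t ≤ 20 * j ∧ s'.reg rE = lo + j ∧
      (∀ e ∈ Finset.Ico lo (lo + j), s'.arr aEntry e = b e) ∧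
      ∀ q, s'.arr aCnt q = {e ∈ Finset.Ico lo (lo + j) | b e = q}.card) ?_ ?_ ?_).mono ?_
  · simp [hE, hcnt]
  · rintro j t s₁ hj hf₁ ⟨ht, hE₁, hent, hc⟩
    have g0 : s₁.reg rZero = 0 := (hf₁.1 _ (by decide)).trans h0
    have g1 : s₁.reg rOne = 1 := (hf₁.1 _ (by decide)).trans h1
    have gK : s₁.reg rK = k := (hf₁.1 _ (by decide)).trans hK
    have gEnd : s₁.reg rEnd = lo + k := (hf₁.1 _ (by decide)).trans hEnd
    refine ⟨by omega, Runs.seq (runs_readValue.mono ?_)⟩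
    rintro t₂ s₂ hf₂ ⟨ht₂, hU₂, hL₂⟩
    have hU : s₂.reg rU = s.arr aNbr (lo + j) := by
      rw [hU₂, hE₁, hf₁.2 aNbr (by decide)]
    refine Runs.seq ((runs_capValue ((hf₂.1 _ (by decide)).trans g0)
      ((hf₂.1 _ (by decide)).trans g1) ?_).mono ?_)
    · rw [hU]
      exact hnbr _ (by simp; omega)
    rintro t₃ s₃ hf₃ ⟨ht₃, hL₃⟩
    have hL : s₃.reg rL = b (lo + j) := by
      rw [hL₃, hL₂, hb, entry, hU, hf₂.1 rK (by decide), gK, hf₂.2 aOff (by decide),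
        hf₁.2 aOff (by decide), hf₁.2 aVal (by decide), hf₁.1 rPar (by decide),
        hf₁.1 rG (by decide)]
    have hE₃ : s₃.reg rE = lo + j := by
      rw [hf₃.1 _ (by decide), hf₂.1 _ (by decide), hE₁]
    have h1₃ : s₃.reg rOne = 1 := by
      rw [hf₃.1 _ (by decide), hf₂.1 _ (by decide), g1]
    have hent₃ : s₃.arr aEntry = s₁.arr aEntry := by
      rw [hf₃.2 _ (by decide), hf₂.2 _ (by decide)]
    have hc₃ : s₃.arr aCnt = s₁.arr aCnt := by
      rw [hf₃.2 _ (by decide), hf₂.2 _ (by decide)]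
    have hcard : ∀ q, {e ∈ Finset.Ico lo (lo + j) | b e = q}.card ≤ j := fun q =>
      (Finset.card_filter_le _ _).trans (by simp)
    have hstep : ∀ q, {e ∈ Finset.Ico lo (lo + (j + 1)) | b e = q}.card =
        {e ∈ Finset.Ico lo (lo + j) | b e = q}.card + if b (lo + j) = q then 1 else 0 := by
      intro q
      rw [← add_assoc, ← Finset.insert_Ico_right_eq_Ico_add_one (by omega), Finset.filter_insert]
      split_ifs
      · rw [Finset.card_insert_of_notMem (by simp)]
      · rfl
    apply Runs.of_wp
    simp only [countValue, wp, Memory.setReg_reg, Memory.setReg_arr, Memory.setArr_reg,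
      Memory.setArr_arr, hL, hE₃, h1₃, hent₃, hc₃, hc, reduceIte, Nat.reduceEqDiff]
    refine ⟨(Nat.add_le_add_right (hcard _) 1).trans (by omega), by omega, by omega, by omega, ?_,
      fun q => ?_⟩
    · intro e he
      rw [Function.update_apply]
      split_ifs with h
      · rw [h]
      · exact hent e (by simp at he ⊢; omega)
    · rw [Function.update_apply, hstep]
      split_ifs with h h' h'
      · rw [h]
      · exact absurd h.symm h'
      · exact absurd h'.symm h
      · rw [hc, add_zero]
  · rintro t s₁ hf ⟨-, hE₁, -⟩
    rw [hE₁, hf.1 rEnd (by decide), hEnd]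
    omega
  · rintro t s₁ - ⟨t', rfl, ht, -, h⟩
    exact ⟨by omega, h⟩

/-- The number of filled slots after the counters of the values less than `q` are processed. -/
def scan (N : ℕ → ℕ) : ℕ → ℕ
  | 0 => 0
  | q + 1 => min (scan N q + N q) q

theorem scan_le (N : ℕ → ℕ) (q : ℕ) : scan N q ≤ q := by
  cases q with
  | zero => exact le_rfl
  | succ q => exact (min_le_right _ _).trans q.le_succ

/-- This is what allows a neighbour of value `q` to take any slot above `scan N q` and up to `scan N
(q + 1)`. -/
theorem scan_succ_le (N : ℕ → ℕ) (q : ℕ) : scan N (q + 1) ≤ q := min_le_right _ _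

theorem scan_le_succ (N : ℕ → ℕ) (q : ℕ) : scan N q ≤ scan N (q + 1) :=
  le_min (Nat.le_add_right _ _) (scan_le N q)

/-- `z` is the minimum of `j + c j`, and `J` is the smallest `j` where it is attained. -/
def IsMinAt (c : ℕ → ℕ) (z J : ℕ) : Prop :=
  z = J + c J ∧ ∀ j, z ≤ j + c j ∧ (z = j + c j → J ≤ j)

/-- The threshold `J` found together with `scan N q`. -/
def IsThreshold (N : ℕ → ℕ) (q J : ℕ) : Prop :=
  (0 < q → J < q ∧ scan N q = J + ∑ i ∈ Finset.Ioo J q, N i) ∧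
    ∀ j < q, scan N q ≤ j + ∑ i ∈ Finset.Ioo j q, N i ∧
      (scan N q = j + ∑ i ∈ Finset.Ioo j q, N i → J ≤ j)

theorem sum_Ioo_succ (N : ℕ → ℕ) {j q : ℕ} (h : j < q) :
    ∑ i ∈ Finset.Ioo j (q + 1), N i = ∑ i ∈ Finset.Ioo j q, N i + N q := by
  have : Finset.Ioo j (q + 1) = insert q (Finset.Ioo j q) := by
    ext i
    simp
    omega
  rw [this, Finset.sum_insert (by simp), add_comm]

theorem sum_Ioo_self_succ (N : ℕ → ℕ) (q : ℕ) : ∑ i ∈ Finset.Ioo q (q + 1), N i = 0 := by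
  have : Finset.Ioo q (q + 1) = ∅ := by
    ext i
    simp
  rw [this, Finset.sum_empty]

/-- Passing to `q + 1` adds `N q` to every old term and creates the new term `q`. The new term
replaces the minimiser only if it is strictly smaller; for `q = 0` it is the only term. -/
theorem IsThreshold.succ {N : ℕ → ℕ} {q J : ℕ} (h : IsThreshold N q J) (hJ : q = 0 → J = 0) :
    IsThreshold N (q + 1) (if q < scan N q + N q then q else J) := by
  have hs : scan N (q + 1) = min (scan N q + N q) q := rfl
  rw [IsThreshold, hs]
  split_ifs with hlt
  · rw [min_eq_right hlt.le]
    refine ⟨fun _ => ⟨q.lt_succ_self, ?_⟩, fun j hj => ?_⟩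
    · rw [sum_Ioo_self_succ, add_zero]
    · rcases (Nat.lt_succ_iff.1 hj).lt_or_eq with hjq | rfl
      · rw [sum_Ioo_succ N hjq]
        have := (h.2 j hjq).1
        constructor <;> omega
      · rw [sum_Ioo_self_succ]
        exact ⟨le_rfl, fun _ => le_rfl⟩
  · rw [not_lt] at hlt
    rw [min_eq_left hlt]
    constructor
    · intro _
      rcases Nat.eq_zero_or_pos q with rfl | hq
      · obtain rfl := hJ rfl
        rw [sum_Ioo_self_succ]
        omega
      · have := h.1 hq
        rw [sum_Ioo_succ N this.1]
        omega
    · intro j hj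
      rcases (Nat.lt_succ_iff.1 hj).lt_or_eq with hjq | rfl
      · rw [sum_Ioo_succ N hjq]
        have := h.2 j hjq
        refine ⟨by omega, fun he => this.2 (by omega)⟩
      · rw [sum_Ioo_self_succ]
        refine ⟨by omega, fun _ => ?_⟩
        rcases Nat.eq_zero_or_pos j with rfl | hq
        · exact (hJ rfl).le
        · exact (h.1 hq).1.le

/-- Summing the counters above `j` counts the entries above `j`. Indices `j > k` cannot compete
because the scan ends with at most `k`. -/
theorem IsThreshold.isMinAt {E : Finset ℕ} {b : ℕ → ℕ} {k J : ℕ} (hbk : ∀ e ∈ E, b e ≤ k)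
    (h : IsThreshold (fun q => {e ∈ E | b e = q}.card) (k + 1) J) :
    IsMinAt (fun j => {e ∈ E | j < b e}.card)
      (scan (fun q => {e ∈ E | b e = q}.card) (k + 1)) J := by
  have hsum : ∀ j, ∑ i ∈ Finset.Ioo j (k + 1), {e ∈ E | b e = i}.card =
      {e ∈ E | j < b e}.card := by
    intro j
    rw [Finset.card_eq_sum_card_fiberwise (f := b) (t := Finset.Ioo j (k + 1))]
    · refine Finset.sum_congr rfl fun i hi => ?_
      congr 1
      ext e
      simp only [Finset.mem_filter, Finset.mem_Ioo] at hi ⊢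
      constructor
      · rintro ⟨h1, h2⟩
        exact ⟨⟨h1, by omega⟩, h2⟩
      · rintro ⟨⟨h1, -⟩, h2⟩
        exact ⟨h1, h2⟩
    · intro e he
      have := (Finset.mem_filter.1 he)
      have := hbk e this.1
      simp
      omega
  simp only [IsThreshold, hsum] at h
  refine ⟨(h.1 k.succ_pos).2, fun j => ?_⟩
  by_cases hj : j < k + 1
  · exact h.2 j hj
  · have h1 := (h.1 k.succ_pos).1
    have h2 := scan_succ_le (fun q => {e ∈ E | b e = q}.card) k
    constructor <;> omega

theorem runs_scanLoop {W : ℕ} {s : Memory} {k : ℕ} {N : ℕ → ℕ} (h0 : s.reg rZero = 0)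
    (h1 : s.reg rOne = 1) (hQ : s.reg rQ = 0) (hZ : s.reg rZ = 0) (hJ : s.reg rJ = 0)
    (hA : s.reg rA = k + 1) (hcnt : ∀ q, s.arr aCnt q = N q) (hN : ∀ q, N q ≤ k)
    (hNk : ∀ q, k < q → N q = 0) (hW : 2 * k + 1 ≤ W) :
    Runs W (.loop rQ rA scanStep) s fun t s' => t ≤ 12 * (k + 1) + 1 ∧
      (∀ q, s'.arr aCnt q = 0) ∧ s'.reg rZ = scan N (k + 1) ∧
      IsThreshold N (k + 1) (s'.reg rJ) ∧
      ∀ q ≤ k, s'.arr aLow q = scan N q ∧ s'.arr aLim q = scan N (q + 1) := by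
  refine (Runs.loop (k + 1) (fun j t s' => t ≤ 12 * j ∧ s'.reg rQ = j ∧ s'.reg rZ = scan N j ∧
      (∀ q, s'.arr aCnt q = if q < j then 0 else N q) ∧
      (IsThreshold N j (s'.reg rJ) ∧ (j = 0 → s'.reg rJ = 0)) ∧
      ∀ q < j, s'.arr aLow q = scan N q ∧ s'.arr aLim q = scan N (q + 1)) ?_ ?_ ?_).mono ?_
  · simp [hQ, hZ, hJ, hcnt, scan, IsThreshold]
  · rintro j t s₁ hj hf ⟨ht, hQ₁, hZ₁, hc, ⟨hJ₁, hJ0⟩, hq⟩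
    have g0 : s₁.reg rZero = 0 := (hf.1 _ (by decide)).trans h0
    have g1 : s₁.reg rOne = 1 := (hf.1 _ (by decide)).trans h1
    have gA : s₁.reg rA = k + 1 := (hf.1 _ (by decide)).trans hA
    refine ⟨by omega, Runs.of_wp ?_⟩
    have hcj : s₁.arr aCnt j = N j := by rw [hc, if_neg (lt_irrefl j)]
    have hs : scan N (j + 1) = min (scan N j + N j) j := rfl
    have hsj := scan_le N j
    have hNj := hN j
    have hthr := hJ₁.succ hJ0
    have hc' : ∀ q, Function.update (s₁.arr aCnt) j 0 q = if q < j + 1 then 0 else N q := by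
      intro q
      rw [Function.update_apply, hc]
      split_ifs <;> first | rfl | omega
    have hq' : ∀ z, z = scan N (j + 1) → ∀ q < j + 1,
        Function.update (s₁.arr aLow) j (scan N j) q = scan N q ∧
        Function.update (s₁.arr aLim) j z q = scan N (q + 1) := by
      intro z hz q hqj
      rw [Function.update_apply, Function.update_apply]
      split_ifs with h
      · subst h
        exact ⟨rfl, hz⟩
      · exact hq q (by omega)
    simp only [scanStep, wp, Memory.setReg_reg, Memory.setReg_arr, Memory.setArr_reg,
      Memory.setArr_arr, hQ₁, hZ₁, g0, g1, hcj, reduceIte, Nat.reduceEqDiff]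
    refine ⟨by omega, fun h => ?_, fun h => ?_⟩
    · rw [if_pos h] at hthr
      rw [min_eq_right h.le] at hs
      exact ⟨by omega, by omega, trivial, hs.symm, hc', ⟨hthr, False.elim⟩, hq' _ hs.symm⟩
    · rw [if_neg h] at hthr
      rw [min_eq_left (not_lt.1 h)] at hs
      exact ⟨by omega, by omega, trivial, hs.symm, hc', ⟨hthr, False.elim⟩, hq' _ hs.symm⟩
  · rintro t s₁ hf ⟨-, hQ₁, -⟩
    rw [hQ₁, hf.1 rA (by decide), hA]
    omega
  · rintro t s₁ - ⟨t', rfl, ht, -, hZ₁, hc, ⟨hJ₁, -⟩, hq⟩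
    refine ⟨by omega, fun q => ?_, hZ₁, hJ₁, fun q hqk => hq q (by omega)⟩
    rw [hc]
    split_ifs
    · rfl
    · exact hNk q (by omega)

/-- Neighbours of value `q` receive the slots after `scan N q` up to `scan N (q + 1)`. For varying
`q` these intervals cover all slots, and the scan guarantees enough neighbours for each; surplus
ones get rank `0`. -/
theorem runs_rankLoop {W : ℕ} {s : Memory} {lo k : ℕ} {b N : ℕ → ℕ} (h0 : s.reg rZero = 0)
    (h1 : s.reg rOne = 1) (hE : s.reg rE = lo) (hEnd : s.reg rEnd = lo + k)
    (hent : ∀ e ∈ Finset.Ico lo (lo + k), s.arr aEntry e = b e)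
    (hb : ∀ e ∈ Finset.Ico lo (lo + k), b e ≤ k)
    (hN : N = fun q => {e ∈ Finset.Ico lo (lo + k) | b e = q}.card)
    (hq : ∀ q ≤ k, s.arr aLow q = scan N q ∧ s.arr aLim q = scan N (q + 1))
    (hinj : Set.InjOn (s.arr aNbr) (Finset.Ico lo (lo + k))) (hW : lo + k ≤ W) :
    Runs W (.loop rE rEnd rankStep) s fun t s' => t ≤ 12 * k + 1 ∧
      (∀ e ∈ Finset.Ico lo (lo + k), s'.arr aRank (s.arr aNbr e) ≤ b e) ∧
      (∀ r, 1 ≤ r → r ≤ scan N (k + 1) →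
        ∃ e ∈ Finset.Ico lo (lo + k), s'.arr aRank (s.arr aNbr e) = r) ∧
      ∀ u, (∀ e ∈ Finset.Ico lo (lo + k), s.arr aNbr e ≠ u) →
        s'.arr aRank u = s.arr aRank u := by
  refine (Runs.loop k (fun j t s' => t ≤ 12 * j ∧ s'.reg rE = lo + j ∧
      (∀ q ≤ k, s'.arr aLow q =
        min (scan N q + {e ∈ Finset.Ico lo (lo + j) | b e = q}.card) (scan N (q + 1))) ∧
      (∀ e ∈ Finset.Ico lo (lo + j), s'.arr aRank (s.arr aNbr e) ≤ b e) ∧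
      (∀ q ≤ k, ∀ r, scan N q < r → r ≤ s'.arr aLow q →
        ∃ e ∈ Finset.Ico lo (lo + j), s'.arr aRank (s.arr aNbr e) = r) ∧
      ∀ u, (∀ e ∈ Finset.Ico lo (lo + j), s.arr aNbr e ≠ u) →
        s'.arr aRank u = s.arr aRank u) ?_ ?_ ?_).mono ?_
  · refine ⟨le_rfl, hE, fun q hqk => ?_, by simp, fun q hqk r h2 h3 => ?_, fun _ _ => rfl⟩
    · rw [(hq q hqk).1]
      simpa using scan_le_succ N q
    · rw [(hq q hqk).1] at h3
      omega
  · rintro j t s₁ hj hf ⟨ht, hE₁, hlow, hle, hsurj, hu⟩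
    have g0 : s₁.reg rZero = 0 := (hf.1 _ (by decide)).trans h0
    have g1 : s₁.reg rOne = 1 := (hf.1 _ (by decide)).trans h1
    have gEnd : s₁.reg rEnd = lo + k := (hf.1 _ (by decide)).trans hEnd
    have gNbr : s₁.arr aNbr = s.arr aNbr := hf.2 _ (by decide)
    have gLim : s₁.arr aLim = s.arr aLim := hf.2 _ (by decide)
    have gEnt : s₁.arr aEntry = s.arr aEntry := hf.2 _ (by decide)
    have hmem : lo + j ∈ Finset.Ico lo (lo + k) := by simp; omega
    have hstep : ∀ q, {e ∈ Finset.Ico lo (lo + (j + 1)) | b e = q}.card =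
        {e ∈ Finset.Ico lo (lo + j) | b e = q}.card + if b (lo + j) = q then 1 else 0 := by
      intro q
      rw [← add_assoc, ← Finset.insert_Ico_right_eq_Ico_add_one (by omega), Finset.filter_insert]
      split_ifs
      · rw [Finset.card_insert_of_notMem (by simp)]
      · rfl
    have hsplit : ∀ e, e ∈ Finset.Ico lo (lo + (j + 1)) ↔
        e ∈ Finset.Ico lo (lo + j) ∨ e = lo + j := by
      intro e
      simp
      omega
    have hne : ∀ e ∈ Finset.Ico lo (lo + j), s.arr aNbr e ≠ s.arr aNbr (lo + j) := by
      intro e he h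
      rw [Finset.mem_Ico] at he
      have := hinj (by simp; omega) (by simp; omega) h
      omega
    have hbj := hb _ hmem
    set B := b (lo + j) with hB
    have hlowB := hlow B hbj
    have hlim := (hq B hbj).2
    refine ⟨by omega, Runs.of_wp ?_⟩
    simp only [rankStep, wp, Memory.setReg_reg, Memory.setReg_arr, Memory.setArr_reg,
      Memory.setArr_arr, hE₁, gNbr, gEnt, gLim, hent _ hmem, ← hB, g0, g1, hlim, reduceIte,
      Nat.reduceEqDiff]
    have hsB := scan_succ_le N B
    refine ⟨fun h => ⟨by omega, by omega, by omega, by omega, fun q hqk => ?_, ?_, ?_, ?_⟩,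
      fun h => ⟨by omega, by omega, by omega, fun q hqk => ?_, ?_, ?_, ?_⟩⟩
    · rw [Function.update_apply, hstep]
      split_ifs with h1 h2 h2
      · subst h1
        omega
      · exact absurd h1.symm h2
      · exact absurd h2.symm h1
      · exact hlow q hqk
    · intro e he
      rcases (hsplit e).1 he with he | rfl
      · rw [Function.update_of_ne (hne e he)]
        exact hle e he
      · rw [Function.update_self]
        omega
    · intro q hqk r h1 h2
      by_cases hqr : q = B ∧ r = s₁.arr aLow B + 1
      · exact ⟨lo + j, (hsplit _).2 (Or.inr rfl), by rw [Function.update_self, hqr.2]⟩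
      · have h3 : r ≤ s₁.arr aLow q := by
          rw [Function.update_apply] at h2
          split_ifs at h2 with h4
          · subst h4
            have : r ≠ s₁.arr aLow B + 1 := fun h5 => hqr ⟨rfl, h5⟩
            omega
          · exact h2
        obtain ⟨e, he, her⟩ := hsurj q hqk r h1 h3
        exact ⟨e, (hsplit e).2 (Or.inl he), by rw [Function.update_of_ne (hne e he), her]⟩
    · intro u hu'
      rw [Function.update_of_ne (hu' _ ((hsplit _).2 (Or.inr rfl))).symm]
      exact hu u fun e he => hu' e ((hsplit e).2 (Or.inl he))
    · rw [hstep]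
      split_ifs with h1
      · subst h1
        omega
      · exact hlow q hqk
    · intro e he
      rcases (hsplit e).1 he with he | rfl
      · rw [Function.update_of_ne (hne e he)]
        exact hle e he
      · rw [Function.update_self]
        omega
    · intro q hqk r h1 h2
      obtain ⟨e, he, her⟩ := hsurj q hqk r h1 h2
      exact ⟨e, (hsplit e).2 (Or.inl he), by rw [Function.update_of_ne (hne e he), her]⟩
    · intro u hu'
      rw [Function.update_of_ne (hu' _ ((hsplit _).2 (Or.inr rfl))).symm]
      exact hu u fun e he => hu' e ((hsplit e).2 (Or.inl he))
  · rintro t s₁ hf ⟨-, hE₁, -⟩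
    rw [hE₁, hf.1 rEnd (by decide), hEnd]
    omega
  · rintro t s₁ - ⟨t', rfl, ht, -, hlow, hle, hsurj, hu⟩
    refine ⟨by omega, hle, fun r h2 h3 => ?_, hu⟩
    -- Locates the interval, hence the value `q'`, to which the slot `r` belongs.
    have key : ∀ q ≤ k + 1, r ≤ scan N q → ∃ q' < q, scan N q' < r ∧ r ≤ scan N (q' + 1) := by
      intro q
      induction q with
      | zero => intro _ h; simp [scan] at h; omega
      | succ q ih =>
        intro hqk h
        by_cases hr : r ≤ scan N q
        · obtain ⟨q', h4, h5⟩ := ih (by omega) hr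
          exact ⟨q', by omega, h5⟩
        · exact ⟨q, q.lt_succ_self, by omega, h⟩
    obtain ⟨q, hqk, h4, h5⟩ := key (k + 1) le_rfl h3
    refine hsurj q (by omega) r h4 ?_
    have h6 : scan N (q + 1) = min (scan N q + N q) q := rfl
    have h7 : N q = {e ∈ Finset.Ico lo (lo + k) | b e = q}.card := by rw [hN]
    rw [hlow q (by omega), ← h7]
    omega

/-- Capped values need only the counters `0, …, k`, whence the cost is linear in the degree. The
counters are zero before and after, so no global reset is ever needed. -/
theorem runs_fillSlots {W : ℕ} {s : Memory} {lo k : ℕ} {b : ℕ → ℕ} (h0 : s.reg rZero = 0)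
    (h1 : s.reg rOne = 1) (hlo : s.arr aOff (s.reg rX) = lo)
    (hhi : s.arr aOff (s.reg rX + 1) = lo + k) (hcnt : ∀ q, s.arr aCnt q = 0)
    (hnbr : ∀ e ∈ Finset.Ico lo (lo + k), s.arr aNbr e + 1 ≤ W)
    (hinj : Set.InjOn (s.arr aNbr) (Finset.Ico lo (lo + k)))
    (hX : s.reg rX + 1 ≤ W) (hW : lo + k ≤ W) (hW' : 2 * k + 1 ≤ W)
    (hb : b = entry (s.arr aOff) (s.arr aNbr) (s.arr aVal) (s.reg rPar) (s.reg rG) k) :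
    Runs W fillSlots s fun t s' => t ≤ 50 * (k + 1) ∧ (∀ q, s'.arr aCnt q = 0) ∧
      IsMinAt (fun j => {e ∈ Finset.Ico lo (lo + k) | j < b e}.card) (s'.reg rZ) (s'.reg rJ) ∧
      (∀ e ∈ Finset.Ico lo (lo + k), s'.arr aRank (s.arr aNbr e) ≤ b e) ∧
      (∀ r, 1 ≤ r → r ≤ s'.reg rZ →
        ∃ e ∈ Finset.Ico lo (lo + k), s'.arr aRank (s.arr aNbr e) = r) ∧
      ∀ u, (∀ e ∈ Finset.Ico lo (lo + k), s.arr aNbr e ≠ u) →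
        s'.arr aRank u = s.arr aRank u := by
  have hbk : ∀ e, b e ≤ k := fun e => by
    rw [hb, entry]
    split_ifs
    · exact Nat.zero_le _
    · exact min_le_left _ _
    · exact min_le_left _ _
  obtain ⟨N, hN⟩ : ∃ N : ℕ → ℕ, N = fun q => {e ∈ Finset.Ico lo (lo + k) | b e = q}.card :=
    ⟨_, rfl⟩
  have hcard : (Finset.Ico lo (lo + k)).card = k := by simp
  unfold fillSlots
  have step1 : Runs W (.load rE aOff rX ;; .add rA rX rOne ;; .load rEnd aOff rA ;;
      .sub rK rEnd rE) s fun t s' => t = 4 ∧ s'.reg rE = lo ∧ s'.reg rEnd = lo + k ∧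
        s'.reg rK = k := by
    apply Runs.of_wp
    simp [wp, h1, hlo, hhi, hX]
  refine Runs.seq (step1.mono ?_)
  rintro t₁ s₁ hf₁ ⟨rfl, hE₁, hEnd₁, hK₁⟩
  refine Runs.seq ((runs_readLoop (b := b) ((hf₁.1 _ (by decide)).trans h0)
    ((hf₁.1 _ (by decide)).trans h1) hE₁ hEnd₁ hK₁ ?_ hW ?_ ?_).mono ?_)
  · rwa [hf₁.2 _ (by decide)]
  · rwa [hf₁.2 _ (by decide)]
  · rw [hb, hf₁.2 _ (by decide), hf₁.2 _ (by decide), hf₁.2 _ (by decide), hf₁.1 _ (by decide),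
      hf₁.1 _ (by decide)]
  rintro t₂ s₂ hf₂ ⟨ht₂, hent₂, hcnt₂⟩
  have g1₂ : s₂.reg rOne = 1 := by rw [hf₂.1 _ (by decide), hf₁.1 _ (by decide), h1]
  have step2 : Runs W (.const rZ 0 ;; .const rJ 0 ;; .const rQ 0 ;; .add rA rK rOne) s₂
      fun t s' => t = 4 ∧ s'.reg rZ = 0 ∧ s'.reg rJ = 0 ∧ s'.reg rQ = 0 ∧
        s'.reg rA = k + 1 := by
    have : s₂.reg rK = k := (hf₂.1 _ (by decide)).trans hK₁
    apply Runs.of_wp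
    simp [wp, g1₂, this]
    omega
  refine Runs.seq (step2.mono ?_)
  rintro t₃ s₃ hf₃ ⟨rfl, hZ₃, hJ₃, hQ₃, hA₃⟩
  refine Runs.seq ((runs_scanLoop (k := k) (N := N) ?_ ((hf₃.1 _ (by decide)).trans g1₂) hQ₃ hZ₃
    hJ₃ hA₃ ?_ ?_ ?_ hW').mono ?_)
  · rw [hf₃.1 _ (by decide), hf₂.1 _ (by decide), hf₁.1 _ (by decide), h0]
  · intro q
    rw [hf₃.2 _ (by decide), hcnt₂, hN]
  · intro q
    rw [hN]
    exact (Finset.card_filter_le _ _).trans hcard.le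
  · intro q hq
    rw [hN]
    refine Finset.card_eq_zero.2 (Finset.filter_eq_empty_iff.2 fun e _ he => ?_)
    have := hbk e
    omega
  rintro t₄ s₄ hf₄ ⟨ht₄, hcnt₄, hZ₄, hJ₄, hq₄⟩
  have hframe : Frame fillSlots s s₄ :=
    (hf₁.mono (by decide) (by decide)).trans ((hf₂.mono (by decide) (by decide)).trans
      ((hf₃.mono (by decide) (by decide)).trans (hf₄.mono (by decide) (by decide))))
  have hnbr₄ : s₄.arr aNbr = s.arr aNbr := hframe.2 _ (by decide)
  have hrank₄ : s₄.arr aRank = s.arr aRank := by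
    rw [hf₄.2 _ (by decide), hf₃.2 _ (by decide), hf₂.2 _ (by decide), hf₁.2 _ (by decide)]
  have step3 : Runs W (.load rE aOff rX) s₄ fun t s' => t = 1 ∧ s'.reg rE = lo := by
    have h2 : s₄.reg rX = s.reg rX := hframe.1 _ (by decide)
    have h3 : s₄.arr aOff = s.arr aOff := hframe.2 _ (by decide)
    apply Runs.of_wp
    simp [wp, h2, h3, hlo]
  refine Runs.seq (step3.mono ?_)
  rintro t₅ s₅ hf₅ ⟨rfl, hE₅⟩
  have hnbr₅ : s₅.arr aNbr = s.arr aNbr := (hf₅.2 _ (by decide)).trans hnbr₄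
  refine (runs_rankLoop (b := b) (N := N) (k := k) ?_ ?_ hE₅ ?_ ?_ (fun e _ => hbk e) hN ?_ ?_
    hW).mono ?_
  · rw [hf₅.1 _ (by decide), hframe.1 _ (by decide), h0]
  · rw [hf₅.1 _ (by decide), hframe.1 _ (by decide), h1]
  · rw [hf₅.1 _ (by decide), hf₄.1 _ (by decide), hf₃.1 _ (by decide), hf₂.1 _ (by decide), hEnd₁]
  · rw [hf₅.2 _ (by decide), hf₄.2 _ (by decide), hf₃.2 _ (by decide)]
    exact hent₂
  · rw [hf₅.2 _ (by decide), hf₅.2 _ (by decide)]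
    exact hq₄
  · rwa [hnbr₅]
  rintro t₆ s₆ hf₆ ⟨ht₆, hle, hsurj, hu⟩
  rw [hnbr₅] at hle hsurj hu
  have hZ₆ : s₆.reg rZ = scan N (k + 1) := by
    rw [hf₆.1 _ (by decide), hf₅.1 _ (by decide), hZ₄]
  have hJ₆ : s₆.reg rJ = s₄.reg rJ := by
    rw [hf₆.1 _ (by decide), hf₅.1 _ (by decide)]
  refine ⟨by omega, fun q => ?_, ?_, hle, ?_, fun u hu' => ?_⟩
  · rw [hf₆.2 _ (by decide), hf₅.2 _ (by decide), hcnt₄]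
  · rw [hZ₆, hJ₆]
    subst hN
    exact hJ₄.isMinAt fun e _ => hbk e
  · rwa [hZ₆]
  · rw [hu u hu', hf₅.2 _ (by decide), hrank₄]

/-! ### Breadth-first search -/

/-- Append the vertex `u` to the queue. -/
def push : Program :=
  .store aOrd rTail rU ;; .store aPar rU rX ;; .add rTail rTail rOne

/-- Look at the neighbour in cell `e`. -/
def searchStep : Program :=
  .load rU aNbr rE ;; .ite rU rPar push (.ite rPar rU push .skip) ;; .add rE rE rOne

/-- Process the vertex at position `i` of the queue. -/
def searchVertex : Program :=
  (.load rX aOrd rI ;; .load rPar aPar rX ;; .load rE aOff rX ;; .add rA rX rOne ;;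
    .load rEnd aOff rA) ;;
  .loop rE rEnd searchStep ;; .add rI rI rOne

/-- List the vertices and their parents, starting at the root. -/
def search : Program :=
  (.store aOrd rZero rRoot ;; .store aPar rRoot rNum ;; .copy rTail rOne ;; .copy rI rZero) ;;
  .loop rI rNum searchVertex

/-- The cells of the neighbours of `x`. -/
def cells (off : ℕ → ℕ) (x : ℕ) : Finset ℕ := Finset.Ico (off x) (off (x + 1))

/-- The adjacency lists `off`, `nbr` describe a tree with root `r`, where `Ch x u` says that `u` is
a child of `x`. -/
structure IsRooted (n : ℕ) (off nbr : ℕ → ℕ) (r : ℕ) (Ch : ℕ → ℕ → Prop) : Prop where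
  root_lt : r < n
  off_zero : off 0 = 0
  off_le : ∀ x < n, off x ≤ off (x + 1)
  injOn : ∀ x < n, Set.InjOn nbr (cells off x)
  nbr_lt : ∀ x < n, ∀ e ∈ cells off x, nbr e < n
  child_or : ∀ x < n, ∀ e ∈ cells off x, Ch x (nbr e) ∨ Ch (nbr e) x
  lt_left : ∀ x u, Ch x u → x < n
  lt_right : ∀ x u, Ch x u → u < n
  exists_cell : ∀ x u, Ch x u → ∃ e ∈ cells off x, nbr e = u
  unique : ∀ x y u, Ch x u → Ch y u → x = y
  not_root : ∀ x, ¬ Ch x r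
  asymm : ∀ x u, Ch x u → ¬ Ch u x
  connected : ∀ P : ℕ → Prop, P r → (∀ x u, P x → Ch x u → P u) → ∀ x < n, P x

/-- The arrays `ord` and `par` list the vertices of a rooted tree from the root downwards, and the
parents of the vertices. -/
structure IsOrder (n r : ℕ) (Ch : ℕ → ℕ → Prop) (ord par : ℕ → ℕ) : Prop where
  lt : ∀ i < n, ord i < n
  inj : ∀ i < n, ∀ j < n, ord i = ord j → i = j
  surj : ∀ x < n, ∃ i < n, ord i = x
  ord_zero : ord 0 = r
  par_root : par r = n
  par_child : ∀ x u, Ch x u → par u = x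
  exists_parent : ∀ i, 0 < i → i < n → ∃ j < i, Ch (ord j) (ord i)
  lt_of_child : ∀ i < n, ∀ j < n, Ch (ord i) (ord j) → i < j

/-- The state of the search when the first `i` vertices of the queue and the cells before `e` of
the next vertex are processed. -/
structure IsQueue (n : ℕ) (off nbr : ℕ → ℕ) (r : ℕ) (Ch : ℕ → ℕ → Prop) (i e tail : ℕ)
    (ord par : ℕ → ℕ) : Prop where
  pos : 0 < tail
  lt : ∀ m < tail, ord m < n
  inj : ∀ m < tail, ∀ m' < tail, ord m = ord m' → m = m'
  ord_zero : ord 0 = r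
  par_root : par r = n
  par_spec : ∀ m, 0 < m → m < tail → ∃ j < m, par (ord m) = ord j ∧ Ch (ord j) (ord m) ∧
    (j < i ∨ j = i ∧ ∃ e' ∈ Finset.Ico (off (ord i)) e, nbr e' = ord m)
  closed : ∀ j < i, ∀ u, Ch (ord j) u → ∃ m < tail, ord m = u
  closed_cells : ∀ e' ∈ Finset.Ico (off (ord i)) e, Ch (ord i) (nbr e') →
    ∃ m < tail, ord m = nbr e'

section Search

variable {n r i e tail : ℕ} {off nbr ord par : ℕ → ℕ} {Ch : ℕ → ℕ → Prop}

theorem IsQueue.tail_le (h : IsQueue n off nbr r Ch i e tail ord par) : tail ≤ n := by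
  have := Finset.card_le_card_of_injOn (s := Finset.range tail) (t := Finset.range n) ord
    (fun m hm => by simpa using h.lt m (by simpa using hm))
    (fun m hm m' hm' he => h.inj m (by simpa using hm) m' (by simpa using hm') he)
  simpa using this

theorem IsQueue.mem_of_le (hR : IsRooted n off nbr r Ch)
    (h : IsQueue n off nbr r Ch i e tail ord par) (hi : tail ≤ i) {x : ℕ} (hx : x < n) :
    ∃ m < tail, ord m = x := by
  refine hR.connected (fun x => ∃ m < tail, ord m = x) ⟨0, h.pos, h.ord_zero⟩ ?_ x hx
  rintro _ u ⟨m, hm, rfl⟩ hu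
  exact h.closed m (hm.trans_le hi) u hu

theorem IsQueue.le_tail (hR : IsRooted n off nbr r Ch)
    (h : IsQueue n off nbr r Ch i e tail ord par) (hi : tail ≤ i) : n ≤ tail := by
  have := Finset.card_le_card_of_surjOn (s := Finset.range tail) (t := Finset.range n) ord
    (fun x hx => by
      obtain ⟨m, hm, hmx⟩ := h.mem_of_le hR hi (x := x) (by simpa using hx)
      exact ⟨m, by simpa using hm, hmx⟩)
  simpa using this

/-- An exhausted queue is closed under children and hence contains all vertices. So it cannot run
dry early, and the search may loop exactly `n` times. -/
theorem IsQueue.lt_tail (hR : IsRooted n off nbr r Ch)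
    (h : IsQueue n off nbr r Ch i e tail ord par) (hi : i < n) : i < tail := by
  by_contra hn
  have := h.le_tail hR (not_lt.1 hn)
  omega

theorem IsQueue.isOrder (hR : IsRooted n off nbr r Ch)
    (h : IsQueue n off nbr r Ch n e tail ord par) : IsOrder n r Ch ord par := by
  obtain rfl : tail = n := le_antisymm h.tail_le (h.le_tail hR h.tail_le)
  have hpar : ∀ x u, Ch x u → ∃ m, 0 < m ∧ m < tail ∧ ord m = u ∧
      ∃ j < m, par u = ord j ∧ ord j = x := by
    intro x u hu
    obtain ⟨m, hm, rfl⟩ := h.mem_of_le hR le_rfl (hR.lt_right x u hu)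
    have hm0 : 0 < m := by
      rcases Nat.eq_zero_or_pos m with rfl | hm0
      · exact absurd (h.ord_zero ▸ hu) (hR.not_root x)
      · exact hm0
    obtain ⟨j, hj, h1, h2, -⟩ := h.par_spec m hm0 hm
    exact ⟨m, hm0, hm, rfl, j, hj, h1, hR.unique _ _ _ h2 hu⟩
  refine ⟨h.lt, h.inj, fun x hx => h.mem_of_le hR le_rfl hx, h.ord_zero, h.par_root, ?_, ?_, ?_⟩
  · intro x u hu
    obtain ⟨m, -, -, -, j, -, h1, h2⟩ := hpar x u hu
    exact h1.trans h2
  · intro i hi hin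
    obtain ⟨j, hj, -, h2, -⟩ := h.par_spec i hi hin
    exact ⟨j, hj, h2⟩
  · intro i hi j hj hc
    obtain ⟨m, -, hm, h1, j', hj', -, h2⟩ := hpar _ _ hc
    obtain rfl := h.inj m hm j hj h1
    obtain rfl := h.inj j' (hj'.trans hm) i hi h2
    exact hj'

/-- In a queue, the neighbours of the current vertex other than its parent are its children. -/
theorem IsQueue.child_iff (hR : IsRooted n off nbr r Ch)
    (h : IsQueue n off nbr r Ch i e tail ord par) (hi : i < tail) {e' : ℕ}
    (he : e' ∈ cells off (ord i)) : Ch (ord i) (nbr e') ↔ nbr e' ≠ par (ord i) := by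
  have hn := h.lt i hi
  rcases Nat.eq_zero_or_pos i with rfl | h0
  · rw [h.ord_zero] at he hn ⊢
    rw [h.par_root]
    have h1 := hR.nbr_lt r hn e' he
    refine iff_of_true ?_ h1.ne
    rcases hR.child_or r hn e' he with h2 | h2
    · exact h2
    · exact absurd h2 (hR.not_root _)
  · obtain ⟨j, -, h1, h2, -⟩ := h.par_spec i h0 hi
    rw [h1]
    constructor
    · intro h3 h4
      exact hR.asymm _ _ h2 (h4 ▸ h3)
    · intro h3
      rcases hR.child_or _ hn e' he with h4 | h4
      · exact h4
      · exact absurd (hR.unique _ _ _ h4 h2) h3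

theorem IsQueue.skip (hR : IsRooted n off nbr r Ch)
    (h : IsQueue n off nbr r Ch i e tail ord par) (hi : i < tail) (he : e ∈ cells off (ord i))
    (hp : nbr e = par (ord i)) : IsQueue n off nbr r Ch i (e + 1) tail ord par := by
  refine ⟨h.pos, h.lt, h.inj, h.ord_zero, h.par_root, fun m h0 hm => ?_, h.closed, ?_⟩
  · obtain ⟨j, hj, h1, h2, h3⟩ := h.par_spec m h0 hm
    refine ⟨j, hj, h1, h2, h3.imp_right fun ⟨h4, e', h5, h6⟩ => ⟨h4, e', ?_, h6⟩⟩
    simp at h5 ⊢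
    omega
  · intro e' he' hc
    by_cases h1 : e' = e
    · subst h1
      exact absurd hp ((h.child_iff hR hi he).1 hc)
    · exact h.closed_cells e' (by simp at he' ⊢; omega) hc

theorem IsQueue.push (hR : IsRooted n off nbr r Ch)
    (h : IsQueue n off nbr r Ch i e tail ord par) (hi : i < tail) (he : e ∈ cells off (ord i))
    (hp : nbr e ≠ par (ord i)) : IsQueue n off nbr r Ch i (e + 1) (tail + 1)
      (Function.update ord tail (nbr e)) (Function.update par (nbr e) (ord i)) := by
  have hn := h.lt i hi
  have hc := (h.child_iff hR hi he).2 hp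
  have hur : nbr e ≠ r := fun hur => hR.not_root _ (hur ▸ hc)
  -- A vertex queued before would have the same parent, hence would have been found in an earlier
  -- cell of the same list; but a list has no repetitions.
  have hnew : ∀ m < tail, ord m ≠ nbr e := by
    intro m hm hme
    have h0 : 0 < m := by
      rcases Nat.eq_zero_or_pos m with rfl | h0
      · exact absurd (hme.symm.trans h.ord_zero) hur
      · exact h0
    obtain ⟨j, hj, -, h2, h3⟩ := h.par_spec m h0 hm
    rw [hme] at h2
    have hji : j = i := h.inj j (hj.trans hm) i hi (hR.unique _ _ _ h2 hc)
    rcases h3 with h3 | ⟨-, e', he', h4⟩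
    · omega
    · simp only [cells, Finset.mem_Ico] at he he'
      have := hR.injOn _ hn (x₁ := e') (x₂ := e) (by simp [cells]; omega) (by simp [cells]; omega)
        (h4.trans hme)
      omega
  have ho : ∀ m < tail, Function.update ord tail (nbr e) m = ord m := fun m hm =>
    Function.update_of_ne hm.ne _ _
  have hself : Function.update ord tail (nbr e) tail = nbr e := Function.update_self _ _ _
  refine ⟨Nat.succ_pos _, fun m hm => ?_, fun m hm m' hm' hmm => ?_, ?_, ?_, fun m h0 hm => ?_,
    fun j hj u hu => ?_, fun e' he' hc' => ?_⟩
  · rcases (Nat.lt_succ_iff.1 hm).lt_or_eq with hm | rfl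
    · rw [ho m hm]
      exact h.lt m hm
    · rw [hself]
      exact hR.nbr_lt _ hn e he
  · rcases (Nat.lt_succ_iff.1 hm).lt_or_eq with hm | rfl <;>
      rcases (Nat.lt_succ_iff.1 hm').lt_or_eq with hm' | rfl
    · rw [ho m hm, ho m' hm'] at hmm
      exact h.inj m hm m' hm' hmm
    · rw [ho m hm, hself] at hmm
      exact absurd hmm (hnew m hm)
    · rw [ho m' hm', hself] at hmm
      exact absurd hmm.symm (hnew m' hm')
    · rfl
  · rw [ho 0 h.pos, h.ord_zero]
  · rw [Function.update_of_ne hur.symm, h.par_root]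
  · rw [ho i hi]
    rcases (Nat.lt_succ_iff.1 hm).lt_or_eq with hm | rfl
    · obtain ⟨j, hj, h1, h2, h3⟩ := h.par_spec m h0 hm
      refine ⟨j, hj, ?_, ?_, h3.imp_right fun ⟨h4, e', h5, h6⟩ => ⟨h4, e', ?_, ?_⟩⟩
      · rw [ho m hm, ho j (hj.trans hm), Function.update_of_ne (hnew m hm), h1]
      · rw [ho m hm, ho j (hj.trans hm)]
        exact h2
      · simp at h5 ⊢
        omega
      · rw [ho m hm, h6]
    · refine ⟨i, hi, ?_, ?_, Or.inr ⟨rfl, e, ?_, ?_⟩⟩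
      · rw [hself, Function.update_self, ho i hi]
      · rw [hself, ho i hi]
        exact hc
      · simp [cells] at he ⊢
        omega
      · rw [hself]
  · rw [ho j (hj.trans hi)] at hu
    obtain ⟨m, hm, hmu⟩ := h.closed j hj u hu
    exact ⟨m, by omega, by rw [ho m hm, hmu]⟩
  · rw [ho i hi] at he' hc'
    by_cases h1 : e' = e
    · subst h1
      exact ⟨tail, by omega, hself⟩
    · obtain ⟨m, hm, hmu⟩ := h.closed_cells e' (by simp at he' ⊢; omega) hc'
      exact ⟨m, by omega, by rw [ho m hm, hmu]⟩

/-- Both cell positions say that no cell of the next vertex has been processed. The value `0` serves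
between rounds because it does not depend on that vertex. -/
theorem IsQueue.start (h : IsQueue n off nbr r Ch i 0 tail ord par) :
    IsQueue n off nbr r Ch i (off (ord i)) tail ord par := by
  refine ⟨h.pos, h.lt, h.inj, h.ord_zero, h.par_root, fun m h0 hm => ?_, h.closed, by simp⟩
  obtain ⟨j, hj, h1, h2, h3⟩ := h.par_spec m h0 hm
  refine ⟨j, hj, h1, h2, h3.imp_right fun ⟨_, e', h5, _⟩ => ?_⟩
  simp at h5

theorem IsQueue.finish (hR : IsRooted n off nbr r Ch) (hi : i < tail)
    (h : IsQueue n off nbr r Ch i (off (ord i + 1)) tail ord par) :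
    IsQueue n off nbr r Ch (i + 1) 0 tail ord par := by
  refine ⟨h.pos, h.lt, h.inj, h.ord_zero, h.par_root, fun m h0 hm => ?_, fun j hj u hu => ?_,
    by simp⟩
  · obtain ⟨j, hj, h1, h2, h3⟩ := h.par_spec m h0 hm
    exact ⟨j, hj, h1, h2, Or.inl (by omega)⟩
  · rcases (Nat.lt_succ_iff.1 hj).lt_or_eq with hj | rfl
    · exact h.closed j hj u hu
    · obtain ⟨e', he', rfl⟩ := hR.exists_cell _ _ hu
      exact h.closed_cells e' he' hu

theorem IsOrder.sum_eq (h : IsOrder n r Ch ord par) (F : ℕ → ℕ) :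
    ∑ j ∈ Finset.range n, F (ord j) = ∑ x ∈ Finset.range n, F x := by
  refine Finset.sum_bij (fun j _ => ord j) (fun j hj => ?_) (fun j hj j' hj' he => ?_)
    (fun x hx => ?_) (fun _ _ => rfl)
  · simpa using h.lt j (by simpa using hj)
  · exact h.inj j (by simpa using hj) j' (by simpa using hj') he
  · obtain ⟨i, hi, he⟩ := h.surj x (by simpa using hx)
    exact ⟨i, by simpa using hi, he⟩

theorem off_le_off (h : ∀ x < n, off x ≤ off (x + 1)) {x : ℕ} (hx : x ≤ n) : off x ≤ off n := by
  induction hx using Nat.decreasingInduction with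
  | self => exact le_rfl
  | of_succ k hk ih => exact (h k hk).trans ih

theorem sum_card_cells (h0 : off 0 = 0) (h : ∀ x < n, off x ≤ off (x + 1)) :
    ∑ x ∈ Finset.range n, (cells off x).card = off n := by
  induction n with
  | zero => simp [h0]
  | succ m ih =>
    rw [Finset.sum_range_succ, ih fun x hx => h x (by omega), cells, Nat.card_Ico]
    have := h m (by omega)
    omega

theorem runs_searchStep {W : ℕ} {s : Memory} (hR : IsRooted n off nbr r Ch)
    (h1 : s.reg rOne = 1) (hNbr : s.arr aNbr = nbr) (hi : i < s.reg rTail)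
    (hX : s.reg rX = s.arr aOrd i) (hP : s.reg rPar = s.arr aPar (s.arr aOrd i))
    (hQ : IsQueue n off nbr r Ch i (s.reg rE) (s.reg rTail) (s.arr aOrd) (s.arr aPar))
    (he : s.reg rE ∈ cells off (s.arr aOrd i)) (hW : s.reg rE + 1 ≤ W) (hnW : n < W) :
    Runs W searchStep s fun t s' => t ≤ 7 ∧ s'.reg rE = s.reg rE + 1 ∧ i < s'.reg rTail ∧
      IsQueue n off nbr r Ch i (s.reg rE + 1) (s'.reg rTail) (s'.arr aOrd) (s'.arr aPar) ∧
      (∀ m ≤ i, s'.arr aOrd m = s.arr aOrd m) ∧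
      s'.arr aPar (s.arr aOrd i) = s.arr aPar (s.arr aOrd i) := by
  have htail := hQ.tail_le
  have hpush : nbr (s.reg rE) ≠ s.reg rPar →
      i < s.reg rTail + 1 ∧
      IsQueue n off nbr r Ch i (s.reg rE + 1) (s.reg rTail + 1)
        (Function.update (s.arr aOrd) (s.reg rTail) (nbr (s.reg rE)))
        (Function.update (s.arr aPar) (nbr (s.reg rE)) (s.reg rX)) ∧
      (∀ m ≤ i, Function.update (s.arr aOrd) (s.reg rTail) (nbr (s.reg rE)) m = s.arr aOrd m) ∧
      Function.update (s.arr aPar) (nbr (s.reg rE)) (s.reg rX) (s.arr aOrd i) =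
        s.arr aPar (s.arr aOrd i) := by
    intro hne
    rw [hP] at hne
    rw [hX]
    refine ⟨by omega, hQ.push hR hi he hne, fun m hm => Function.update_of_ne (by omega) _ _,
      Function.update_of_ne (fun h => ?_) _ _⟩
    have hc := (hQ.child_iff hR hi he).2 hne
    rw [← h] at hc
    exact hR.asymm _ _ hc hc
  have hskip : nbr (s.reg rE) = s.reg rPar →
      IsQueue n off nbr r Ch i (s.reg rE + 1) (s.reg rTail) (s.arr aOrd) (s.arr aPar) := by
    intro heq
    exact hQ.skip hR hi he (heq.trans hP)
  apply Runs.of_wp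
  simp only [searchStep, StrongTrans.push, wp, Memory.setReg_reg, Memory.setReg_arr,
    Memory.setArr_reg, Memory.setArr_arr, hNbr, h1, reduceIte, Nat.reduceEqDiff]
  refine ⟨fun h => ⟨by omega, hW, by omega, trivial, hpush h.ne⟩, fun h =>
    ⟨fun h' => ⟨by omega, hW, by omega, trivial, hpush h'.ne'⟩, fun h' =>
      ⟨hW, by omega, trivial, hi, hskip (by omega), fun _ _ => trivial, trivial⟩⟩⟩

theorem runs_searchVertex {W : ℕ} {s : Memory} (hR : IsRooted n off nbr r Ch)
    (h1 : s.reg rOne = 1) (hOff : s.arr aOff = off) (hNbr : s.arr aNbr = nbr)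
    (hI : s.reg rI = i) (hi : i < n)
    (hQ : IsQueue n off nbr r Ch i 0 (s.reg rTail) (s.arr aOrd) (s.arr aPar))
    (hW : off n + n < W) :
    Runs W searchVertex s fun t s' => t ≤ 10 * (cells off (s.arr aOrd i)).card + 10 ∧
      s'.reg rI = i + 1 ∧
      IsQueue n off nbr r Ch (i + 1) 0 (s'.reg rTail) (s'.arr aOrd) (s'.arr aPar) ∧
      ∀ m ≤ i, s'.arr aOrd m = s.arr aOrd m := by
  have hit := hQ.lt_tail hR hi
  have hx := hQ.lt i hit
  obtain ⟨x, hxe⟩ : ∃ x, x = s.arr aOrd i := ⟨_, rfl⟩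
  rw [← hxe] at hx ⊢
  have hoff := hR.off_le x hx
  have hoffn := off_le_off hR.off_le (x := x + 1) hx
  have hcard : (cells off x).card = off (x + 1) - off x := by simp [cells]
  unfold searchVertex
  have step1 : Runs W (.load rX aOrd rI ;; .load rPar aPar rX ;; .load rE aOff rX ;;
      .add rA rX rOne ;; .load rEnd aOff rA) s fun t s' => t = 5 ∧ s'.reg rX = x ∧
        s'.reg rPar = s.arr aPar x ∧ s'.reg rE = off x ∧ s'.reg rEnd = off (x + 1) := by
    apply Runs.of_wp
    simp [wp, hI, ← hxe, hOff, h1]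
    omega
  refine Runs.seq (step1.mono ?_)
  rintro t₁ s₁ hf₁ ⟨rfl, hX₁, hP₁, hE₁, hEnd₁⟩
  have g1 : s₁.reg rOne = 1 := (hf₁.1 _ (by decide)).trans h1
  have gNbr : s₁.arr aNbr = nbr := (hf₁.2 _ (by decide)).trans hNbr
  have gOrd : s₁.arr aOrd = s.arr aOrd := hf₁.2 _ (by decide)
  have gPar : s₁.arr aPar = s.arr aPar := hf₁.2 _ (by decide)
  have gTail : s₁.reg rTail = s.reg rTail := hf₁.1 _ (by decide)
  refine Runs.seq ((Runs.loop (cells off x).card (fun j t s' => t ≤ 8 * j ∧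
      s'.reg rE = off x + j ∧ i < s'.reg rTail ∧
      IsQueue n off nbr r Ch i (off x + j) (s'.reg rTail) (s'.arr aOrd) (s'.arr aPar) ∧
      (∀ m ≤ i, s'.arr aOrd m = s.arr aOrd m) ∧ s'.arr aPar x = s.arr aPar x) ?_ ?_ ?_).mono ?_)
  · rw [gOrd, gPar, gTail]
    exact ⟨le_rfl, hE₁, hit, hxe ▸ hQ.start, fun _ _ => rfl, rfl⟩
  · rintro j t s₂ hj hf₂ ⟨ht, hE₂, hi₂, hQ₂, ho₂, hp₂⟩
    have hoi : s₂.arr aOrd i = x := (ho₂ i le_rfl).trans hxe.symm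
    refine ⟨?_, (runs_searchStep hR ((hf₂.1 _ (by decide)).trans g1)
      ((hf₂.2 _ (by decide)).trans gNbr) hi₂ ?_ ?_ ?_ ?_ ?_ (by omega)).mono ?_⟩
    · rw [hE₂, hf₂.1 rEnd (by decide), hEnd₁]
      omega
    · rw [hoi, hf₂.1 _ (by decide), hX₁]
    · rw [hoi, hf₂.1 _ (by decide), hP₁, hp₂]
    · rwa [hE₂]
    · rw [hoi, hE₂]
      simp [cells]
      omega
    · omega
    · rintro t₃ s₃ - ⟨ht₃, hE₃, hi₃, hQ₃, ho₃, hp₃⟩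
      rw [hE₂] at hQ₃ hE₃
      rw [hoi] at hp₃
      exact ⟨by omega, hE₃, hi₃, hQ₃, fun m hm => (ho₃ m hm).trans (ho₂ m hm), hp₃.trans hp₂⟩
  · rintro t s₂ hf₂ ⟨-, hE₂, -⟩
    rw [hE₂, hf₂.1 rEnd (by decide), hEnd₁]
    omega
  · rintro t s₂ hf₂ ⟨t', rfl, ht', hE₂, hi₂, hQ₂, ho₂, -⟩
    have hI₂ : s₂.reg rI = i := by rw [hf₂.1 _ (by decide), hf₁.1 _ (by decide), hI]
    have h1₂ : s₂.reg rOne = 1 := (hf₂.1 _ (by decide)).trans g1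
    have hoi : s₂.arr aOrd i = x := (ho₂ i le_rfl).trans hxe.symm
    have hfin : IsQueue n off nbr r Ch (i + 1) 0 (s₂.reg rTail) (s₂.arr aOrd) (s₂.arr aPar) := by
      refine IsQueue.finish hR hi₂ ?_
      rw [hoi]
      have : off (x + 1) = off x + (cells off x).card := by omega
      rwa [this]
    apply Runs.of_wp
    simp only [wp, Memory.setReg_reg, Memory.setReg_arr, hI₂, h1₂, reduceIte, Nat.reduceEqDiff]
    exact ⟨by omega, by omega, trivial, hfin, ho₂⟩

theorem runs_search {W : ℕ} {s : Memory} (hR : IsRooted n off nbr r Ch)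
    (h0 : s.reg rZero = 0) (h1 : s.reg rOne = 1) (hNum : s.reg rNum = n) (hr : s.reg rRoot = r)
    (hOff : s.arr aOff = off) (hNbr : s.arr aNbr = nbr) (hW : off n + n < W) :
    Runs W search s fun t s' => t ≤ 10 * off n + 11 * n + 5 ∧
      IsOrder n r Ch (s'.arr aOrd) (s'.arr aPar) := by
  unfold search
  have step1 : Runs W (.store aOrd rZero rRoot ;; .store aPar rRoot rNum ;; .copy rTail rOne ;;
      .copy rI rZero) s fun t s' => t = 4 ∧ s'.reg rI = 0 ∧
        IsQueue n off nbr r Ch 0 0 (s'.reg rTail) (s'.arr aOrd) (s'.arr aPar) := by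
    apply Runs.of_wp
    simp only [wp, Memory.setReg_reg, Memory.setReg_arr, Memory.setArr_reg, Memory.setArr_arr,
      h0, h1, hNum, hr, reduceIte, Nat.reduceEqDiff]
    refine ⟨trivial, trivial, Nat.one_pos, fun m hm => ?_, fun m hm m' hm' _ => by omega, ?_, ?_,
      fun m hm hm' => by omega, fun j hj => by omega, by simp⟩
    · obtain rfl : m = 0 := by omega
      rw [Function.update_self]
      exact hR.root_lt
    · rw [Function.update_self]
    · rw [Function.update_self]
  refine Runs.seq (step1.mono ?_)
  rintro t₁ s₁ hf₁ ⟨rfl, hI₁, hQ₁⟩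
  -- The cost is summed along the processed part of the queue, which later rounds leave unchanged.
  -- At the end the queue lists every vertex once, so this becomes a sum of degrees.
  refine (Runs.loop n (fun i t s' => t ≤ ∑ j ∈ Finset.range i,
      (10 * (cells off (s'.arr aOrd j)).card + 11) ∧ s'.reg rI = i ∧
      IsQueue n off nbr r Ch i 0 (s'.reg rTail) (s'.arr aOrd) (s'.arr aPar)) ?_ ?_ ?_).mono ?_
  · exact ⟨by simp, hI₁, hQ₁⟩
  · rintro i t s₂ hi hf₂ ⟨ht₂, hI₂, hQ₂⟩
    refine ⟨?_, (runs_searchVertex hR ?_ ?_ ?_ hI₂ hi hQ₂ hW).mono ?_⟩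
    · rw [hI₂, hf₂.1 rNum (by decide), hf₁.1 rNum (by decide), hNum]
      exact hi
    · rw [hf₂.1 _ (by decide), hf₁.1 _ (by decide), h1]
    · rw [hf₂.2 _ (by decide), hf₁.2 _ (by decide), hOff]
    · rw [hf₂.2 _ (by decide), hf₁.2 _ (by decide), hNbr]
    · rintro t₃ s₃ - ⟨ht₃, hI₃, hQ₃, ho₃⟩
      refine ⟨?_, hI₃, hQ₃⟩
      rw [Finset.sum_range_succ, ho₃ i le_rfl]
      have : ∑ j ∈ Finset.range i, (10 * (cells off (s₃.arr aOrd j)).card + 11) =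
          ∑ j ∈ Finset.range i, (10 * (cells off (s₂.arr aOrd j)).card + 11) :=
        Finset.sum_congr rfl fun j hj => by rw [ho₃ j (Finset.mem_range.1 hj).le]
      omega
  · rintro t s₂ hf₂ ⟨-, hI₂, -⟩
    rw [hI₂, hf₂.1 rNum (by decide), hf₁.1 rNum (by decide), hNum]
    exact lt_irrefl n
  · rintro t s₂ - ⟨t', rfl, ht', -, hQ₂⟩
    have ho := hQ₂.isOrder hR
    refine ⟨?_, ho⟩
    rw [ho.sum_eq fun x => 10 * (cells off x).card + 11, Finset.sum_add_distrib,
      ← Finset.mul_sum, sum_card_cells hR.off_zero hR.off_le] at ht'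
    simp at ht'
    omega

end Search

/-! ### The tree behind the adjacency lists -/

section Adjacency

variable {n : ℕ} {G : SimpleGraph (Fin n)} {off nbr : ℕ → ℕ}

theorem IsAdjList.bijOn_cells (hA : IsAdjList G off nbr) (v : Fin n) :
    Set.BijOn nbr (cells off v) (Fin.val '' G.neighborSet v) := by
  rw [cells, Finset.coe_Ico]
  exact hA.bijOn v

theorem IsAdjList.exists_cell (hA : IsAdjList G off nbr) {v u : Fin n} (h : G.Adj v u) :
    ∃ e ∈ cells off v, nbr e = u :=
  (hA.bijOn_cells v).surjOn ⟨u, h, rfl⟩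

theorem IsAdjList.adj_of_mem_cells (hA : IsAdjList G off nbr) {v : Fin n} {e : ℕ}
    (he : e ∈ cells off v) : ∃ u : Fin n, G.Adj v u ∧ nbr e = u := by
  obtain ⟨u, hu, h⟩ := (hA.bijOn_cells v).mapsTo he
  exact ⟨u, hu, h.symm⟩

theorem IsAdjList.deg_eq (hA : IsAdjList G off nbr) (v : Fin n) :
    deg G v = off (v + 1) - off v := by
  rw [deg_eq_ncard, ← Set.ncard_image_of_injective _ Fin.val_injective,
    ← (hA.bijOn_cells v).ncard_eq, Set.ncard_coe_finset, cells, Nat.card_Ico]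

theorem IsAdjList.card_cells (hA : IsAdjList G off nbr) (v : Fin n) :
    (cells off v).card = deg G v := by
  rw [hA.deg_eq, cells, Nat.card_Ico]

theorem IsAdjList.card_filter_cells (hA : IsAdjList G off nbr) (v : Fin n) (p : ℕ → Prop)
    [DecidablePred p] :
    {e ∈ cells off v | p (nbr e)}.card = {u | u ∈ G.neighborSet v ∧ p u}.ncard := by
  rw [← Set.ncard_coe_finset, ← Set.ncard_image_of_injective _ Fin.val_injective]
  refine Set.BijOn.ncard_eq (f := nbr) ⟨fun e he => ?_, ?_, ?_⟩
  · rw [Finset.mem_coe, Finset.mem_filter] at he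
    obtain ⟨u, hu, h⟩ := hA.adj_of_mem_cells he.1
    exact ⟨u, ⟨hu, h ▸ he.2⟩, h.symm⟩
  · refine (hA.bijOn_cells v).injOn.mono fun e he => ?_
    exact (Finset.mem_filter.1 he).1
  · rintro _ ⟨u, ⟨hu, hp⟩, rfl⟩
    obtain ⟨e, he, h⟩ := hA.exists_cell hu
    exact ⟨e, Finset.mem_coe.2 (Finset.mem_filter.2 ⟨he, h ▸ hp⟩), h⟩

theorem deg_eq_degree {V : Type*} [Fintype V] (G : SimpleGraph V) [DecidableRel G.Adj] (v : V) :
    deg G v = G.degree v := by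
  unfold deg
  congr!

/-- The handshake lemma with `n - 1` edges; every linear time bound rests on it. -/
theorem IsAdjList.off_last (hA : IsAdjList G off nbr) (hG : G.IsTree) : off n + 2 = 2 * n := by
  classical
  have h1 := sum_card_cells hA.off_zero hA.off_le
  rw [← Fin.sum_univ_eq_sum_range (fun x => (cells off x).card)] at h1
  have h2 : ∑ v : Fin n, (cells off v).card = ∑ v : Fin n, G.degree v :=
    Finset.sum_congr rfl fun v _ => by rw [hA.card_cells, deg_eq_degree]
  have h3 := hG.card_edgeFinset
  rw [Fintype.card_fin] at h3
  rw [h2, G.sum_degrees_eq_twice_card_edges] at h1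
  omega

/-- `u` is a child of `x` in the tree `G` with root `r`. -/
def IsChild (G : SimpleGraph (Fin n)) (r : Fin n) (x u : ℕ) : Prop :=
  ∃ (hx : x < n) (hu : u < n), (⟨u, hu⟩ : Fin n) ∈ children G r ⟨x, hx⟩

theorem isChild_iff {r x u : Fin n} : IsChild G r x u ↔ u ∈ children G r x :=
  ⟨fun ⟨_, _, h⟩ => h, fun h => ⟨x.2, u.2, h⟩⟩

/-- Along the path from `x` to the root each vertex is a child of the next one, so the property
travels down this path. -/
theorem of_forall_children {V : Type*} {G : SimpleGraph V} (hG : G.IsTree) {c : V} {P : V → Prop}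
    (hc : P c) (h : ∀ x, P x → ∀ u ∈ children G c x, P u) (x : V) : P x := by
  classical
  have key : ∀ {x : V} (p : G.Walk x c), (∀ c', c' = c → P c') → p.IsPath → P x := by
    intro x p
    induction p with
    | nil => exact fun hc' _ => hc' _ rfl
    | @cons x w c hxw q ih =>
      intro hc' hp
      rw [SimpleGraph.Walk.cons_isPath_iff] at hp
      refine h w (ih hc h hc' hp.1) x ((mem_children_iff hG).2 ⟨hxw.symm, ?_⟩)
      rw [← branch_compl hG hxw, Set.mem_compl_iff, not_not]
      exact mem_branch_of_notMem_support q hp.2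
  obtain ⟨p⟩ := hG.connected.preconnected x c
  exact key p.bypass (fun _ e => e ▸ hc) p.bypass_isPath

theorem IsAdjList.isRooted (hA : IsAdjList G off nbr) (hG : G.IsTree) (r : Fin n) :
    IsRooted n off nbr r (IsChild G r) where
  root_lt := r.2
  off_zero := hA.off_zero
  off_le := hA.off_le
  injOn x hx := (hA.bijOn_cells ⟨x, hx⟩).injOn
  nbr_lt x hx e he := by
    obtain ⟨u, -, h⟩ := hA.adj_of_mem_cells (v := ⟨x, hx⟩) he
    exact h ▸ u.2
  child_or x hx e he := by
    obtain ⟨u, hu, h⟩ := hA.adj_of_mem_cells (v := ⟨x, hx⟩) he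
    rw [h]
    by_cases hr : r ∈ branch G ⟨x, hx⟩ u
    · refine Or.inr (isChild_iff (x := u) (u := ⟨x, hx⟩) |>.2
        ((mem_children_iff hG).2 ⟨hu.symm, ?_⟩))
      rwa [← branch_compl hG hu, Set.mem_compl_iff, not_not]
    · exact Or.inl (isChild_iff (x := ⟨x, hx⟩) (u := u) |>.2 ((mem_children_iff hG).2 ⟨hu, hr⟩))
  lt_left _ _ := fun ⟨h, _, _⟩ => h
  lt_right _ _ := fun ⟨_, h, _⟩ => h
  exists_cell _ _ := fun ⟨_, _, h⟩ => hA.exists_cell h.1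
  unique x y u := by
    rintro ⟨hx, hu, h⟩ ⟨hy, _, h'⟩
    rw [mem_children_iff hG] at h h'
    by_contra hne
    rw [← Set.mem_compl_iff, branch_compl hG h.1] at h
    rw [← Set.mem_compl_iff, branch_compl hG h'.1] at h'
    exact branch_disjoint hG h.1.symm h'.1.symm (fun e => hne (Fin.mk.inj_iff.1 e)) h.2 h'.2
  not_root x := by
    rintro ⟨hx, hr, h⟩
    exact ((mem_children_iff hG).1 h).2 mem_branch_self
  asymm x u := by
    rintro ⟨hx, hu, h⟩ ⟨_, _, h'⟩
    rw [mem_children_iff hG] at h h'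
    rw [← branch_compl hG h.1, Set.mem_compl_iff, not_not] at h'
    exact h.2 h'.2
  connected P hr h x hx :=
    of_forall_children hG (P := fun v : Fin n => P v) hr
      (fun v hv u hu => h v u hv (isChild_iff.2 hu)) ⟨x, hx⟩

/-- So the special value for the parent is never applied to a child. The root is covered because its
parent entry `n` is not a vertex. -/
theorem IsOrder.par_ne (hR : IsRooted n off nbr r Ch) (h : IsOrder n r Ch ord par) {x u : ℕ}
    (hc : Ch x u) : par x ≠ u := by
  obtain ⟨i, hi, rfl⟩ := h.surj x (hR.lt_left _ _ hc)
  rcases Nat.eq_zero_or_pos i with rfl | h0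
  · rw [h.ord_zero, h.par_root]
    exact (hR.lt_right _ _ hc).ne'
  · obtain ⟨j, -, hj⟩ := h.exists_parent i h0 hi
    rw [h.par_child _ _ hj]
    exact fun e => hR.asymm _ _ hc (e ▸ hj)

end Adjacency

/-! ### Slots and neighbours -/

/-- The term at `0` is at most `k`, so for `k > 0` the smallest minimiser is below `k`, where
capping does not change the counts. From `k` on, `j` alone is at least the minimum. -/
theorem IsMinAt.of_min {E : Finset ℕ} {a : ℕ → ℕ} {k z J : ℕ} (hE : E.card ≤ k)
    (h : IsMinAt (fun j => {e ∈ E | j < min k (a e)}.card) z J) :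
    IsMinAt (fun j => {e ∈ E | j < a e}.card) z J := by
  have hlt : ∀ j < k, {e ∈ E | j < min k (a e)} = {e ∈ E | j < a e} := fun j hj => by
    refine Finset.filter_congr fun e _ => ?_
    omega
  have hge : ∀ j, k ≤ j → {e ∈ E | j < min k (a e)} = ∅ := fun j hj =>
    Finset.filter_eq_empty_iff.2 fun e _ => by omega
  have h0 : {e ∈ E | 0 < min k (a e)}.card ≤ k := (Finset.card_filter_le _ _).trans hE
  have hz := h.2 0
  simp only [zero_add] at hz
  by_cases hk : k = 0
  · subst hk
    obtain rfl : E = ∅ := Finset.card_eq_zero.1 (by omega)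
    simpa [IsMinAt] using h
  · have hJ : J < k := by
      by_contra hJ
      have h1 := h.1
      simp only [hge J (not_lt.1 hJ), Finset.card_empty] at h1
      have := hz.2 (by omega)
      omega
    refine ⟨?_, fun j => ?_⟩
    · have h1 := h.1
      simp only [hlt J hJ] at h1
      exact h1
    · by_cases hj : j < k
      · have h1 := h.2 j
        simp only [hlt j hj] at h1
        exact h1
      · exact ⟨by omega, fun _ => by omega⟩

section MinAt

variable {V : Type*} {S : Set V} {a : V → ℕ} {z J : ℕ}

theorem IsMinAt.fill_eq (h : IsMinAt (fun j => {u | u ∈ S ∧ j < a u}.ncard) z J) :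
    fill S a = z :=
  le_antisymm ((fill_le S a J).trans_eq h.1.symm) (le_fill_iff.2 fun j => (h.2 j).1)

/-- Rerooting in constant time: some minimiser lies below the weight of `x` exactly when the
smallest one does, so a single comparison decides whether `w` loses one. -/
theorem branchNumber_eq_of_isMinAt [Finite V] {G : SimpleGraph V} (hG : G.IsTree) {x w : V}
    (hxw : G.Adj w x)
    (h : IsMinAt (fun j => {u | u ∈ G.neighborSet w ∧ j < weight G w u}.ncard) z J) :
    branchNumber G x w = if J < weight G w x then z else 1 + z := by
  rw [branchNumber_eq_fill hG hxw]
  have hmem : x ∈ G.neighborSet w := hxw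
  have hz := h.fill_eq
  split_ifs with hJ
  · have := (fill_sdiff_add_one_iff (a := weight G w) hmem).2 ⟨J, hJ, hz.trans h.1⟩
    omega
  · rw [fill_sdiff_of_ne hmem, hz]
    intro h'
    obtain ⟨j, hj, he⟩ := (fill_sdiff_add_one_iff hmem).1 h'
    have := (h.2 j).2 (hz.symm.trans he)
    omega

end MinAt

/-- The registers and arrays that the program does not change. -/
structure IsEnv (n : ℕ) (off nbr : ℕ → ℕ) (s : Memory) : Prop where
  num : s.reg rNum = n
  zero : s.reg rZero = 0
  one : s.reg rOne = 1
  off_eq : s.arr aOff = off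
  nbr_eq : s.arr aNbr = nbr

theorem IsEnv.frame {n : ℕ} {off nbr : ℕ → ℕ} {s s' : Memory} {P : Program}
    (h : IsEnv n off nbr s) (hf : Frame P s s')
    (hr : rNum ∉ P.outRegs ∧ rZero ∉ P.outRegs ∧ rOne ∉ P.outRegs)
    (ha : aOff ∉ P.outArrs ∧ aNbr ∉ P.outArrs) : IsEnv n off nbr s' :=
  ⟨(hf.1 _ hr.1).trans h.num, (hf.1 _ hr.2.1).trans h.zero, (hf.1 _ hr.2.2).trans h.one,
    (hf.2 _ ha.1).trans h.off_eq, (hf.2 _ ha.2).trans h.nbr_eq⟩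

section FillTree

variable {n : ℕ} {G : SimpleGraph (Fin n)} {off nbr : ℕ → ℕ}

/-- Translates cells of the lists into neighbours and removes the cap. The weights `a` need to match
only on neighbours, which leaves room for both sweeps. -/
theorem runs_fillSlots_tree (hG : G.IsTree) (hA : IsAdjList G off nbr) {W : ℕ}
    (hW : 10 * n ≤ W) {s : Memory} (hE : IsEnv n off nbr s) (hcnt : ∀ q, s.arr aCnt q = 0)
    {x : Fin n} (hX : s.reg rX = x) {a : Fin n → ℕ}
    (ha : ∀ u : Fin n, G.Adj x u →
      (if deg G x ≤ deg G u then
        if (u : ℕ) = s.reg rPar then s.reg rG else s.arr aVal u else 0) = a u) :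
    Runs W fillSlots s fun t s' => t ≤ 50 * (cells off x).card + 50 ∧
      (∀ q, s'.arr aCnt q = 0) ∧ s'.reg rZ < 2 * n ∧
      IsMinAt (fun j => {u | u ∈ G.neighborSet x ∧ j < a u}.ncard) (s'.reg rZ) (s'.reg rJ) ∧
      (∀ u : Fin n, G.Adj x u → s'.arr aRank u ≤ a u) ∧
      (∀ q, 1 ≤ q → q ≤ s'.reg rZ → ∃ u : Fin n, G.Adj x u ∧ s'.arr aRank u = q) ∧
      ∀ u : Fin n, ¬ G.Adj x u → s'.arr aRank u = s.arr aRank u := by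
  have hn := x.2
  have hoff := hA.off_last hG
  have hx := hA.off_le x x.2
  have hxn := off_le_off hA.off_le (x := x + 1) x.2
  set k := deg G x with hk
  have hkx := hA.deg_eq x
  have hcells : Finset.Ico (off x) (off x + k) = cells off x := by
    rw [cells]
    congr 1
    omega
  set b := entry off nbr (s.arr aVal) (s.reg rPar) (s.reg rG) k with hb
  have hba : ∀ e ∈ cells off x, ∃ u : Fin n, G.Adj x u ∧ nbr e = u ∧ b e = min k (a u) := by
    intro e he
    obtain ⟨u, hu, h⟩ := hA.adj_of_mem_cells he
    refine ⟨u, hu, h, ?_⟩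
    rw [hb, entry, h, ← hA.deg_eq u, ← ha u hu]
    by_cases hd : deg G u < k
    · rw [if_pos hd, if_neg (not_le.2 hd), min_eq_right (Nat.zero_le _)]
    · rw [if_neg hd, if_pos (not_lt.1 hd)]
  refine (runs_fillSlots (lo := off x) (k := k) (b := b) hE.zero hE.one ?_ ?_ hcnt ?_ ?_ ?_ ?_ ?_
    ?_).mono ?_
  · rw [hE.off_eq, hX]
  · rw [hE.off_eq, hX]
    omega
  · intro e he
    rw [hcells] at he
    obtain ⟨u, -, h⟩ := hA.adj_of_mem_cells he
    rw [hE.nbr_eq, h]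
    omega
  · rw [hcells, hE.nbr_eq]
    exact (hA.bijOn_cells x).injOn
  · omega
  · omega
  · omega
  · rw [hE.off_eq, hE.nbr_eq]
  · rintro t s' - ⟨ht, hcnt', hmin, hle, hsurj, hu⟩
    rw [hcells, hE.nbr_eq] at hle hsurj hu
    rw [hcells] at hmin
    have hcard : (cells off x).card = k := hA.card_cells x
    obtain ⟨a', ha'⟩ : ∃ a' : ℕ → ℕ, ∀ u : Fin n, a' u = a u :=
      ⟨fun u => if h : u < n then a ⟨u, h⟩ else 0, fun u => by simp⟩
    have hmin' : IsMinAt (fun j => {u | u ∈ G.neighborSet x ∧ j < a u}.ncard) (s'.reg rZ)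
        (s'.reg rJ) := by
      have h1 : ∀ j, {e ∈ cells off x | j < b e}.card =
          {e ∈ cells off x | j < min k (a' (nbr e))}.card := fun j => by
        congr 1
        refine Finset.filter_congr fun e he => ?_
        obtain ⟨u, -, h, hbe⟩ := hba e he
        rw [hbe, h, ha']
      simp only [h1] at hmin
      have h2 := hmin.of_min hcard.le
      have h3 : ∀ j, {e ∈ cells off x | j < a' (nbr e)}.card =
          {u | u ∈ G.neighborSet x ∧ j < a u}.ncard := fun j => by
        rw [hA.card_filter_cells x fun u => j < a' u]
        simp only [ha']
      simpa only [h3] using h2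
    refine ⟨by omega, hcnt', ?_, hmin', fun u hxu => ?_, fun q h1 h2 => ?_, fun u hxu => ?_⟩
    · have h1 : s'.reg rZ ≤ 0 + {u | u ∈ G.neighborSet x ∧ 0 < a u}.ncard := (hmin'.2 0).1
      have h2 : {u | u ∈ G.neighborSet x ∧ 0 < a u}.ncard ≤ (G.neighborSet x).ncard :=
        Set.ncard_le_ncard fun u hu => hu.1
      rw [← deg_eq_ncard] at h2
      omega
    · obtain ⟨e, he, h⟩ := hA.exists_cell hxu
      obtain ⟨u', -, h', hbe⟩ := hba e he
      obtain rfl : u' = u := Fin.ext (h'.symm.trans h)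
      have := hle e he
      rw [hbe, h] at this
      omega
    · obtain ⟨e, he, h⟩ := hsurj q h1 h2
      obtain ⟨u, hxu, h'⟩ := hA.adj_of_mem_cells he
      exact ⟨u, hxu, h' ▸ h⟩
    · refine hu u fun e he h => hxu ?_
      obtain ⟨u', hxu', h'⟩ := hA.adj_of_mem_cells he
      obtain rfl : u' = u := Fin.ext (h'.symm.trans h)
      exact hxu'

end FillTree

/-! ### The sweeps -/

/-- Process the vertex at position `i - 1` of the order, after its children. -/
def upStep : Program :=
  (.sub rI rI rOne ;; .load rX aOrd rI ;; .load rPar aPar rX ;; .copy rG rZero) ;;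
  fillSlots ;; .add rZ rZ rOne ;; .store aVal rX rZ

/-- Compute the numbers of the vertices in the rooted tree. -/
def sweepUp : Program :=
  .copy rI rNum ;; .loop rZero rI upStep

/-- Process the vertex at position `i` of the order, after its parent. -/
def downStep : Program :=
  -- At the root the parent entry is `n` and the values loaded through it are meaningless, but no
  -- neighbour equals `n`, so they are never used.
  ((.load rX aOrd rI ;; .load rPar aPar rX ;; .load rG aSt rPar ;; .load rB aThr rPar ;;
    .load rL aVal rX) ;;
    (.add rA rX rOne ;; .load rA aOff rA ;; .load rE aOff rX ;; .sub rA rA rE) ;;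
    (.add rK rPar rOne ;; .load rK aOff rK ;; .load rE aOff rPar ;; .sub rK rK rE) ;;
    -- One is subtracted exactly when `x` is required at its parent: its degree is large enough and
    -- its value exceeds the threshold of the parent.
    .ite rA rK .skip (.ite rB rL (.sub rG rG rOne) .skip)) ;;
  fillSlots ;; .store aThr rX rJ ;; .add rZ rZ rOne ;; .store aSt rX rZ ;;
  .ite rBest rZ (.copy rBest rZ ;; .copy rArg rX) .skip ;; .add rI rI rOne

/-- Compute the strong transitive numbers and their maximum. -/
def sweepDown : Program :=
  (.const rBest 0 ;; .copy rI rZero) ;; .loop rI rNum downStep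

/-- Choose the part of the vertex at position `i` of the order. -/
def colorStep : Program :=
  .load rU aOrd rI ;; .load rX aPar rU ;; .load rL aRank rU ;; .load rA aCol rX ;;
  .ite rZero rL (.ite rL rA .skip (.copy rL rOne)) (.copy rL rOne) ;;
  .store aCol rU rL ;; .add rI rI rOne

/-- Compute the partition from the ranks. -/
def color : Program :=
  (.store aCol rRoot rBest ;; .copy rI rOne) ;; .loop rI rNum colorStep ;; .copy rNum rBest

/-- The program that solves the maximum strong transitivity problem on trees. -/
def solve : Program :=
  .const rOne 1 ;; search ;; sweepUp ;; sweepDown ;; .copy rRoot rArg ;; search ;; sweepUp ;;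
  color

section Sweeps

variable {n : ℕ} {G : SimpleGraph (Fin n)} {off nbr ord par : ℕ → ℕ}

/-- The children of `x` are ranked: each rank below the number of `x` in the tree `G` with root `r`
is given to a child that can get it. -/
def IsRanked (G : SimpleGraph (Fin n)) (r x : Fin n) (rank : ℕ → ℕ) : Prop :=
  (∀ u ∈ children G r x, rank u ≤ mst G r u) ∧
    ∀ q, 1 ≤ q → q < mst G r x → ∃ u ∈ children G r x, deg G x ≤ deg G u ∧ rank u = q

/-- The vertex at position `i` of the order. -/
theorem IsOrder.exists_fin {r : ℕ} {Ch : ℕ → ℕ → Prop} (h : IsOrder n r Ch ord par) {i : ℕ}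
    (hi : i < n) : ∃ x : Fin n, ord i = x := ⟨⟨ord i, h.lt i hi⟩, rfl⟩

theorem IsOrder.exists_pos {r : ℕ} {Ch : ℕ → ℕ → Prop} (h : IsOrder n r Ch ord par)
    (x : Fin n) : ∃ i < n, ord i = x := h.surj x x.2

theorem runs_upStep (hG : G.IsTree) (hA : IsAdjList G off nbr) {W : ℕ} (hW : 10 * n ≤ W)
    {s : Memory} (hE : IsEnv n off nbr s) (hcnt : ∀ q, s.arr aCnt q = 0) {r : Fin n}
    (hO : IsOrder n r (IsChild G r) (s.arr aOrd) (s.arr aPar)) {i : ℕ} {x : Fin n}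
    (hI : s.reg rI = i + 1) (hx : s.arr aOrd i = x)
    (hval : ∀ u ∈ children G r x, s.arr aVal u = mst G r u) :
    Runs W upStep s fun t s' => t ≤ 50 * (cells off x).card + 56 ∧ s'.reg rI = i ∧
      (∀ q, s'.arr aCnt q = 0) ∧ s'.arr aVal = Function.update (s.arr aVal) x (mst G r x) ∧
      IsRanked G r x (s'.arr aRank) ∧
      ∀ u : Fin n, ¬ G.Adj x u → s'.arr aRank u = s.arr aRank u := by
  classical
  have hR := hA.isRooted hG r
  have step1 : Runs W (.sub rI rI rOne ;; .load rX aOrd rI ;; .load rPar aPar rX ;;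
      .copy rG rZero) s fun t s' => t = 4 ∧ s'.reg rI = i ∧ s'.reg rX = x ∧
        s'.reg rPar = s.arr aPar x ∧ s'.reg rG = 0 := by
    apply Runs.of_wp
    simp [wp, hI, hE.one, hE.zero, hx]
  refine Runs.seq (step1.mono ?_)
  rintro t₁ s₁ hf₁ ⟨rfl, hI₁, hX₁, hP₁, hG₁⟩
  have hE₁ := hE.frame hf₁ (by decide) (by decide)
  have hval₁ : s₁.arr aVal = s.arr aVal := hf₁.2 _ (by decide)
  have hcnt₁ : s₁.arr aCnt = s.arr aCnt := hf₁.2 _ (by decide)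
  have hrank₁ : s₁.arr aRank = s.arr aRank := hf₁.2 _ (by decide)
  have hadj : ∀ u : Fin n, G.Adj x u → u ∉ children G r x → (u : ℕ) = s.arr aPar x := by
    intro u hu hn
    obtain ⟨e, he, h⟩ := hA.exists_cell hu
    rcases hR.child_or x x.2 e he with h1 | h1
    · rw [h] at h1
      exact absurd (isChild_iff.1 h1) hn
    · rw [h] at h1
      exact (hO.par_child _ _ h1).symm
  -- The only neighbour that is not a child is the parent. Its value is set to `0`, so it takes no
  -- slot and the count is that of the rooted tree.
  refine Runs.seq ((runs_fillSlots_tree hG hA hW hE₁ (fun q => by rw [hcnt₁, hcnt]) hX₁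
    (a := fun u => if u ∈ children G r x then weight G x u else 0) ?_).mono ?_)
  · intro u hu
    rw [hP₁, hG₁, hval₁]
    split_ifs with h1 h2 h3 h3 h3
    · exact absurd h2.symm (hO.par_ne hR (isChild_iff.2 h3))
    · rfl
    · rw [hval u h3, weight, if_pos h1, mst_eq_of_mem_children hG h3]
    · exact absurd (hadj u hu h3) h2
    · rw [weight, if_neg h1]
    · rfl
  · rintro t₂ s₂ hf₂ ⟨ht₂, hcnt₂, hZ₂, hmin, hle, hsurj, hu₂⟩
    have hset : ∀ j, {u | u ∈ G.neighborSet x ∧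
        j < if u ∈ children G r x then weight G x u else 0} =
        {u | u ∈ children G r x ∧ j < weight G x u} := by
      intro j
      ext u
      simp only [Set.mem_ofPred_eq]
      constructor
      · rintro ⟨-, h⟩
        split_ifs at h with h1
        · exact ⟨h1, h⟩
        · omega
      · rintro ⟨h1, h2⟩
        exact ⟨h1.1, by rwa [if_pos h1]⟩
    simp only [hset] at hmin
    have hmst : mst G r x = s₂.reg rZ + 1 := by rw [mst_eq_fill hG, hmin.fill_eq, add_comm]
    have hX₂ : s₂.reg rX = x := by rw [hf₂.1 _ (by decide), hX₁]
    have hI₂ : s₂.reg rI = i := by rw [hf₂.1 _ (by decide), hI₁]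
    have hval₂ : s₂.arr aVal = s.arr aVal := by rw [hf₂.2 _ (by decide), hval₁]
    have h1₂ : s₂.reg rOne = 1 := (hE₁.frame hf₂ (by decide) (by decide)).one
    have hw : ∀ u ∈ children G r x, weight G x u ≤ mst G r u := by
      intro u hu
      rw [weight, mst_eq_of_mem_children hG hu]
      split_ifs
      · exact le_rfl
      · exact Nat.zero_le _
    have hrk : IsRanked G r x (s₂.arr aRank) := by
      refine ⟨fun u hu => ?_, fun q h1 h2 => ?_⟩
      · have := hle u hu.1
        rw [if_pos hu] at this
        exact this.trans (hw u hu)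
      · obtain ⟨u, hxu, hq⟩ := hsurj q h1 (by omega)
        have := hle u hxu
        split_ifs at this with hc
        · refine ⟨u, hc, ?_, hq⟩
          by_contra hd
          rw [weight, if_neg hd] at this
          omega
        · omega
    apply Runs.of_wp
    simp only [wp, Memory.setReg_reg, Memory.setReg_arr, Memory.setArr_reg, Memory.setArr_arr,
      hX₂, hI₂, hval₂, h1₂, reduceIte, Nat.reduceEqDiff, ← hmst]
    refine ⟨by omega, by omega, trivial, hcnt₂, trivial, hrk, fun u hu => ?_⟩
    rw [hu₂ u hu, hrank₁]

theorem runs_sweepUp (hG : G.IsTree) (hA : IsAdjList G off nbr) {W : ℕ} (hW : 10 * n ≤ W)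
    {s : Memory} (hE : IsEnv n off nbr s) (hcnt : ∀ q, s.arr aCnt q = 0) {r : Fin n}
    (hO : IsOrder n r (IsChild G r) (s.arr aOrd) (s.arr aPar)) :
    Runs W sweepUp s fun t s' => t ≤ 160 * n + 2 ∧ (∀ q, s'.arr aCnt q = 0) ∧
      (∀ v : Fin n, s'.arr aVal v = mst G r v) ∧ ∀ v, IsRanked G r v (s'.arr aRank) := by
  have hR := hA.isRooted hG r
  set ord := s.arr aOrd with hord
  have step1 : Runs W (.copy rI rNum) s fun t s' => t = 1 ∧ s'.reg rI = n := by
    apply Runs.of_wp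
    simp [wp, hE.num]
  refine Runs.seq (step1.mono ?_)
  rintro t₁ s₁ hf₁ ⟨rfl, hI₁⟩
  have hE₁ := hE.frame hf₁ (by decide) (by decide)
  refine (Runs.loop n (fun j t s' =>
    t ≤ ∑ m ∈ Finset.range j, (50 * (cells off (ord (n - 1 - m))).card + 57) ∧
    s'.reg rI = n - j ∧ (∀ q, s'.arr aCnt q = 0) ∧
    ∀ m, n - j ≤ m → m < n → ∀ v : Fin n, ord m = v → s'.arr aVal v = mst G r v ∧
      IsRanked G r v (s'.arr aRank)) ?_ ?_ ?_).mono ?_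
  · refine ⟨by simp, by rw [hI₁, Nat.sub_zero], fun q => ?_, fun m h1 h2 => by omega⟩
    rw [hf₁.2 _ (by decide), hcnt]
  · rintro j t s₂ hj hf₂ ⟨ht₂, hI₂, hcnt₂, hdone⟩
    have hE₂ := hE₁.frame hf₂ (by decide) (by decide)
    have hord₂ : s₂.arr aOrd = ord := by rw [hf₂.2 _ (by decide), hf₁.2 _ (by decide)]
    have hpar₂ : s₂.arr aPar = s.arr aPar := by rw [hf₂.2 _ (by decide), hf₁.2 _ (by decide)]
    have hi : n - 1 - j < n := by omega
    obtain ⟨x, hx⟩ := hO.exists_fin hi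
    refine ⟨by rw [hE₂.zero, hI₂]; omega, (runs_upStep hG hA hW hE₂ hcnt₂ (r := r) (x := x) ?_
      (i := n - 1 - j) (by omega) (by rw [hord₂, hx]) ?_).mono ?_⟩
    · rw [hord₂, hpar₂]
      exact hO
    · intro u hu
      obtain ⟨m, hm, hmu⟩ := hO.exists_pos u
      have := hO.lt_of_child (n - 1 - j) hi m hm (by rw [hx, hmu]; exact isChild_iff.2 hu)
      exact (hdone m (by omega) hm u hmu).1
    · rintro t₃ s₃ - ⟨ht₃, hI₃, hcnt₃, hval₃, hrk₃, hu₃⟩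
      refine ⟨?_, by omega, hcnt₃, fun m h1 h2 v hv => ?_⟩
      · rw [Finset.sum_range_succ, hx]
        omega
      · by_cases hm : m = n - 1 - j
        · obtain rfl : v = x := Fin.ext (by rw [← hv, hm, hx])
          rw [hval₃, Function.update_self]
          exact ⟨rfl, hrk₃⟩
        · have hvx : (v : ℕ) ≠ x := fun e => hm (hO.inj m h2 _ hi (by rw [hx, hv, e]))
          obtain ⟨h3, h4⟩ := hdone m (by omega) h2 v hv
          -- The round of `x` writes ranks of neighbours of `x` only. A child of an already
          -- processed `v` is not among them: `x` is not its parent, and `x` comes too early in the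
          -- order to be its child.
          have hrank : ∀ u ∈ children G r v, s₃.arr aRank u = s₂.arr aRank u := by
            intro u hu
            refine hu₃ u fun hxu => ?_
            obtain ⟨m', hm', hmu⟩ := hO.exists_pos u
            have h5 := hO.lt_of_child m h2 m' hm' (by rw [hv, hmu]; exact isChild_iff.2 hu)
            obtain ⟨e, he, hee⟩ := hA.exists_cell hxu
            rcases hR.child_or x x.2 e he with h6 | h6
            · rw [hee] at h6
              exact hvx (hR.unique _ _ _ (isChild_iff.2 hu) h6)
            · rw [hee] at h6
              have := hO.lt_of_child m' hm' _ hi (by rw [hx, hmu]; exact h6)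
              omega
          rw [hval₃, Function.update_of_ne hvx]
          refine ⟨h3, fun u hu => ?_, fun q hq1 hq2 => ?_⟩
          · rw [hrank u hu]
            exact h4.1 u hu
          · obtain ⟨u, hu, hd, hq⟩ := h4.2 q hq1 hq2
            exact ⟨u, hu, hd, by rw [hrank u hu, hq]⟩
  · rintro t s₂ hf₂ ⟨-, hI₂, -⟩
    rw [hI₂]
    omega
  · rintro t s₂ - ⟨t', rfl, ht', -, hcnt₂, hdone⟩
    have hsum : ∑ m ∈ Finset.range n, (50 * (cells off (ord (n - 1 - m))).card + 57) =
        50 * off n + 57 * n := by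
      rw [Finset.sum_range_reflect (fun m => 50 * (cells off (ord m)).card + 57) n,
        hO.sum_eq fun x => 50 * (cells off x).card + 57, Finset.sum_add_distrib,
        ← Finset.mul_sum, sum_card_cells hA.off_zero hA.off_le]
      simp [mul_comm]
    have := hA.off_last hG
    refine ⟨by omega, hcnt₂, fun v => ?_, fun v => ?_⟩
    all_goals
      obtain ⟨m, hm, hmv⟩ := hO.exists_pos v
      have := hdone m (by omega) hm v hmv
    · exact this.1
    · exact this.2

/-- The entry of `v` in the arrays of the downward sweep is correct. -/
def IsDone (G : SimpleGraph (Fin n)) (v : Fin n) (s : Memory) : Prop :=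
  s.arr aSt v = st G v ∧
    IsMinAt (fun j => {u | u ∈ G.neighborSet v ∧ j < weight G v u}.ncard) (st G v - 1)
      (s.arr aThr v)

/-- The parent is finished, so its number and threshold give its value in the branch away from `x`.
The children contribute their values from the upward sweep, and together these are all weights at
`x`. -/
theorem runs_downStep (hG : G.IsTree) (hA : IsAdjList G off nbr) {W : ℕ} (hW : 10 * n ≤ W)
    {s : Memory} (hE : IsEnv n off nbr s) (hcnt : ∀ q, s.arr aCnt q = 0) {r : Fin n}
    (hO : IsOrder n r (IsChild G r) (s.arr aOrd) (s.arr aPar))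
    (hval : ∀ v : Fin n, s.arr aVal v = mst G r v) {i : ℕ} {x : Fin n} (hi : i < n)
    (hI : s.reg rI = i) (hx : s.arr aOrd i = x)
    (hdone : ∀ w : Fin n, x ∈ children G r w → IsDone G w s) :
    Runs W downStep s fun t s' => t ≤ 50 * (cells off x).card + 76 ∧ s'.reg rI = i + 1 ∧
      (∀ q, s'.arr aCnt q = 0) ∧ IsDone G x s' ∧
      (∀ v : Fin n, v ≠ x → s'.arr aSt v = s.arr aSt v ∧ s'.arr aThr v = s.arr aThr v) ∧
      if s.reg rBest < st G x then s'.reg rBest = st G x ∧ s'.reg rArg = x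
        else s'.reg rBest = s.reg rBest ∧ s'.reg rArg = s.reg rArg := by
  classical
  have hR := hA.isRooted hG r
  have hPn : s.arr aPar x ≤ n := by
    rcases Nat.eq_zero_or_pos i with rfl | h0
    · rw [← hx, hO.ord_zero, hO.par_root]
    · obtain ⟨j, -, hc⟩ := hO.exists_parent i h0 hi
      rw [hx] at hc
      rw [hO.par_child _ _ hc]
      exact (hR.lt_left _ _ hc).le
  unfold downStep
  have step1 : Runs W ((.load rX aOrd rI ;; .load rPar aPar rX ;; .load rG aSt rPar ;;
      .load rB aThr rPar ;; .load rL aVal rX) ;;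
      (.add rA rX rOne ;; .load rA aOff rA ;; .load rE aOff rX ;; .sub rA rA rE) ;;
      (.add rK rPar rOne ;; .load rK aOff rK ;; .load rE aOff rPar ;; .sub rK rK rE) ;;
      .ite rA rK .skip (.ite rB rL (.sub rG rG rOne) .skip)) s fun t s' => t ≤ 16 ∧
        s'.reg rX = x ∧ s'.reg rPar = s.arr aPar x ∧
        s'.reg rG = if off (s.arr aPar x + 1) - off (s.arr aPar x) ≤ deg G x ∧
          s.arr aThr (s.arr aPar x) < mst G r x then s.arr aSt (s.arr aPar x) - 1
          else s.arr aSt (s.arr aPar x) := by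
    have hn := x.2
    apply Runs.of_wp
    simp only [wp, Memory.setReg_reg, Memory.setReg_arr, hI, hx, hE.one, hE.off_eq, hval,
      reduceIte, Nat.reduceEqDiff, ← hA.deg_eq]
    refine ⟨by omega, by omega, fun h => ⟨by omega, trivial, trivial, ?_⟩, fun h =>
      ⟨fun h' => ⟨by omega, trivial, trivial, ?_⟩, fun h' => ⟨by omega, trivial, trivial, ?_⟩⟩⟩
    · rw [if_neg (by omega)]
    · rw [if_pos (by omega)]
    · rw [if_neg (by omega)]
  refine Runs.seq (step1.mono ?_)
  rintro t₁ s₁ hf₁ ⟨ht₁, hX₁, hP₁, hG₁⟩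
  have hE₁ := hE.frame hf₁ (by decide) (by decide)
  have hval₁ : s₁.arr aVal = s.arr aVal := hf₁.2 _ (by decide)
  refine Runs.seq ((runs_fillSlots_tree hG hA hW hE₁
    (fun q => by rw [hf₁.2 _ (by decide), hcnt]) hX₁ (a := weight G x) ?_).mono ?_)
  · intro u hu
    rw [weight]
    refine if_congr Iff.rfl ?_ rfl
    rw [hP₁, hval₁]
    by_cases hc : u ∈ children G r x
    · rw [if_neg fun h => hO.par_ne hR (isChild_iff.2 hc) h.symm, hval,
        mst_eq_of_mem_children hG hc]
    · have hxu : x ∈ children G r u := by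
        obtain ⟨e, he, h⟩ := hA.exists_cell hu
        rcases hR.child_or x x.2 e he with h1 | h1
        · rw [h] at h1
          exact absurd (isChild_iff.1 h1) hc
        · rw [h] at h1
          exact isChild_iff.1 h1
      have hpar : s.arr aPar x = u := hO.par_child _ _ (isChild_iff.2 hxu)
      obtain ⟨h1, h2⟩ := hdone u hxu
      have hst : st G u = 1 + (st G u - 1) := by
        rw [st_eq_fill hG]
        omega
      rw [if_pos hpar.symm, hG₁, hpar, ← hA.deg_eq, branchNumber_eq_of_isMinAt hG hu.symm h2, h1,
        weight, mst_eq_of_mem_children hG hxu]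
      by_cases hd : deg G u ≤ deg G x
      · simp only [hd, true_and, if_true]
        split_ifs
        · rfl
        · exact hst
      · simp only [hd, false_and, if_false, Nat.not_lt_zero]
        exact hst
  · rintro t₂ s₂ hf₂ ⟨ht₂, hcnt₂, hZ₂, hmin, -, -, -⟩
    have hst : st G x = s₂.reg rZ + 1 := by rw [st_eq_fill hG, hmin.fill_eq, add_comm]
    have hX₂ : s₂.reg rX = x := by rw [hf₂.1 _ (by decide), hX₁]
    have hI₂ : s₂.reg rI = i := by rw [hf₂.1 _ (by decide), hf₁.1 _ (by decide), hI]
    have h1₂ : s₂.reg rOne = 1 := (hE₁.frame hf₂ (by decide) (by decide)).one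
    have hst₂ : s₂.arr aSt = s.arr aSt := by rw [hf₂.2 _ (by decide), hf₁.2 _ (by decide)]
    have hthr₂ : s₂.arr aThr = s.arr aThr := by rw [hf₂.2 _ (by decide), hf₁.2 _ (by decide)]
    have hbest₂ : s₂.reg rBest = s.reg rBest := by
      rw [hf₂.1 _ (by decide), hf₁.1 _ (by decide)]
    have harg₂ : s₂.reg rArg = s.reg rArg := by
      rw [hf₂.1 _ (by decide), hf₁.1 _ (by decide)]
    have hmin' : IsMinAt (fun j => {u | u ∈ G.neighborSet x ∧ j < weight G x u}.ncard)
        (st G x - 1) (Function.update (s.arr aThr) x (s₂.reg rJ) x) := by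
      rw [Function.update_self, hst]
      exact hmin
    have hother : ∀ v : Fin n, v ≠ x →
        Function.update (s.arr aSt) x (st G x) v = s.arr aSt v ∧
        Function.update (s.arr aThr) x (s₂.reg rJ) v = s.arr aThr v := fun v hv =>
      ⟨Function.update_of_ne (fun e => hv (Fin.ext e)) _ _,
        Function.update_of_ne (fun e => hv (Fin.ext e)) _ _⟩
    apply Runs.of_wp
    simp only [IsDone, wp, Memory.setReg_reg, Memory.setReg_arr, Memory.setArr_reg,
      Memory.setArr_arr, hX₂, hI₂, hst₂, hthr₂, hbest₂, harg₂, h1₂, reduceIte, Nat.reduceEqDiff,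
      ← hst]
    refine ⟨by omega, fun h => ⟨by omega, by omega, trivial, hcnt₂,
      ⟨Function.update_self _ _ _, hmin'⟩, hother, ?_⟩, fun h => ⟨by omega, by omega, trivial,
        hcnt₂, ⟨Function.update_self _ _ _, hmin'⟩, hother, ?_⟩⟩
    · rw [if_pos h]
      exact ⟨trivial, trivial⟩
    · rw [if_neg h]
      exact ⟨trivial, trivial⟩

theorem runs_sweepDown (hG : G.IsTree) (hA : IsAdjList G off nbr) {W : ℕ} (hW : 10 * n ≤ W)
    {s : Memory} (hE : IsEnv n off nbr s) (hcnt : ∀ q, s.arr aCnt q = 0) {r : Fin n}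
    (hO : IsOrder n r (IsChild G r) (s.arr aOrd) (s.arr aPar))
    (hval : ∀ v : Fin n, s.arr aVal v = mst G r v) :
    Runs W sweepDown s fun t s' => t ≤ 180 * n + 3 ∧ (∀ q, s'.arr aCnt q = 0) ∧
      (∀ v : Fin n, s'.arr aSt v = st G v) ∧
      ∃ p : Fin n, s'.reg rArg = p ∧ s'.reg rBest = st G p ∧ ∀ v, st G v ≤ st G p := by
  have hR := hA.isRooted hG r
  set ord := s.arr aOrd with hord
  have step1 : Runs W (.const rBest 0 ;; .copy rI rZero) s fun t s' => t = 2 ∧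
      s'.reg rI = 0 ∧ s'.reg rBest = 0 := by
    apply Runs.of_wp
    simp [wp, hE.zero]
  refine Runs.seq (step1.mono ?_)
  rintro t₁ s₁ hf₁ ⟨rfl, hI₁, hbest₁⟩
  have hE₁ := hE.frame hf₁ (by decide) (by decide)
  refine (Runs.loop n (fun i t s' =>
    t ≤ ∑ m ∈ Finset.range i, (50 * (cells off (ord m)).card + 77) ∧
    s'.reg rI = i ∧ (∀ q, s'.arr aCnt q = 0) ∧
    (∀ m < i, ∀ v : Fin n, ord m = v → IsDone G v s' ∧ st G v ≤ s'.reg rBest) ∧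
    ((i = 0 ∧ s'.reg rBest = 0) ∨ ∃ p : Fin n, s'.reg rArg = p ∧ s'.reg rBest = st G p))
    ?_ ?_ ?_).mono ?_
  · refine ⟨by simp, hI₁, fun q => ?_, fun m h1 => by omega, Or.inl ⟨rfl, hbest₁⟩⟩
    rw [hf₁.2 _ (by decide), hcnt]
  · rintro i t s₂ hi hf₂ ⟨ht₂, hI₂, hcnt₂, hdone, hbest⟩
    have hE₂ := hE₁.frame hf₂ (by decide) (by decide)
    have hord₂ : s₂.arr aOrd = ord := by rw [hf₂.2 _ (by decide), hf₁.2 _ (by decide)]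
    have hpar₂ : s₂.arr aPar = s.arr aPar := by rw [hf₂.2 _ (by decide), hf₁.2 _ (by decide)]
    have hval₂ : s₂.arr aVal = s.arr aVal := by rw [hf₂.2 _ (by decide), hf₁.2 _ (by decide)]
    obtain ⟨x, hx⟩ := hO.exists_fin hi
    refine ⟨by rw [hE₂.num, hI₂]; exact hi, (runs_downStep hG hA hW hE₂ hcnt₂ (r := r) (x := x)
      ?_ (by rwa [hval₂]) hi hI₂ (by rw [hord₂, hx]) ?_).mono ?_⟩
    · rw [hord₂, hpar₂]
      exact hO
    · intro w hw
      obtain ⟨m, hm, hmw⟩ := hO.exists_pos w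
      have := hO.lt_of_child m hm i hi (by rw [hx, hmw]; exact isChild_iff.2 hw)
      exact (hdone m this w hmw).1
    · rintro t₃ s₃ - ⟨ht₃, hI₃, hcnt₃, hx₃, hother, hb₃⟩
      have hst1 : 0 < st G x := by
        rw [st_eq_fill hG]
        omega
      refine ⟨?_, hI₃, hcnt₃, fun m hm v hv => ?_, Or.inr ?_⟩
      · rw [Finset.sum_range_succ, hx]
        omega
      · have hle : s₂.reg rBest ≤ s₃.reg rBest ∧ st G x ≤ s₃.reg rBest := by
          split_ifs at hb₃ <;> omega
        by_cases hvx : v = x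
        · subst hvx
          exact ⟨hx₃, hle.2⟩
        · have hmi : m < i := by
            refine lt_of_le_of_ne (Nat.lt_succ_iff.1 hm) fun e => hvx (Fin.ext ?_)
            rw [← hv, e, hx]
          obtain ⟨h1, h2⟩ := hdone m hmi v hv
          refine ⟨?_, h2.trans hle.1⟩
          rw [IsDone, (hother v hvx).1, (hother v hvx).2]
          exact h1
      · split_ifs at hb₃ with h
        · exact ⟨x, hb₃.2, hb₃.1⟩
        · rw [hb₃.1, hb₃.2]
          rcases hbest with ⟨-, h0⟩ | hp
          · omega
          · exact hp
  · rintro t s₂ hf₂ ⟨-, hI₂, -⟩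
    rw [hI₂, (hE₁.frame hf₂ (by decide) (by decide)).num]
    exact lt_irrefl n
  · rintro t s₂ - ⟨t', rfl, ht', -, hcnt₂, hdone, hbest⟩
    rw [hO.sum_eq fun x => 50 * (cells off x).card + 77, Finset.sum_add_distrib,
      ← Finset.mul_sum, sum_card_cells hA.off_zero hA.off_le] at ht'
    simp only [Finset.sum_const, Finset.card_range, smul_eq_mul] at ht'
    have := hA.off_last hG
    have hall : ∀ v : Fin n, IsDone G v s₂ ∧ st G v ≤ s₂.reg rBest := fun v => by
      obtain ⟨m, hm, hmv⟩ := hO.exists_pos v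
      exact hdone m hm v hmv
    refine ⟨by omega, hcnt₂, fun v => (hall v).1.1, ?_⟩
    rcases hbest with ⟨h0, -⟩ | ⟨p, h1, h2⟩
    · have := r.2
      omega
    · exact ⟨p, h1, h2, fun v => h2 ▸ (hall v).2⟩

/-- Parents precede their children in the order, so the class of the parent is final when a child
reads it. -/
theorem runs_color {W : ℕ} {s : Memory} (hE : IsEnv n off nbr s) {r : ℕ} {Ch : ℕ → ℕ → Prop}
    (hn : 0 < n) (hnW : n ≤ W) (hr : s.reg rRoot = r)
    (hroot : ∀ x, ¬ Ch x r) (hO : IsOrder n r Ch (s.arr aOrd) (s.arr aPar)) :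
    Runs W color s fun t s' => t ≤ 12 * n + 4 ∧ s'.reg rNum = s.reg rBest ∧
      s'.arr aCol r = s.reg rBest ∧ ∀ x u, Ch x u → u < n → s'.arr aCol u =
        if 0 < s.arr aRank u ∧ s.arr aRank u < s'.arr aCol x then s.arr aRank u else 1 := by
  unfold color
  have step1 : Runs W (.store aCol rRoot rBest ;; .copy rI rOne) s fun t s' => t = 2 ∧
      s'.reg rI = 1 ∧ s'.arr aCol r = s.reg rBest := by
    apply Runs.of_wp
    simp [wp, hE.one, hr]
  refine Runs.seq (step1.mono ?_)
  rintro t₁ s₁ hf₁ ⟨rfl, hI₁, hcol₁⟩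
  have hE₁ := hE.frame hf₁ (by decide) (by decide)
  refine Runs.seq ((Runs.loop (n - 1) (fun j t s' => t ≤ 12 * j ∧ s'.reg rI = j + 1 ∧
    s'.arr aCol r = s.reg rBest ∧ ∀ m, 0 < m → m ≤ j → s'.arr aCol (s.arr aOrd m) =
      if 0 < s.arr aRank (s.arr aOrd m) ∧
        s.arr aRank (s.arr aOrd m) < s'.arr aCol (s.arr aPar (s.arr aOrd m))
      then s.arr aRank (s.arr aOrd m) else 1) ?_ ?_ ?_).mono ?_)
  · exact ⟨le_rfl, hI₁, hcol₁, fun m h1 h2 => by omega⟩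
  · rintro j t s₂ hj hf₂ ⟨ht₂, hI₂, hcolr, hcol⟩
    have hE₂ := hE₁.frame hf₂ (by decide) (by decide)
    have hord₂ : s₂.arr aOrd = s.arr aOrd := by rw [hf₂.2 _ (by decide), hf₁.2 _ (by decide)]
    have hpar₂ : s₂.arr aPar = s.arr aPar := by rw [hf₂.2 _ (by decide), hf₁.2 _ (by decide)]
    have hrank₂ : s₂.arr aRank = s.arr aRank := by
      rw [hf₂.2 _ (by decide), hf₁.2 _ (by decide)]
    have hne : ∀ m ≤ j, s.arr aOrd m ≠ s.arr aOrd (j + 1) := fun m hm he => by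
      have := hO.inj m (by omega) (j + 1) (by omega) he
      omega
    have hparne : ∀ m, 0 < m → m ≤ j + 1 → s.arr aPar (s.arr aOrd m) ≠ s.arr aOrd (j + 1) := by
      intro m h0 hm
      obtain ⟨j', hj', hc⟩ := hO.exists_parent m h0 (by omega)
      rw [hO.par_child _ _ hc]
      exact hne j' (by omega)
    have key : ∀ c, c = (if 0 < s.arr aRank (s.arr aOrd (j + 1)) ∧
          s.arr aRank (s.arr aOrd (j + 1)) < s₂.arr aCol (s.arr aPar (s.arr aOrd (j + 1)))
          then s.arr aRank (s.arr aOrd (j + 1)) else 1) →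
        Function.update (s₂.arr aCol) (s.arr aOrd (j + 1)) c r = s.reg rBest ∧
        ∀ m, 0 < m → m ≤ j + 1 →
          Function.update (s₂.arr aCol) (s.arr aOrd (j + 1)) c (s.arr aOrd m) =
          if 0 < s.arr aRank (s.arr aOrd m) ∧ s.arr aRank (s.arr aOrd m) <
            Function.update (s₂.arr aCol) (s.arr aOrd (j + 1)) c (s.arr aPar (s.arr aOrd m))
          then s.arr aRank (s.arr aOrd m) else 1 := by
      intro c hc
      refine ⟨?_, fun m h0 hm => ?_⟩
      · rw [Function.update_of_ne (hO.ord_zero ▸ hne 0 (Nat.zero_le _)), hcolr]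
      · rw [Function.update_of_ne (hparne m h0 hm)]
        by_cases hmj : m = j + 1
        · rw [hmj, Function.update_self, hc]
        · rw [Function.update_of_ne (hne m (by omega))]
          exact hcol m h0 (by omega)
    refine ⟨by rw [hE₂.num, hI₂]; omega, Runs.of_wp ?_⟩
    simp only [colorStep, wp, Memory.setReg_reg, Memory.setReg_arr, Memory.setArr_reg,
      Memory.setArr_arr, hI₂, hord₂, hpar₂, hrank₂, hE₂.one, hE₂.zero, reduceIte,
      Nat.reduceEqDiff]
    refine ⟨fun h => ⟨fun h' => ⟨by omega, by omega, trivial, key _ ?_⟩, fun h' =>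
      ⟨by omega, by omega, trivial, key _ ?_⟩⟩, fun h => ⟨by omega, by omega, trivial, key _ ?_⟩⟩
    · rw [if_pos ⟨h, h'⟩]
    · rw [if_neg fun h'' => h' h''.2]
    · rw [if_neg fun h'' => h h''.1]
  · rintro t s₂ hf₂ ⟨-, hI₂, -⟩
    rw [hI₂, (hE₁.frame hf₂ (by decide) (by decide)).num]
    omega
  · rintro t s₂ hf₂ ⟨t', rfl, ht', -, hcolr, hcol⟩
    have hbest₂ : s₂.reg rBest = s.reg rBest := by
      rw [hf₂.1 _ (by decide), hf₁.1 _ (by decide)]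
    apply Runs.of_wp
    simp only [wp, Memory.setReg_reg, Memory.setReg_arr, hbest₂, reduceIte]
    refine ⟨by omega, trivial, hcolr, fun x u hxu hu => ?_⟩
    obtain ⟨m, hm, rfl⟩ := hO.surj u hu
    have h0 : 0 < m := by
      rcases Nat.eq_zero_or_pos m with rfl | h0
      · exact absurd (hO.ord_zero ▸ hxu) (hroot x)
      · exact h0
    rw [hcol m h0 (by omega), hO.par_child _ _ hxu]

end Sweeps

/-! ### The partition and the correctness of the whole program -/

section Solve

variable {n : ℕ} {G : SimpleGraph (Fin n)} {off nbr : ℕ → ℕ}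

/-- By the rank bounds the class of `v` never exceeds `mst G p v`. So every class below that of `y`
is the rank of a child of sufficient degree, and this child keeps its rank because it is below the
class of `y`. -/
theorem valid_of_isRanked (hG : G.IsTree) {p : Fin n} {rank col : ℕ → ℕ}
    (hrank : ∀ v, IsRanked G p v rank) (hp : col p = st G p)
    (hcol : ∀ x u : Fin n, u ∈ children G p x → col u =
      if 0 < rank u ∧ rank u < col x then rank u else 1) :
    Valid G (deg G) Set.univ fun v : Fin n => col v := by
  have hpos : ∀ v, 1 ≤ mst G p v := fun v => by
    rw [mst_eq_fill hG]
    omega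
  have hle : ∀ v : Fin n, 1 ≤ col v ∧ col v ≤ mst G p v := by
    intro v
    by_cases hv : v = p
    · subst hv
      have := hpos v
      rw [mst_self] at this ⊢
      omega
    · obtain ⟨w, hw, hc⟩ := exists_mem_branch hG hv
      have hvw : v ∈ children G p w := by
        rw [mem_children_iff hG, ← Set.mem_compl_iff, branch_compl hG hw.symm]
        exact ⟨hw.symm, hc⟩
      have h1 := (hrank w).1 v hvw
      have h2 := hpos v
      rw [hcol w v hvw]
      split_ifs <;> omega
  intro y _
  refine ⟨(hle y).1, fun i h1 h2 => ?_⟩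
  obtain ⟨u, hu, hd, hi⟩ := (hrank y).2 i h1 (h2.trans_le (hle y).2)
  refine ⟨u, trivial, hu.1.symm, hd, ?_⟩
  change col u = i
  rw [hcol y u hu, hi, if_pos ⟨h1, h2⟩]

theorem runs_solve (hG : G.IsTree) (hA : IsAdjList G off nbr) {W : ℕ} (hW : 10 * n ≤ W) :
    Runs W solve (inputMemory n off nbr) fun t s => t ≤ 1000 * n ∧ IsSolution G s := by
  have hn : 0 < n := by
    obtain ⟨v⟩ := hG.connected.nonempty
    exact v.pos
  have hoff := hA.off_last hG
  set r : Fin n := ⟨0, hn⟩ with hr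
  unfold solve
  have step1 : Runs W (.const rOne 1) (inputMemory n off nbr) fun t s' => t = 1 ∧
      IsEnv n off nbr s' ∧ s'.reg rRoot = 0 ∧ ∀ q, s'.arr aCnt q = 0 := by
    apply Runs.of_wp
    simp only [wp, Memory.setReg_reg, Memory.setReg_arr]
    refine ⟨by omega, trivial, ⟨?_, ?_, ?_, ?_, ?_⟩, ?_, fun q => ?_⟩ <;> simp [inputMemory]
  refine Runs.seq (step1.mono ?_)
  rintro t₁ s₁ - ⟨rfl, hE₁, hroot₁, hcnt₁⟩
  refine Runs.seq ((runs_search (hA.isRooted hG r) hE₁.zero hE₁.one hE₁.num hroot₁ hE₁.off_eq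
    hE₁.nbr_eq (by omega)).mono ?_)
  rintro t₂ s₂ hf₂ ⟨ht₂, hO₂⟩
  have hE₂ := hE₁.frame hf₂ (by decide) (by decide)
  refine Runs.seq ((runs_sweepUp hG hA hW hE₂ (r := r)
    (fun q => by rw [hf₂.2 _ (by decide), hcnt₁]) hO₂).mono ?_)
  rintro t₃ s₃ hf₃ ⟨ht₃, hcnt₃, hval₃, -⟩
  have hE₃ := hE₂.frame hf₃ (by decide) (by decide)
  refine Runs.seq ((runs_sweepDown hG hA hW hE₃ hcnt₃ (r := r) ?_ hval₃).mono ?_)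
  · rw [hf₃.2 _ (by decide), hf₃.2 _ (by decide)]
    exact hO₂
  rintro t₄ s₄ hf₄ ⟨ht₄, hcnt₄, hst₄, p, harg₄, hbest₄, hmax⟩
  have hE₄ := hE₃.frame hf₄ (by decide) (by decide)
  -- The partition must be built from a vertex of maximal number, and the downward sweep has
  -- overwritten the ranks; hence a second search and upward sweep.
  have step5 : Runs W (.copy rRoot rArg) s₄ fun t s' => t = 1 ∧ s'.reg rRoot = p := by
    apply Runs.of_wp
    simp [wp, harg₄]
  refine Runs.seq (step5.mono ?_)
  rintro t₅ s₅ hf₅ ⟨rfl, hroot₅⟩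
  have hE₅ := hE₄.frame hf₅ (by decide) (by decide)
  refine Runs.seq ((runs_search (hA.isRooted hG p) hE₅.zero hE₅.one hE₅.num hroot₅ hE₅.off_eq
    hE₅.nbr_eq (by omega)).mono ?_)
  rintro t₆ s₆ hf₆ ⟨ht₆, hO₆⟩
  have hE₆ := hE₅.frame hf₆ (by decide) (by decide)
  refine Runs.seq ((runs_sweepUp hG hA hW hE₆ (r := p)
    (fun q => by rw [hf₆.2 _ (by decide), hf₅.2 _ (by decide), hcnt₄]) hO₆).mono ?_)
  rintro t₇ s₇ hf₇ ⟨ht₇, -, -, hrank₇⟩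
  have hE₇ := hE₆.frame hf₇ (by decide) (by decide)
  have hR := hA.isRooted hG p
  refine (runs_color hE₇ (r := p) (Ch := IsChild G p) hn (by omega) ?_ hR.not_root ?_).mono ?_
  · rw [hf₇.1 _ (by decide), hf₆.1 _ (by decide), hroot₅]
  · rw [hf₇.2 _ (by decide), hf₇.2 _ (by decide)]
    exact hO₆
  rintro t₈ s₈ hf₈ ⟨ht₈, hnum₈, hp₈, hcol₈⟩
  have hbest₇ : s₇.reg rBest = st G p := by
    rw [hf₇.1 _ (by decide), hf₆.1 _ (by decide), hf₅.1 _ (by decide), hbest₄]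
  have hne : Nonempty (Fin n) := ⟨r⟩
  have htr : strongTransitivity G = st G p := by
    obtain ⟨⟨v, hv⟩, hub⟩ := isGreatest_strongTransitivity G
    exact le_antisymm (hv ▸ hmax v) (hub ⟨p, rfl⟩)
  have hvalid : Valid G (deg G) Set.univ fun v : Fin n => s₈.arr aCol v :=
    valid_of_isRanked hG hrank₇ (hp₈.trans hbest₇) fun x u hu =>
      hcol₈ x u (isChild_iff.2 hu) u.2
  refine ⟨by omega, ?_, fun v => ?_, ?_⟩
  · rw [hnum₈, hbest₇, htr]
  · rw [hf₈.2 _ (by decide), hf₇.2 _ (by decide), hf₆.2 _ (by decide), hf₅.2 _ (by decide), hst₄]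
  · have h1 := hvalid.isPartition (r := p) fun v => by
      have h2 := hvalid.le_setNumber (Set.mem_univ v)
      rw [← st_eq_setNumber] at h2
      rw [hp₈, hbest₇]
      exact h2.trans (hmax v)
    rw [hp₈, hbest₇] at h1
    rw [htr]
    exact h1

/-- `Runs` assumes a bound on every memory cell, so the zeros in unused cells of the input matter
here. -/
theorem bounded_inputMemory (hG : G.IsTree) (hA : IsAdjList G off nbr) {W : ℕ}
    (hW : 10 * n ≤ W) : (inputMemory n off nbr).Bounded W := by
  have hoff := hA.off_last hG
  have hadj : ∀ e < off n, nbr e ≤ n := by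
    intro e he
    have key : ∀ m ≤ n, e < off m → ∃ x < m, e ∈ cells off x := by
      intro m
      induction m with
      | zero =>
        intro _ h
        rw [hA.off_zero] at h
        omega
      | succ m ih =>
        intro hm h
        by_cases hlt : e < off m
        · obtain ⟨x, hx, hxe⟩ := ih (by omega) hlt
          exact ⟨x, by omega, hxe⟩
        · exact ⟨m, m.lt_succ_self, Finset.mem_Ico.2 ⟨not_lt.1 hlt, h⟩⟩
    obtain ⟨x, hx, hxe⟩ := key n le_rfl he
    obtain ⟨u, -, h⟩ := hA.adj_of_mem_cells (v := ⟨x, hx⟩) hxe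
    rw [h]
    exact u.2.le
  refine ⟨fun x => ?_, fun a i => ?_⟩
  · simp only [inputMemory]
    split_ifs <;> omega
  · simp only [inputMemory]
    split_ifs
    · by_cases hi : i ≤ n
      · have := off_le_off hA.off_le hi
        omega
      · rw [hA.off_unused i (by omega)]
        omega
    · by_cases hi : i < off n
      · have := hadj i hi
        omega
      · rw [hA.nbr_unused i (by omega)]
        omega
    · exact Nat.zero_le W

end Solve
end StrongTrans

theorem mainTheorem4 :
    -- one program solves the problem on all trees in linear time, with words of size `O(log n)`
    (∃ (P : StrongTrans.Program) (C : ℕ),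
      ∀ (n : ℕ) (G : SimpleGraph (Fin n)) (off nbr : ℕ → ℕ),
        G.IsTree → StrongTrans.IsAdjList G off nbr →
        ∃ (t : ℕ) (s : StrongTrans.Memory), t ≤ C * n ∧
          StrongTrans.Exec (C * n) P (StrongTrans.inputMemory n off nbr) t s ∧
          StrongTrans.IsSolution G s) ∧
    -- the rules behind the computation
    (∀ (V : Type*) [Finite V] (G : SimpleGraph V), G.IsTree →
      -- `Tr_st` is the maximum of the strong transitive numbers
      IsGreatest (Set.range (StrongTrans.st G)) (StrongTrans.strongTransitivity G) ∧
      -- the bottom-up rule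
      (∀ (c x : V) (k : ℕ) (v : Fin k → V), Function.Injective v →
        Set.range v = StrongTrans.children G c x →
        Monotone (fun i => StrongTrans.mst G c (v i)) →
        ∃ z : ℕ, IsGreatest {m : ℕ | ∃ s : Fin m → Fin k, StrictMono s ∧
            ∀ q : Fin m, (q : ℕ) + 1 ≤ StrongTrans.mst G c (v (s q)) ∧
              StrongTrans.deg G x ≤ StrongTrans.deg G (v (s q))} z ∧
          StrongTrans.mst G c x = 1 + z) ∧
      -- its value at the root, and its independence of the root above a child
      (∀ c : V, StrongTrans.mst G c c = StrongTrans.st G c) ∧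
      (∀ c x v : V, v ∈ StrongTrans.children G c x →
        StrongTrans.mst G x v = StrongTrans.mst G c v) ∧
      -- the rerooting rule
      (∀ (x v : V) (h : G.Adj x v),
        (StrongTrans.Required h → StrongTrans.mst G v x + 1 = StrongTrans.st G x) ∧
        (¬ StrongTrans.Required h → StrongTrans.mst G v x = StrongTrans.st G x)) ∧
      -- which children of the root are required
      (∀ (x : V) (k p z : ℕ) (v : ℕ → V) (l : ℕ → ℕ) (R : ℕ → Prop),
        Set.BijOn v (Set.Icc 1 k) (G.neighborSet x) → p ≤ k →
        z = StrongTrans.st G x →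
        (∀ i, l i = StrongTrans.mst G x (v i)) →
        (∀ i, R i ↔ ∃ h : G.Adj x (v i), StrongTrans.Required h) →
        (∀ i ∈ Set.Icc 1 p, StrongTrans.deg G (v i) < k) →
        (∀ i ∈ Set.Icc (p + 1) k, k ≤ StrongTrans.deg G (v i)) →
        MonotoneOn l (Set.Icc (p + 1) k) →
        (k + 1 = z → ∀ i ∈ Set.Icc 1 k, R i) ∧
        (z < k + 1 → k + 1 = z + p →
          (∀ i ∈ Set.Icc 1 p, ¬ R i) ∧ ∀ i ∈ Set.Icc (p + 1) k, R i) ∧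
        (z < k + 1 → z + p < k + 1 →
          (∀ i ∈ Set.Icc 1 p, ¬ R i) ∧
          (∀ i ∈ Set.Icc (p + 1) (k + 1 - z), ¬ R i) ∧
          ∀ i ∈ Set.Icc (k + 2 - z) k,
            ((∀ j ∈ Set.Icc (k + 2 - z) i, j - (k + 1 - z) ≤ l (j - 1)) → ¬ R i) ∧
            ((∃ j ∈ Set.Icc (k + 2 - z) i, l (j - 1) < j - (k + 1 - z)) → R i)))) := by
  refine ⟨⟨StrongTrans.solve, 1000, fun n G off nbr hG hA => ?_⟩, fun V _ G hG => ?_⟩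
  -- Numbers up to `10 * n` would suffice; the constant `1000` comes from the running time and
  -- serves for both bounds.
  · obtain ⟨t, s, he, -, ht, hs⟩ := StrongTrans.runs_solve hG hA (W := 1000 * n) (by omega)
      (StrongTrans.bounded_inputMemory hG hA (by omega))
    exact ⟨t, s, ht, he, hs⟩
  · have := hG.connected.nonempty
    refine ⟨StrongTrans.isGreatest_strongTransitivity G, fun c x k v hv hr hm =>
      ⟨_, StrongTrans.isGreatest_fill_children hG c x k v hv hr hm,
        StrongTrans.mst_eq_fill hG c x⟩, StrongTrans.mst_self G, fun c x v hv => ?_,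
      fun x v h => ⟨StrongTrans.mst_add_one_eq_of_required hG h,
        StrongTrans.mst_eq_of_not_required hG h⟩, StrongTrans.required_rules hG⟩
    rw [StrongTrans.mst_eq_of_mem_children hG hv, StrongTrans.mst_eq_branchNumber hG hv.1
      (StrongTrans.root_notMem_branch hG hv.1)]
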